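/- **Theorem 4.1.** Define differential polynomials $\mathcal L_j[x]$ in a function $x=x(z)$ by $\mathcal L_0[x]=1$ and $$\frac{d}{dz}\mathcal L_{j+1}[x]=\Bigl(\frac{d^3}{dz^3}-8x\frac{d}{dz}-4\frac{dx}{dz}\Bigr)\mathcal L_j[x],$$ where all constants of integration are taken to be zero. For $m\ge 1$ let $P_m$ be the polynomial with $\mathcal L_{m+1}[x]=-4\bigl(x^{(2m)}-P_m(x,x',\dots,x^{(2m-2)})\bigr)$. The $2m$-dimensional first Painlevé hierarchy is the system $$x_1'=x_2,\ \dots,\ x_{2m-1}'=x_{2m},\qquad x_{2m}'=P_m(x_1,\dots,x_{2m-1})+z,$$ with weights $p_i=i+1$ $(i=1,\dots,2m)$. Write $f_i^A$ for its right-hand sides with $z$ replaced by $0$. For $1\le k\le m$ put $$c_j(k)=(-1)^{j+1}\,j!\,\frac{k(k+1)}2,\qquad j=1,\dots,2m .$$ Then: 1. $c(k)$ satisfies $-p_ic_i(k)=f_i^A(c(k))$ for all $i$, and the Kovalevskaya exponents associated with $c(k)$, i.e. the eigenvalues, with multiplicity, of the matrix $K=\bigl(\partial f_i^A/\partial x_j(c(k))+p_i\delta_{ij}\bigr)_{i,j}$,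 are the $2m$ integers $$2,4,\dots,2m-2k;\qquad 2k+3,2k+5,\dots,2m+1;\qquad 2m+4,2m+6,\dots,2m+2k+2;\qquad -1,-3,\dots,-(2k-1)$$ (with $m-k$, $m-k$, $k$ and $k$ members, respectively). 2. The Laurent series solutions $x_i=c_i(k)(z-z_0)^{-p_i}+\sum_{n\ge1}a_{i,n}(z-z_0)^{-p_i+n}$ contain $2m-k+1$ free parameters, including $z_0$: there are exactly $2m-k$ positive exponents $n$, and for every $z_0\in\mathbb C$ and every choice of complex numbers $\alpha_n$, indexed by these $n$, there is exactly one formal solution of this form with $a_{1,n}=\alpha_n$ for all positive exponents $n$. Each such formal solution converges in a punctured disc $0<|z-z_0|<r$, $r>0$, and is a solution of the system there. 3. For $k=1$ there are thus $2m$ free parameters and the Laurent series represents a general solution: for every $z_1\in\mathbb C$ there is a non-empty open set $U\subset\mathbb C^{2m}$ such that every $y\in U$ is the value at $z_1$ of one of these Laurent series solutions, with a pole $z_0\ne z_1$ and a punctured disc of convergence around $z_0$ that contains $z_1$. -/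

import Mathlib

noncomputable section

open MvPolynomial

namespace PainleveI

/-! ### The Lenard recursion on differential polynomials

Differential polynomials in one function `x` are elements of `MvPolynomial ℕ ℂ`, the variable
`X n` standing for the `n`-th derivative of `x`. -/

/-- The total derivative `d/dz` on differential polynomials: `x^(n) ↦ x^(n+1)`. -/
def totalDeriv : Derivation ℂ (MvPolynomial ℕ ℂ) (MvPolynomial ℕ ℂ) :=
  mkDerivation ℂ fun n => X (n + 1)

/-- `L 0 = 1` and `d/dz L (j+1) = (d³/dz³ - 8 x d/dz - 4 x') L j`, the constants of integration
being zero (so that every `L j` is quasi-homogeneous). -/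
structure IsLenardSequence (L : ℕ → MvPolynomial ℕ ℂ) : Prop where
  zero : L 0 = 1
  succ : ∀ j, totalDeriv (L (j + 1)) =
    totalDeriv (totalDeriv (totalDeriv (L j))) - 8 * X 0 * totalDeriv (L j) - 4 * X 1 * L j
  const : ∀ j, constantCoeff (L (j + 1)) = 0

/-- An auxiliary explicit construction, used to prove that a Lenard sequence exists. -/
def lenardAux : ℕ → MvPolynomial ℕ ℂ
  | 0 => 1
  | j + 1 => C (1 / 2) *
      ((∑ i : Fin (j + 1),
          (2 * lenardAux i * totalDeriv (totalDeriv (lenardAux (j - i)))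
            - totalDeriv (lenardAux i) * totalDeriv (lenardAux (j - i))
            - 8 * X 0 * (lenardAux i * lenardAux (j - i))))
        - ∑ i : Fin j, lenardAux (i + 1) * lenardAux (j - i))
  decreasing_by all_goals omega

lemma totalDeriv_X (n : ℕ) : totalDeriv (X n) = X (n + 1) := mkDerivation_X _ _ _

lemma lenardAux_zero : lenardAux 0 = 1 := by rw [lenardAux]

lemma two_mul_lenardAux_succ (j : ℕ) : 2 * lenardAux (j + 1) =
    (∑ i ∈ Finset.range (j + 1),
          (2 * lenardAux i * totalDeriv (totalDeriv (lenardAux (j - i)))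
            - totalDeriv (lenardAux i) * totalDeriv (lenardAux (j - i))
            - 8 * X 0 * (lenardAux i * lenardAux (j - i))))
        - ∑ i ∈ Finset.range j, lenardAux (i + 1) * lenardAux (j - i) := by
  rw [lenardAux, ← mul_assoc, Finset.sum_range, Finset.sum_range]
  have : (2 : MvPolynomial ℕ ℂ) * C (1 / 2) = 1 := by
    rw [← map_ofNat C 2, ← C_mul]; norm_num
  rw [this, one_mul]

lemma lenardAux_quadratic (j : ℕ) :
    ∑ p ∈ Finset.HasAntidiagonal.antidiagonal (j + 1), lenardAux p.1 * lenardAux p.2 =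
      ∑ p ∈ Finset.HasAntidiagonal.antidiagonal j, (2 * lenardAux p.1 * totalDeriv (totalDeriv (lenardAux p.2))
            - totalDeriv (lenardAux p.1) * totalDeriv (lenardAux p.2)
            - 8 * X 0 * (lenardAux p.1 * lenardAux p.2)) := by
  have h := two_mul_lenardAux_succ j
  rw [Finset.Nat.sum_antidiagonal_eq_sum_range_succ_mk,
    Finset.Nat.sum_antidiagonal_eq_sum_range_succ_mk,
    Finset.sum_range_succ, Finset.sum_range_succ']
  have h2 : ∀ i, j + 1 - (i + 1) = j - i := fun i => by omega
  simp only [h2, Nat.sub_self, Nat.sub_zero, lenardAux_zero, one_mul, mul_one]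
  linear_combination h

lemma lenardAux_succ (j : ℕ) : totalDeriv (lenardAux (j + 1)) =
    totalDeriv (totalDeriv (totalDeriv (lenardAux j)))
      - 8 * X 0 * totalDeriv (lenardAux j) - 4 * X 1 * lenardAux j := by
  induction j using Nat.strong_induction_on with
  | _ j ih =>
  have h := congrArg totalDeriv (lenardAux_quadratic j)
  have h8 : totalDeriv (8 : MvPolynomial ℕ ℂ) = 0 := by
    simpa using totalDeriv.map_natCast 8
  have h2 : totalDeriv (2 : MvPolynomial ℕ ℂ) = 0 := by
    simpa using totalDeriv.map_natCast 2
  simp only [map_sum, map_sub, Derivation.leibniz, smul_eq_mul, totalDeriv_X, h8, h2, mul_zero,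
    add_zero, zero_add] at h
  -- left side
  have hl : ∑ p ∈ Finset.HasAntidiagonal.antidiagonal (j + 1),
      (lenardAux p.1 * totalDeriv (lenardAux p.2) + lenardAux p.2 * totalDeriv (lenardAux p.1)) =
      2 * (∑ p ∈ Finset.HasAntidiagonal.antidiagonal j, lenardAux p.1 * totalDeriv (lenardAux (p.2 + 1))) := by
    rw [Finset.sum_add_distrib, two_mul,
      Finset.Nat.antidiagonal_succ', Finset.sum_cons, Finset.sum_cons]
    have h1 : totalDeriv (lenardAux 0) = 0 := by rw [lenardAux_zero]; exact totalDeriv.map_one_eq_zero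
    simp only [h1, mul_zero, zero_add, Finset.sum_map]
    congr 1
    have := Finset.Nat.sum_antidiagonal_swap (n := j + 1)
      (f := fun p => lenardAux p.1 * totalDeriv (lenardAux p.2))
    rw [Finset.Nat.antidiagonal_succ', Finset.sum_cons, Finset.sum_cons] at this
    simp only [h1, mul_zero, zero_add, Finset.sum_map, Prod.fst_swap, Prod.snd_swap] at this
    exact this
  have hr : ∑ p ∈ Finset.HasAntidiagonal.antidiagonal j,
      (totalDeriv (lenardAux p.1) * totalDeriv (totalDeriv (lenardAux p.2))
        - totalDeriv (lenardAux p.2) * totalDeriv (totalDeriv (lenardAux p.1))) = 0 := by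
    rw [Finset.sum_sub_distrib, sub_eq_zero]
    exact (Finset.Nat.sum_antidiagonal_swap (n := j)
      (f := fun p => totalDeriv (lenardAux p.2) * totalDeriv (totalDeriv (lenardAux p.1))))
  have hs : ∑ p ∈ Finset.HasAntidiagonal.antidiagonal j,
      (X 0 * (lenardAux p.1 * totalDeriv (lenardAux p.2)) -
        X 0 * (lenardAux p.2 * totalDeriv (lenardAux p.1))) = 0 := by
    rw [Finset.sum_sub_distrib, sub_eq_zero]
    exact (Finset.Nat.sum_antidiagonal_swap (n := j)
      (f := fun p => X 0 * (lenardAux p.2 * totalDeriv (lenardAux p.1))))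
  rw [hl] at h
  have key : 2 * ∑ p ∈ Finset.HasAntidiagonal.antidiagonal j, lenardAux p.1 *
      (totalDeriv (lenardAux (p.2 + 1)) - (totalDeriv (totalDeriv (totalDeriv (lenardAux p.2)))
      - 8 * X 0 * totalDeriv (lenardAux p.2) - 4 * X 1 * lenardAux p.2)) = 0 := by
    simp only [mul_sub (lenardAux _), Finset.sum_sub_distrib, mul_sub (2 : MvPolynomial ℕ ℂ)]
    rw [h]
    simp only [Finset.mul_sum, ← Finset.sum_sub_distrib]
    have : ∑ p ∈ Finset.HasAntidiagonal.antidiagonal j,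
      ((totalDeriv (lenardAux p.1) * totalDeriv (totalDeriv (lenardAux p.2))
        - totalDeriv (lenardAux p.2) * totalDeriv (totalDeriv (lenardAux p.1)))
        + 8 * (X 0 * (lenardAux p.1 * totalDeriv (lenardAux p.2)) -
        X 0 * (lenardAux p.2 * totalDeriv (lenardAux p.1)))) = 0 := by
      rw [Finset.sum_add_distrib, ← Finset.mul_sum, hr, hs]; simp
    rw [← this]
    refine Finset.sum_congr rfl fun p _ => ?_
    ring
  rw [mul_eq_zero_iff_left two_ne_zero] at key
  rw [Finset.sum_eq_single (0, j)] at key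
  · simp only [lenardAux_zero, one_mul] at key
    exact sub_eq_zero.mp key
  · rintro ⟨a, b⟩ hab hne
    have hab' : a + b = j := by simpa using hab
    have : b < j := by
      rcases Nat.eq_zero_or_pos a with rfl | ha
      · exact absurd (by simpa using hab') (by simpa using hne)
      · omega
    rw [ih b this, sub_self, mul_zero]
  · intro hn
    simp at hn

lemma constantCoeff_totalDeriv (p : MvPolynomial ℕ ℂ) : constantCoeff (totalDeriv p) = 0 := by
  induction p using MvPolynomial.induction_on with
  | C a =>
    rw [show totalDeriv (C a) = 0 from totalDeriv.map_algebraMap a, map_zero]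
  | add p q hp hq => simp [hp, hq]
  | mul_X p n hp => simp [Derivation.leibniz, totalDeriv_X, hp]

lemma lenardAux_const (j : ℕ) : constantCoeff (lenardAux (j + 1)) = 0 := by
  induction j using Nat.strong_induction_on with
  | _ j ih =>
  have h := congrArg constantCoeff (two_mul_lenardAux_succ j)
  have : ∑ i ∈ Finset.range j,
      constantCoeff (lenardAux (i + 1)) * constantCoeff (lenardAux (j - i)) = 0 :=
    Finset.sum_eq_zero fun i hi => by rw [ih i (Finset.mem_range.mp hi), zero_mul]
  simp only [map_mul, map_sub, map_sum, constantCoeff_totalDeriv, this, constantCoeff_X, mul_zero,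
    zero_mul, sub_zero, Finset.sum_const_zero, map_ofNat] at h
  simpa using h

lemma pderiv_totalDeriv (n : ℕ) (p : MvPolynomial ℕ ℂ) :
    pderiv (n + 1) (totalDeriv p) = totalDeriv (pderiv (n + 1) p) + pderiv n p := by
  induction p using MvPolynomial.induction_on with
  | C a => simp [show totalDeriv (C a) = 0 from totalDeriv.map_algebraMap a]
  | add p q hp hq => simp only [map_add, hp, hq]; ring
  | mul_X p i hp =>
    have h1 : ∀ a b : ℕ, totalDeriv (pderiv a (X b)) = 0 := fun a b => by
      rw [pderiv_X, Pi.single_apply]; split_ifs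
      · exact totalDeriv.map_one_eq_zero
      · exact map_zero _
    have h2 : pderiv (n + 1) (X (i + 1) : MvPolynomial ℕ ℂ) = pderiv n (X i) := by
      simp [pderiv_X, Pi.single_apply]
    simp only [Derivation.leibniz, smul_eq_mul, map_add, totalDeriv_X, hp, h1, h2]
    ring

/-- Only constants have total derivative zero. -/
lemma eq_C_of_totalDeriv_eq_zero {p : MvPolynomial ℕ ℂ} (hp : totalDeriv p = 0) :
    p = C (constantCoeff p) := by
  have hd : ∀ n, pderiv n p = 0 := by
    obtain ⟨N, hN⟩ : ∃ N, ∀ i ∈ p.vars, i < N :=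
      ⟨p.vars.sup id + 1, fun i hi => Nat.lt_succ_of_le (Finset.le_sup (f := id) hi)⟩
    have hbig : ∀ n, N ≤ n → pderiv n p = 0 := fun n hn =>
      pderiv_eq_zero_of_notMem_vars fun h => absurd (hN n h) (by omega)
    have hdown : ∀ d n, N ≤ n + d → pderiv n p = 0 := by
      intro d
      induction d with
      | zero => exact fun n hn => hbig n hn
      | succ d ih =>
        intro n hn
        have h := pderiv_totalDeriv n p
        rw [hp, ih (n + 1) (by omega), map_zero, map_zero, zero_add] at h
        exact h.symm
    exact fun n => hdown N n (by omega)
  ext s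
  rw [coeff_C]
  split_ifs with hs
  · rw [← hs]; rfl
  · obtain ⟨n, hn⟩ : ∃ n, s n ≠ 0 := by
      by_contra! hc
      exact hs (Finsupp.ext fun n => (hc n).symm)
    have h := congrArg (coeff (s - Finsupp.single n 1)) (hd n)
    rw [coeff_pderiv, coeff_zero,
      tsub_add_cancel_of_le (Finsupp.single_le_iff.mpr (Nat.one_le_iff_ne_zero.mpr hn))] at h
    rcases mul_eq_zero.mp h with h | h
    · exact h
    · exact absurd h (by exact Nat.cast_add_one_ne_zero _)

theorem existsUnique_isLenardSequence : ∃! L, IsLenardSequence L := by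
  refine ⟨lenardAux, ⟨lenardAux_zero, lenardAux_succ, lenardAux_const⟩, fun L hL => ?_⟩
  funext j
  induction j with
  | zero => rw [hL.zero, lenardAux_zero]
  | succ j ih =>
    have h : totalDeriv (L (j + 1) - lenardAux (j + 1)) = 0 := by
      rw [map_sub, hL.succ, lenardAux_succ, ih, sub_self]
    have := eq_C_of_totalDeriv_eq_zero h
    rw [map_sub, hL.const, lenardAux_const, sub_zero, map_zero] at this
    exact sub_eq_zero.mp this

/-- The differential polynomials `𝓛_j[x]` of the hierarchy. -/
def lenard : ℕ → MvPolynomial ℕ ℂ := existsUnique_isLenardSequence.choose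

theorem lenard_spec : IsLenardSequence lenard := existsUnique_isLenardSequence.choose_spec.1

theorem lenard_eq_lenardAux : lenard = lenardAux :=
  existsUnique_isLenardSequence.unique lenard_spec
    ⟨lenardAux_zero, lenardAux_succ, lenardAux_const⟩

/-- The differential polynomial `P_m`, determined by `𝓛_{m+1}[x] = -4 (x^(2m) - P_m)`. -/
def painlevePoly (m : ℕ) : MvPolynomial ℕ ℂ := X (2 * m) + C (1 / 4) * lenard (m + 1)

lemma totalDeriv_mem_supported {n : ℕ} {p : MvPolynomial ℕ ℂ}
    (hp : p ∈ supported ℂ {i | i + 1 < n}) : totalDeriv p ∈ supported ℂ {i | i < n} := by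
  have hle : supported ℂ {i | i + 1 < n} ≤ supported ℂ {i | i < n} :=
    supported_mono fun i (hi : i + 1 < n) => Nat.lt_of_succ_lt hi
  rw [supported_eq_adjoin_X] at hp
  suffices h : p ∈ supported ℂ {i | i < n} ∧ totalDeriv p ∈ supported ℂ {i | i < n} from h.2
  induction hp using Algebra.adjoin_induction with
  | mem x hx =>
    obtain ⟨i, hi, rfl⟩ := hx
    rw [totalDeriv_X]
    have hi' : i + 1 < n := hi
    exact ⟨X_mem_supported.mpr (by simp; omega), X_mem_supported.mpr hi'⟩
  | algebraMap r =>
    exact ⟨Subalgebra.algebraMap_mem _ _, by rw [Derivation.map_algebraMap]; exact zero_mem _⟩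
  | add x y _ _ hx hy => exact ⟨add_mem hx.1 hy.1, by rw [map_add]; exact add_mem hx.2 hy.2⟩
  | mul x y _ _ hx hy =>
    refine ⟨mul_mem hx.1 hy.1, ?_⟩
    rw [Derivation.leibniz]
    exact add_mem (mul_mem hx.1 hy.2) (mul_mem hy.1 hx.2)

lemma lenardAux_add_mem_supported (j : ℕ) :
    lenardAux (j + 1) + 4 * X (2 * j) ∈ supported ℂ {i | i + 1 < 2 * j} := by
  induction j using Nat.strong_induction_on with
  | _ j ih =>
  have h0 : totalDeriv (lenardAux 0) = 0 := by
    rw [lenardAux_zero]; exact totalDeriv.map_one_eq_zero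
  have hC : (C (1 / 2) : MvPolynomial ℕ ℂ) * 2 = 1 := by
    rw [← map_ofNat C 2, ← C_mul]; norm_num
  have h := two_mul_lenardAux_succ j
  rw [Finset.sum_range_succ'] at h
  simp only [lenardAux_zero, Nat.sub_zero, mul_one, one_mul, totalDeriv.map_one_eq_zero,
    zero_mul, sub_zero] at h
  rcases Nat.eq_zero_or_pos j with rfl | hj
  · simp only [lenardAux_zero, Finset.range_zero, Finset.sum_empty, zero_add,
      totalDeriv.map_one_eq_zero, map_zero, mul_zero, sub_zero, zero_sub, mul_one] at h
    have : lenardAux (0 + 1) + 4 * X (2 * 0) = 0 := by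
      linear_combination C (1 / 2) * h - (lenardAux 1 + 4 * X 0) * hC
    rw [this]
    exact zero_mem _
  obtain ⟨j, rfl⟩ : ∃ j', j = j' + 1 := ⟨j - 1, by omega⟩
  set S : Subalgebra ℂ (MvPolynomial ℕ ℂ) := supported ℂ {i | i + 1 < 2 * (j + 1)} with hS
  have hmono : ∀ n, n + 1 ≤ 2 * (j + 1) → supported ℂ {i | i < n} ≤ S := fun n hn =>
    supported_mono fun i (hi : i < n) => by simp only [Set.mem_ofPred_eq]; omega
  have hnum : ∀ n : ℕ, (n : MvPolynomial ℕ ℂ) ∈ S := fun n => natCast_mem S n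
  have h2 : (2 : MvPolynomial ℕ ℂ) ∈ S := by exact_mod_cast hnum 2
  have h4 : (4 : MvPolynomial ℕ ℂ) ∈ S := by exact_mod_cast hnum 4
  have h8 : (8 : MvPolynomial ℕ ℂ) ∈ S := by exact_mod_cast hnum 8
  have hX : ∀ i, i + 1 < 2 * (j + 1) → X i ∈ S := fun i hi => X_mem_supported.mpr hi
  -- all earlier terms and their first derivatives are fine
  have hL : ∀ i, i < j + 1 → lenardAux (i + 1) ∈ supported ℂ {l | l < 2 * i + 1} := by
    intro i hi
    have h' := ih i hi
    have h3 : lenardAux (i + 1) = (lenardAux (i + 1) + 4 * X (2 * i)) - 4 * X (2 * i) := by ring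
    rw [h3]
    refine sub_mem (supported_mono ?_ h') (mul_mem (natCast_mem _ 4) (X_mem_supported.mpr ?_))
    · intro l (hl : l + 1 < 2 * i)
      simp only [Set.mem_ofPred_eq]; omega
    · simp
  have hD : ∀ n (p : MvPolynomial ℕ ℂ), p ∈ supported ℂ {l | l < n} →
      totalDeriv p ∈ supported ℂ {l | l < n + 1} := fun n p hp =>
    totalDeriv_mem_supported (by simpa using hp)
  have hLS : ∀ i, i < j + 1 → lenardAux (i + 1) ∈ S := fun i hi => hmono _ (by omega) (hL i hi)
  have hDS : ∀ i, i < j → totalDeriv (lenardAux (i + 1)) ∈ S := fun i hi =>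
    hmono _ (by omega) (hD _ _ (hL i (by omega)))
  have hDDS : ∀ i, i < j → totalDeriv (totalDeriv (lenardAux (i + 1))) ∈ S := fun i hi =>
    hmono _ (by omega) (hD _ _ (hD _ _ (hL i (by omega))))
  -- the leading term
  have hlead : totalDeriv (totalDeriv (lenardAux (j + 1))) + 4 * X (2 * (j + 1)) ∈ S := by
    have h5 : totalDeriv (totalDeriv (lenardAux (j + 1))) + 4 * X (2 * (j + 1)) =
        totalDeriv (totalDeriv (lenardAux (j + 1) + 4 * X (2 * j))) := by
      have h4' : totalDeriv (4 : MvPolynomial ℕ ℂ) = 0 := by simpa using totalDeriv.map_natCast 4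
      simp only [map_add, Derivation.leibniz, smul_eq_mul, h4', mul_zero, add_zero, totalDeriv_X]
      ring_nf
    rw [h5]
    have h6 := ih j (by omega)
    have h7 : {l : ℕ | l + 1 < 2 * j} = {l | l < 2 * j - 1} := by ext l; simp; omega
    rw [h7] at h6
    rcases Nat.eq_zero_or_pos j with rfl | hj'
    · have h6' : lenardAux (0 + 1) + 4 * X (2 * 0) ∈ (⊥ : Subalgebra ℂ (MvPolynomial ℕ ℂ)) := by
        simpa using h6
      obtain ⟨c, hc⟩ := Algebra.mem_bot.mp h6'
      rw [← hc, Derivation.map_algebraMap, map_zero]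
      exact zero_mem _
    · exact hmono _ (by omega) (hD _ _ (hD _ _ h6))
  have hsum1 : ∑ i ∈ Finset.range (j + 1),
      (2 * lenardAux (i + 1) * totalDeriv (totalDeriv (lenardAux (j + 1 - (i + 1))))
        - totalDeriv (lenardAux (i + 1)) * totalDeriv (lenardAux (j + 1 - (i + 1)))
        - 8 * X 0 * (lenardAux (i + 1) * lenardAux (j + 1 - (i + 1)))) ∈ S := by
    refine sum_mem fun i hi => ?_
    have hi' : i < j + 1 := Finset.mem_range.mp hi
    rcases Nat.lt_or_ge i j with hij | hij
    · obtain ⟨b, hb⟩ : ∃ b, j + 1 - (i + 1) = b + 1 := ⟨j - i - 1, by omega⟩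
      rw [hb]
      exact sub_mem (sub_mem (mul_mem (mul_mem h2 (hLS i hi')) (hDDS b (by omega)))
        (mul_mem (hDS i hij) (hDS b (by omega))))
        (mul_mem (mul_mem h8 (hX 0 (by omega))) (mul_mem (hLS i hi') (hLS b (by omega))))
    · have hb : j + 1 - (i + 1) = 0 := by omega
      rw [hb, h0, map_zero, mul_zero, mul_zero, lenardAux_zero, mul_one, sub_zero, zero_sub]
      exact neg_mem (mul_mem (mul_mem h8 (hX 0 (by omega))) (hLS i hi'))
  have hsum2 : ∑ i ∈ Finset.range (j + 1), lenardAux (i + 1) * lenardAux (j + 1 - i) ∈ S := by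
    refine sum_mem fun i hi => ?_
    have hi' : i < j + 1 := Finset.mem_range.mp hi
    obtain ⟨b, hb⟩ : ∃ b, j + 1 - i = b + 1 := ⟨j - i, by omega⟩
    rw [hb]
    exact mul_mem (hLS i hi') (hLS b (by omega))
  set A := ∑ i ∈ Finset.range (j + 1),
      (2 * lenardAux (i + 1) * totalDeriv (totalDeriv (lenardAux (j + 1 - (i + 1))))
        - totalDeriv (lenardAux (i + 1)) * totalDeriv (lenardAux (j + 1 - (i + 1)))
        - 8 * X 0 * (lenardAux (i + 1) * lenardAux (j + 1 - (i + 1))))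
  set B := ∑ i ∈ Finset.range (j + 1), lenardAux (i + 1) * lenardAux (j + 1 - i)
  have hfin : lenardAux (j + 1 + 1) + 4 * X (2 * (j + 1)) =
      C (1 / 2) * (A - B + 2 * (totalDeriv (totalDeriv (lenardAux (j + 1))) + 4 * X (2 * (j + 1)))
        - 8 * X 0 * lenardAux (j + 1)) := by
    linear_combination C (1 / 2) * h - (lenardAux (j + 1 + 1) + 4 * X (2 * (j + 1))) * hC
  rw [hfin]
  exact mul_mem (Subalgebra.algebraMap_mem S (1 / 2 : ℂ)) (sub_mem (add_mem (sub_mem hsum1 hsum2)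
    (mul_mem h2 hlead)) (mul_mem (mul_mem h8 (hX 0 (by omega))) (hLS j (by omega))))

/-- `P_m` involves only `x, x', …, x^(2m-2)`. -/
theorem painlevePoly_mem_supported (m : ℕ) :
    painlevePoly m ∈ supported ℂ {i | i + 1 < 2 * m} := by
  have h := mul_mem (Subalgebra.algebraMap_mem _ (1 / 4 : ℂ)) (lenardAux_add_mem_supported m)
  have h4 : (C (1 / 4) : MvPolynomial ℕ ℂ) * 4 = 1 := by
    rw [← map_ofNat C 4, ← C_mul]; norm_num
  convert h using 1
  rw [painlevePoly, lenard_eq_lenardAux, algebraMap_eq]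
  linear_combination -X (2 * m) * h4

/-! ### Polynomial systems, Kovalevskaya exponents and Laurent series solutions

A polynomial system `dx_i/dz = F_i(x_1, …, x_n, z)` is a family
`F : Fin n → MvPolynomial (Option (Fin n)) ℂ`; the variable `some i` is the dependent variable with
index `i` and `none` is the independent variable `z`. -/

/-- The autonomous part `f_i^A(x) = F_i(x, 0)`. -/
def autonomousPart {n : ℕ} (F : Fin n → MvPolynomial (Option (Fin n)) ℂ) (i : Fin n) :
    MvPolynomial (Fin n) ℂ :=
  aeval (fun o : Option (Fin n) => o.elim 0 X) (F i)

/-- `c` is a root of `-p_i c_i = f_i^A(c)`. -/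
def IsIndicialRoot {n : ℕ} (F : Fin n → MvPolynomial (Option (Fin n)) ℂ) (p : Fin n → ℕ)
    (c : Fin n → ℂ) : Prop :=
  ∀ i, -(p i : ℂ) * c i = eval c (autonomousPart F i)

/-- The Kovalevskaya matrix `∂f_i^A/∂x_j (c) + p_i δ_ij` of a quasi-homogeneous system `F` with
weights `p`. -/
def kovalevskayaMatrix {n : ℕ} (F : Fin n → MvPolynomial (Option (Fin n)) ℂ) (p : Fin n → ℕ)
    (c : Fin n → ℂ) : Matrix (Fin n) (Fin n) ℂ :=
  Matrix.of fun i j => eval c (pderiv j (autonomousPart F i)) + if i = j then (p i : ℂ) else 0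

/-- The Kovalevskaya exponents: the eigenvalues of the Kovalevskaya matrix, with multiplicity. -/
def kovalevskayaExponents {n : ℕ} (F : Fin n → MvPolynomial (Option (Fin n)) ℂ) (p : Fin n → ℕ)
    (c : Fin n → ℂ) : Multiset ℂ :=
  (kovalevskayaMatrix F p c).charpoly.roots

/-- `x` is a formal Laurent series solution at `z₀` of the form
`x_i = c_i (z - z₀)^(-p_i) + a_{i,1} (z - z₀)^(-p_i+1) + ⋯`.  The variable of the Laurent series
is `z - z₀`, so that `z` itself is the series `(z - z₀) + z₀`. -/
structure IsLaurentSolution {n : ℕ} (F : Fin n → MvPolynomial (Option (Fin n)) ℂ) (p : Fin n → ℕ)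
    (c : Fin n → ℂ) (z₀ : ℂ) (x : Fin n → LaurentSeries ℂ) : Prop where
  leading : ∀ i, (x i).coeff (-(p i : ℤ)) = c i
  order : ∀ i, ∀ l : ℤ, l < -(p i : ℤ) → (x i).coeff l = 0
  equation : ∀ i, LaurentSeries.derivative ℂ (x i) =
    aeval (fun o : Option (Fin n) => o.elim (HahnSeries.single 1 1 + HahnSeries.C z₀) x) (F i)

/-- On the punctured disc `0 < |z - z₀| < r` the Laurent series `x_i` converge to the functions
`ξ_i`, and these solve the system. -/
def ConvergesToSolution {n : ℕ} (F : Fin n → MvPolynomial (Option (Fin n)) ℂ) (z₀ : ℂ)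
    (x : Fin n → LaurentSeries ℂ) (r : ℝ) (ξ : Fin n → ℂ → ℂ) : Prop :=
  ∀ z, 0 < ‖z - z₀‖ → ‖z - z₀‖ < r → ∀ i,
    HasSum (fun l : ℤ => (x i).coeff l * (z - z₀) ^ l) (ξ i z) ∧
    HasDerivAt (ξ i) (eval (fun o : Option (Fin n) => o.elim z fun j => ξ j z) (F i)) z

/-- The Laurent series solutions with leading coefficients `c` represent a general solution: at
every point `z₁`, their values fill a non-empty open set of initial values. -/
def RepresentsGeneralSolution {n : ℕ} (F : Fin n → MvPolynomial (Option (Fin n)) ℂ)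
    (p : Fin n → ℕ) (c : Fin n → ℂ) : Prop :=
  ∀ z₁ : ℂ, ∃ U : Set (Fin n → ℂ), IsOpen U ∧ U.Nonempty ∧ ∀ y ∈ U,
    ∃ (z₀ : ℂ) (x : Fin n → LaurentSeries ℂ) (r : ℝ) (ξ : Fin n → ℂ → ℂ),
      IsLaurentSolution F p c z₀ x ∧ ConvergesToSolution F z₀ x r ξ ∧
      0 < ‖z₁ - z₀‖ ∧ ‖z₁ - z₀‖ < r ∧ ∀ i, ξ i z₁ = y i

/-! ### The first Painlevé hierarchy as a first order system

Indices are shifted by one: the index `i : Fin (2 * m)` stands for `x_{i+1}`, that is, for the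
`i`-th derivative of `x`. -/

/-- The system `x_1' = x_2, …, x_{2m-1}' = x_{2m}, x_{2m}' = P_m(x_1, …, x_{2m-1}) + z`.
(`P_m` does not contain the variables that are replaced by `0`.) -/
def field (m : ℕ) (i : Fin (2 * m)) : MvPolynomial (Option (Fin (2 * m))) ℂ :=
  if h : (i : ℕ) + 1 < 2 * m then X (some ⟨i + 1, h⟩)
  else aeval (fun n : ℕ => if hn : n < 2 * m then X (some ⟨n, hn⟩) else 0) (painlevePoly m)
    + X none

/-- The weights `(p_1, …, p_{2m}) = (2, 3, …, 2m+1)`. -/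
def weight (m : ℕ) (i : Fin (2 * m)) : ℕ := i + 2

/-- The leading coefficients `c_j(k) = (-1)^(j+1) j! k(k+1)/2`, with `j = i + 1`. -/
def leadingCoeff (m k : ℕ) (i : Fin (2 * m)) : ℂ :=
  (-1) ^ ((i : ℕ) + 2) * (Nat.factorial ((i : ℕ) + 1) : ℂ) * ((k : ℂ) * (k + 1) / 2)

/-- The orders at which a free parameter may enter the Laurent series: the Kovalevskaya exponents
that are positive integers. -/
def freeOrders (m k : ℕ) : Set ℕ :=
  {n | 0 < n ∧ (n : ℂ) ∈ kovalevskayaExponents (field m) (weight m) (leadingCoeff m k)}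

end PainleveI

end

noncomputable section

open MvPolynomial

namespace PainleveI

/-! ### The derivation on Laurent series -/

/-! Put `a = k(k+1)/2` and `t = z - z₀`. The solutions are perturbations of `a t⁻²`, and the Lenard
recursion can be solved explicitly near this function.

Exponents: evaluating differential polynomials at `a z⁻² + ε z^(ρ-2)` with `ε² = 0` turns the Lenard
recursion into scalar recursions for the value and the linearization of `𝓛_j`
(`linHom_lenard_succ`). The value vanishes for `j > k` (`lenardValue_eq_zero`), so `c(k)` is an
indicial root. The linearizations at `k` and `k+1` are tied by `lenardLin_contiguous`, which is
homogeneous when `j > k+1`; induction on `k` then splits the linearization of `𝓛_{m+1}` into linear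
factors (`lenardLin_eq_exponentPoly`). Every root gives an eigenvector of the Kovalevskaya matrix,
and the `2m` roots are distinct.

Free parameters: the coefficients `b_n` of `x` satisfy `Q(n) b_n = (terms in lower coefficients) +
forcing`, where `Q` is `indicialPoly`. Uniqueness is immediate; existence is compatibility at the
positive integer roots of `Q`. Take `b_n = 0` for odd `n ≤ 2k+1`. Then every `𝓛_j[x]` has a pole of
order at most `2k`, and its principal part is even (`IsMonodromyFree.coeff_lenard_eq_zero`); this
settles all exponents up to `2m+1`. At `2m+2+2i` the coefficient of `t^(2i)` in `𝓛_{m+1}[x]` has to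
vanish. This follows from the involution of the Lenard polynomials: `𝓛_i ∂𝓛_{m+1}` has no residue,
and the leading coefficient of `𝓛_i` is nonzero for `i ≤ k` (`IsMonodromyFree.resonance`).

Convergence: in truncated weighted `ℓ¹` norms the nonlinear part is quadratic and its first `N+1`
coefficients only see the first `N` of the series. Induction on `N` gives bounds independent of `N`,
together with Lipschitz dependence on the parameters (`exists_estimates`).

General solution: for `k = 1`, rescale so that `z₁` corresponds to `t = 1`. The values at `z₁` are
then a small Lipschitz perturbation of a linear map of the `2m` parameters, whose image is spanned
by the eigenvectors of all `2m` exponents, with `-1` coming from the motion of the pole. It is onto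
(`surjective_paramLin`), and a sufficiently good linear approximation makes the map open. -/

theorem coeff_derivative (f : LaurentSeries ℂ) (n : ℤ) :
    (LaurentSeries.derivative ℂ f).coeff n = ((n : ℂ) + 1) * f.coeff (n + 1) := by
  rw [LaurentSeries.derivative_apply, LaurentSeries.hasseDeriv_coeff]
  simp

/-- The coefficient of the derivative of a product, in terms of pairs of indices. -/
theorem derivative_mul (f g : LaurentSeries ℂ) :
    LaurentSeries.derivative ℂ (f * g) =
      f * LaurentSeries.derivative ℂ g + g * LaurentSeries.derivative ℂ f := by
  -- The operator `t d/dt` multiplies the `n`-th coefficient by `n`, which is additive along `p.1 +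
  -- p.2 = n`. The Leibniz rule is therefore checked termwise for `t d/dt`, and `t` is cancelled at
  -- the end.
  have hθ : ∀ h : LaurentSeries ℂ, ∀ n, (HahnSeries.single 1 (1 : ℂ) *
      LaurentSeries.derivative ℂ h).coeff n = n * h.coeff n := by
    intro h n
    have := HahnSeries.coeff_single_mul_add (r := (1 : ℂ)) (x := LaurentSeries.derivative ℂ h)
      (a := n - 1) (b := 1)
    rw [sub_add_cancel] at this
    rw [this, coeff_derivative]
    simp
  have hsupp : ∀ h : LaurentSeries ℂ, (HahnSeries.single 1 (1 : ℂ) *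
      LaurentSeries.derivative ℂ h).support ⊆ h.support := by
    intro h n hn
    rw [HahnSeries.mem_support, hθ] at hn
    exact right_ne_zero_of_mul hn
  have key : HahnSeries.single 1 (1 : ℂ) * LaurentSeries.derivative ℂ (f * g) =
      f * (HahnSeries.single 1 (1 : ℂ) * LaurentSeries.derivative ℂ g) +
        (HahnSeries.single 1 (1 : ℂ) * LaurentSeries.derivative ℂ f) * g := by
    ext n
    rw [hθ, HahnSeries.coeff_add, HahnSeries.coeff_mul, HahnSeries.coeff_mul_right' g.isPWO_support
      (hsupp g), HahnSeries.coeff_mul_left' f.isPWO_support (hsupp f), Finset.mul_sum,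
      ← Finset.sum_add_distrib]
    refine Finset.sum_congr rfl fun p hp => ?_
    rw [hθ, hθ, ← (Finset.mem_antidiagonal.mp hp).2.2]
    push_cast
    ring
  have hne : HahnSeries.single (1 : ℤ) (1 : ℂ) ≠ 0 := by simp
  apply mul_left_cancel₀ hne
  rw [key]
  ring

theorem algebraMap_laurentSeries (a : ℂ) :
    algebraMap ℂ (LaurentSeries ℂ) a = HahnSeries.C a := by
  rw [HahnSeries.algebraMap_apply']
  simp

theorem derivative_C (a : ℂ) : LaurentSeries.derivative ℂ (HahnSeries.C a) = 0 := by
  ext n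
  rw [coeff_derivative, HahnSeries.C_apply]
  by_cases h : n + 1 = 0
  · have : (n : ℂ) + 1 = 0 := by exact_mod_cast h
    simp [this]
  · simp [HahnSeries.coeff_single_of_ne h]

/-- The factor `n + 1` vanishes at `n = -1`. This is what permits integration by parts under the
residue. -/
theorem residue_derivative (f : LaurentSeries ℂ) : (LaurentSeries.derivative ℂ f).coeff (-1) = 0 := by
  rw [coeff_derivative]; simp

theorem coeff_mul_eq_zero {f g : LaurentSeries ℂ} {n : ℤ}
    (h : ∀ a b, a + b = n → f.coeff a = 0 ∨ g.coeff b = 0) : (f * g).coeff n = 0 := by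
  rw [HahnSeries.coeff_mul]
  refine Finset.sum_eq_zero fun p hp => ?_
  rcases h p.1 p.2 (Finset.mem_antidiagonal.mp hp).2.2 with h | h <;> simp [h]

/-- The lowest coefficient of a product. -/
theorem coeff_mul_lowest {f g : LaurentSeries ℂ} {p q : ℤ} (hf : ∀ a < p, f.coeff a = 0)
    (hg : ∀ b < q, g.coeff b = 0) : (f * g).coeff (p + q) = f.coeff p * g.coeff q := by
  have hf' : f = HahnSeries.single p (f.coeff p) + (f - HahnSeries.single p (f.coeff p)) := by ring
  have h1 : ((f - HahnSeries.single p (f.coeff p)) * g).coeff (p + q) = 0 := by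
    refine coeff_mul_eq_zero fun a b hab => ?_
    rcases lt_trichotomy a p with h | h | h
    · left; simp [hf a h, HahnSeries.coeff_single_of_ne h.ne]
    · left; subst h; simp
    · right; exact hg b (by omega)
  conv_lhs => rw [hf', add_mul]
  rw [HahnSeries.coeff_add, h1, add_zero, add_comm p q, HahnSeries.coeff_single_mul_add]

/-! ### Weights of differential polynomials -/

/-- The Euler operator of the grading in which `x^(i)` has weight `i + 2`. -/
def eulerOp : Derivation ℂ (MvPolynomial ℕ ℂ) (MvPolynomial ℕ ℂ) :=
  mkDerivation ℂ fun i => ((i : MvPolynomial ℕ ℂ) + 2) * X i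

theorem eulerOp_X (i : ℕ) : eulerOp (X i) = ((i : MvPolynomial ℕ ℂ) + 2) * X i :=
  mkDerivation_X _ _ _

/-- The total derivative raises the weight by one, so its commutator with the Euler operator is
itself. -/
theorem eulerOp_totalDeriv (p : MvPolynomial ℕ ℂ) :
    eulerOp (totalDeriv p) = totalDeriv (eulerOp p) + totalDeriv p := by
  have hN : ∀ (d : Derivation ℂ (MvPolynomial ℕ ℂ) (MvPolynomial ℕ ℂ)) (n : ℕ),
      d (n : MvPolynomial ℕ ℂ) = 0 := fun d n => d.map_natCast n
  have h2 : ∀ (d : Derivation ℂ (MvPolynomial ℕ ℂ) (MvPolynomial ℕ ℂ)),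
      d (2 : MvPolynomial ℕ ℂ) = 0 := fun d => by simpa using d.map_natCast 2
  induction p using MvPolynomial.induction_on with
  | C a =>
    have : ∀ (d : Derivation ℂ (MvPolynomial ℕ ℂ) (MvPolynomial ℕ ℂ)), d (C a) = 0 :=
      fun d => d.map_algebraMap a
    simp [this]
  | add p q hp hq => simp only [map_add, hp, hq]; ring
  | mul_X p n hp =>
    simp only [Derivation.leibniz, smul_eq_mul, map_add, totalDeriv_X, eulerOp_X, hp, hN, h2]
    push_cast
    ring

theorem eulerOp_totalDeriv_of_eq {p : MvPolynomial ℕ ℂ} {w : ℕ}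
    (h : eulerOp p = (w : MvPolynomial ℕ ℂ) * p) :
    eulerOp (totalDeriv p) = ((w + 1 : ℕ) : MvPolynomial ℕ ℂ) * totalDeriv p := by
  rw [eulerOp_totalDeriv, h, Derivation.leibniz, smul_eq_mul, smul_eq_mul,
    totalDeriv.map_natCast]
  push_cast
  ring

theorem constantCoeff_eulerOp (p : MvPolynomial ℕ ℂ) : constantCoeff (eulerOp p) = 0 := by
  induction p using MvPolynomial.induction_on with
  | C a => rw [show eulerOp (C a) = 0 from eulerOp.map_algebraMap a, map_zero]
  | add p q hp hq => simp [hp, hq]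
  | mul_X p n hp => simp [Derivation.leibniz, eulerOp_X, hp]

/-- The right side of the recursion is homogeneous of weight `2j + 3`, so the total derivative of
the difference of the two sides is zero. The difference is then a constant, and the normalization of
the integration constants makes it zero. -/
theorem eulerOp_lenard (j : ℕ) :
    eulerOp (lenard j) = ((2 * j : ℕ) : MvPolynomial ℕ ℂ) * lenard j := by
  have hN : ∀ (d : Derivation ℂ (MvPolynomial ℕ ℂ) (MvPolynomial ℕ ℂ)) (n : ℕ),
      d (n : MvPolynomial ℕ ℂ) = 0 := fun d n => d.map_natCast n
  have h8 : eulerOp (8 : MvPolynomial ℕ ℂ) = 0 := by simpa using hN eulerOp 8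
  have h4 : eulerOp (4 : MvPolynomial ℕ ℂ) = 0 := by simpa using hN eulerOp 4
  induction j with
  | zero => rw [lenard_spec.zero, eulerOp.map_one_eq_zero]; simp
  | succ j ih =>
    have h1 := eulerOp_totalDeriv_of_eq ih
    have h2 := eulerOp_totalDeriv_of_eq h1
    have h3 := eulerOp_totalDeriv_of_eq h2
    have hT : totalDeriv (eulerOp (lenard (j + 1)) -
        ((2 * (j + 1) : ℕ) : MvPolynomial ℕ ℂ) * lenard (j + 1)) = 0 := by
      have e1 := eulerOp_totalDeriv (lenard (j + 1))
      have e2 : eulerOp (totalDeriv (lenard (j + 1))) =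
          ((2 * j + 3 : ℕ) : MvPolynomial ℕ ℂ) * totalDeriv (lenard (j + 1)) := by
        rw [lenard_spec.succ]
        simp only [map_sub, Derivation.leibniz, smul_eq_mul, h1, h3, ih, h8, h4, eulerOp_X]
        push_cast
        ring
      rw [map_sub, Derivation.leibniz, smul_eq_mul, smul_eq_mul, hN]
      rw [e2] at e1
      push_cast at e1 ⊢
      linear_combination -e1
    have := eq_C_of_totalDeriv_eq_zero hT
    rw [map_sub, map_mul, constantCoeff_eulerOp, lenard_spec.const, mul_zero, sub_zero,
      map_zero] at this
    exact sub_eq_zero.mp this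

/-- Monomials are eigenvectors of the Euler operator. This converts its eigenvalue equation into
`IsWeightedHomogeneous`. -/
theorem coeff_eulerOp (p : MvPolynomial ℕ ℂ) (s : ℕ →₀ ℕ) :
    coeff s (eulerOp p) = ((Finsupp.weight (fun i : ℕ => i + 2) s : ℕ) : ℂ) * coeff s p := by
  induction p using MvPolynomial.induction_on generalizing s with
  | C a =>
    rw [show eulerOp (C a) = 0 from eulerOp.map_algebraMap a, coeff_C]
    split_ifs with h
    · subst h; simp
    · simp
  | add p q hp hq => simp [hp, hq, mul_add]
  | mul_X p n hp =>
    rw [Derivation.leibniz, eulerOp_X, smul_eq_mul, smul_eq_mul,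
      show p * (((n : MvPolynomial ℕ ℂ) + 2) * X n) + X n * eulerOp p =
        (C ((n : ℂ) + 2) * p + eulerOp p) * X n by
          simp only [map_add, map_natCast, map_ofNat]; ring,
      coeff_mul_X', coeff_mul_X']
    split_ifs with h
    · rw [coeff_add, coeff_C_mul, hp]
      have hs : s = (s - Finsupp.single n 1) + Finsupp.single n 1 := by
        rw [tsub_add_cancel_of_le]
        exact Finsupp.single_le_iff.mpr (Nat.one_le_iff_ne_zero.mpr (Finsupp.mem_support_iff.mp h))
      conv_rhs => rw [hs]
      rw [map_add, Finsupp.weight_single]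
      push_cast
      simp only [add_tsub_cancel_right, smul_eq_mul]
      push_cast
      ring
    · simp

theorem isWeightedHomogeneous_of_eulerOp {p : MvPolynomial ℕ ℂ} {w : ℕ}
    (h : eulerOp p = (w : MvPolynomial ℕ ℂ) * p) :
    IsWeightedHomogeneous (fun i => i + 2) p w := by
  intro s hs
  have := congrArg (coeff s) h
  rw [coeff_eulerOp, ← map_natCast C, coeff_C_mul] at this
  exact_mod_cast mul_right_cancel₀ hs this

theorem _root_.MvPolynomial.IsWeightedHomogeneous.aeval_pow_mul {σ R A : Type*} [CommSemiring R]
    [CommSemiring A] [Algebra R A] {p : MvPolynomial σ R} {w : σ → ℕ} {n : ℕ}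
    (h : IsWeightedHomogeneous w p n) (s : A) (y : σ → A) :
    aeval (fun i => s ^ w i * y i) p = s ^ n * aeval y p := by
  rw [aeval_def, aeval_def, eval₂_eq, eval₂_eq, Finset.mul_sum]
  refine Finset.sum_congr rfl fun d hd => ?_
  have hd' := h (mem_support_iff.mp hd)
  rw [← hd', Finsupp.weight_apply, Finsupp.sum, ← Finset.prod_pow_eq_pow_sum]
  simp only [mul_pow, Finset.prod_mul_distrib, ← pow_mul, smul_eq_mul]
  rw [show (∏ i ∈ d.support, s ^ (w i * d i)) = ∏ i ∈ d.support, s ^ (d i * w i) from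
    Finset.prod_congr rfl fun i _ => by rw [mul_comm]]
  ring

theorem lenard_isWeightedHomogeneous (j : ℕ) :
    IsWeightedHomogeneous (fun i => i + 2) (lenard j) (2 * j) :=
  isWeightedHomogeneous_of_eulerOp (eulerOp_lenard j)

theorem painlevePoly_isWeightedHomogeneous (m : ℕ) :
    IsWeightedHomogeneous (fun i => i + 2) (painlevePoly m) (2 * m + 2) := by
  refine IsWeightedHomogeneous.add (isWeightedHomogeneous_X _ _ _) ?_
  have := (isWeightedHomogeneous_C (fun i : ℕ => i + 2) (1 / 4 : ℂ)).mul
    (lenard_isWeightedHomogeneous (m + 1))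
  rwa [zero_add] at this

/-! ### Linearization of the Lenard recursion at `a z⁻²` -/

/-- The coefficient of `z ^ (ρ - 2 - i)` in the `i`-th derivative of `z ^ (ρ - 2)`. -/
def descPoly (i : ℕ) : Polynomial ℂ := ∏ j ∈ Finset.range i, (Polynomial.X - ((j : Polynomial ℂ) + 2))

theorem descPoly_zero : descPoly 0 = 1 := by simp [descPoly]

theorem descPoly_succ (i : ℕ) :
    descPoly (i + 1) = descPoly i * (Polynomial.X - ((i : Polynomial ℂ) + 2)) := by
  rw [descPoly, Finset.prod_range_succ, descPoly]

/-- Evaluation of differential polynomials at `a z⁻² + ε z ^ (ρ - 2)`, `ε² = 0`, where the powers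
of `z` are suppressed and `ρ` is the polynomial variable. -/
def linHom (a : ℂ) : MvPolynomial ℕ ℂ →ₐ[ℂ] DualNumber (Polynomial ℂ) :=
  aeval fun i => TrivSqZeroExt.inl (Polynomial.C (a * ((-1) ^ i * (Nat.factorial (i + 1) : ℂ)))) +
    TrivSqZeroExt.inr (descPoly i)

theorem linHom_X (a : ℂ) (i : ℕ) : linHom a (X i) =
    TrivSqZeroExt.inl (Polynomial.C (a * ((-1) ^ i * (Nat.factorial (i + 1) : ℂ)))) +
    TrivSqZeroExt.inr (descPoly i) := aeval_X _ _

theorem linHom_natCast (a : ℂ) (n : ℕ) : linHom a (n : MvPolynomial ℕ ℂ) = (n : DualNumber _) :=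
  map_natCast _ _

/-- A polynomial of weight `w` takes the value `z^(-w) (u + ε z^ρ v)`, so `d/dz` multiplies `u` by
`-w` and `v` by `ρ - w`. Adding the Euler operator cancels `w`, and the resulting identity no longer
needs homogeneity, so it can be proved by induction on `p`. -/
theorem linHom_totalDeriv_add_eulerOp (a : ℂ) (p : MvPolynomial ℕ ℂ) :
    (linHom a (totalDeriv p + eulerOp p)).fst = 0 ∧
    (linHom a (totalDeriv p + eulerOp p)).snd = Polynomial.X * (linHom a p).snd := by
  induction p using MvPolynomial.induction_on with
  | C b =>
    have h : linHom a (C b) = TrivSqZeroExt.inl (Polynomial.C b) := by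
      rw [linHom, aeval_C]; rfl
    have : ∀ (d : Derivation ℂ (MvPolynomial ℕ ℂ) (MvPolynomial ℕ ℂ)), d (C b) = 0 :=
      fun d => d.map_algebraMap b
    simp [this, h]
  | add p q hp hq =>
    have : totalDeriv (p + q) + eulerOp (p + q) =
        (totalDeriv p + eulerOp p) + (totalDeriv q + eulerOp q) := by
      simp only [map_add]; ring
    rw [this, map_add, TrivSqZeroExt.fst_add, TrivSqZeroExt.snd_add, hp.1, hp.2, hq.1, hq.2,
      map_add, TrivSqZeroExt.snd_add]
    exact ⟨by simp, by ring⟩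
  | mul_X p n hp =>
    have : totalDeriv (p * X n) + eulerOp (p * X n) =
        (totalDeriv p + eulerOp p) * X n + p * (X (n + 1) + ((n + 2 : ℕ) : MvPolynomial ℕ ℂ) * X n) := by
      simp only [Derivation.leibniz, smul_eq_mul, totalDeriv_X, eulerOp_X]
      push_cast
      ring
    have hX : (linHom a (X (n + 1) + ((n + 2 : ℕ) : MvPolynomial ℕ ℂ) * X n)).fst = 0 ∧
        (linHom a (X (n + 1) + ((n + 2 : ℕ) : MvPolynomial ℕ ℂ) * X n)).snd =
          Polynomial.X * descPoly n := by
      rw [map_add, map_mul, linHom_natCast, linHom_X, linHom_X]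
      constructor
      · simp only [TrivSqZeroExt.fst_add, TrivSqZeroExt.fst_inl, TrivSqZeroExt.fst_inr,
          TrivSqZeroExt.fst_mul, TrivSqZeroExt.fst_natCast, add_zero, Nat.factorial_succ (n + 1),
          ← map_natCast Polynomial.C, ← map_mul, ← map_add]
        rw [← map_zero Polynomial.C]
        congr 1
        push_cast
        ring
      · simp only [TrivSqZeroExt.snd_add, TrivSqZeroExt.snd_inl, TrivSqZeroExt.snd_inr,
          TrivSqZeroExt.snd_mul, TrivSqZeroExt.snd_natCast, TrivSqZeroExt.fst_natCast, zero_add,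
          descPoly_succ, smul_zero, add_zero, smul_eq_mul]
        push_cast
        ring
    rw [this, map_add, map_mul, map_mul, map_mul, linHom_X]
    simp only [TrivSqZeroExt.fst_add, TrivSqZeroExt.snd_add, TrivSqZeroExt.fst_mul,
      TrivSqZeroExt.snd_mul, hp.1, hp.2, hX.1, hX.2, smul_eq_mul, TrivSqZeroExt.fst_inl,
      TrivSqZeroExt.fst_inr, TrivSqZeroExt.snd_inl, TrivSqZeroExt.snd_inr,
      MulOpposite.smul_eq_mul_unop, MulOpposite.unop_op]
    exact ⟨by ring, by ring⟩

theorem linHom_totalDeriv (a : ℂ) {p : MvPolynomial ℕ ℂ} {w : ℕ}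
    (h : eulerOp p = (w : MvPolynomial ℕ ℂ) * p) :
    (linHom a (totalDeriv p)).fst = -(w : Polynomial ℂ) * (linHom a p).fst ∧
    (linHom a (totalDeriv p)).snd = (Polynomial.X - (w : Polynomial ℂ)) * (linHom a p).snd := by
  have h1 := linHom_totalDeriv_add_eulerOp a p
  rw [h, map_add, map_mul, linHom_natCast] at h1
  simp only [TrivSqZeroExt.fst_add, TrivSqZeroExt.fst_mul, TrivSqZeroExt.fst_natCast,
    TrivSqZeroExt.snd_add, TrivSqZeroExt.snd_mul, TrivSqZeroExt.snd_natCast, smul_eq_mul,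
    smul_zero, add_zero] at h1
  exact ⟨by linear_combination h1.1, by linear_combination h1.2⟩

/-- The value of `𝓛_j` at `k(k+1)/2 z⁻²`. -/
def lenardValue (k j : ℕ) : Polynomial ℂ := (linHom ((k : ℂ) * (k + 1) / 2) (lenard j)).fst

/-- The linearization of `𝓛_j` at `k(k+1)/2 z⁻²` in the direction `z ^ (ρ - 2)`. -/
def lenardLin (k j : ℕ) : Polynomial ℂ := (linHom ((k : ℂ) * (k + 1) / 2) (lenard j)).snd

theorem lenardValue_zero (k : ℕ) : lenardValue k 0 = 1 := by
  rw [lenardValue, lenard_spec.zero, map_one]; simp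

theorem lenardLin_zero (k : ℕ) : lenardLin k 0 = 0 := by
  rw [lenardLin, lenard_spec.zero, map_one]; simp

/-- The three derivatives act on weights `2j`, `2j+1`, `2j+2`, hence by the scalars of
`linHom_totalDeriv`. The two identities are the components of the recursion over the dual numbers,
with `2a = k(k+1)` inserted. -/
theorem linHom_lenard_succ (k j : ℕ) :
    ((j : Polynomial ℂ) + 1) * lenardValue k (j + 1) =
      2 * (2 * (j : Polynomial ℂ) + 1) *
        ((j : Polynomial ℂ) * (j + 1) - (k : Polynomial ℂ) * (k + 1)) * lenardValue k j ∧
    (Polynomial.X - 2 * (j : Polynomial ℂ) - 2) * lenardLin k (j + 1) =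
      (Polynomial.X - 2 * (j : Polynomial ℂ) - 1) *
        ((Polynomial.X - 2 * (j : Polynomial ℂ)) * (Polynomial.X - 2 * (j : Polynomial ℂ) - 2)
        - 4 * (k : Polynomial ℂ) * ((k : Polynomial ℂ) + 1)) * lenardLin k j
      + (16 * (j : Polynomial ℂ) - 4 * (Polynomial.X - 2)) * lenardValue k j := by
  set a : ℂ := (k : ℂ) * (k + 1) / 2 with ha
  have h0 := linHom_totalDeriv a (eulerOp_lenard j)
  have e1 := eulerOp_totalDeriv_of_eq (eulerOp_lenard j)
  have h1 := linHom_totalDeriv a e1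
  have e2 := eulerOp_totalDeriv_of_eq e1
  have h2 := linHom_totalDeriv a e2
  have h3 := linHom_totalDeriv a (eulerOp_lenard (j + 1))
  have h := congrArg (linHom a) (lenard_spec.succ j)
  have h8 : linHom a 8 = (8 : ℕ) := by simpa using linHom_natCast a 8
  have h4 : linHom a 4 = (4 : ℕ) := by simpa using linHom_natCast a 4
  have hX0 : linHom a (X 0) = TrivSqZeroExt.inl (Polynomial.C a) + TrivSqZeroExt.inr 1 := by
    rw [linHom_X, descPoly_zero]; simp
  have hX1 : linHom a (X 1) = TrivSqZeroExt.inl (-2 * Polynomial.C a) +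
      TrivSqZeroExt.inr (Polynomial.X - 2) := by
    rw [linHom_X, descPoly_succ, descPoly_zero]
    have : a * ((-1) ^ 1 * (Nat.factorial (1 + 1) : ℂ)) = -2 * a := by simp; ring
    rw [this, map_mul, map_neg, map_ofNat]
    simp
  have hCa : 2 * Polynomial.C a = (k : Polynomial ℂ) * (k + 1) := by
    rw [← map_ofNat Polynomial.C, ← map_mul, ha, ← map_natCast Polynomial.C k,
      ← map_one Polynomial.C, ← map_add, ← map_mul]
    congr 1
    ring
  simp only [map_sub, map_mul, h8, h4, hX0, hX1] at h
  have hf := congrArg TrivSqZeroExt.fst h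
  have hs := congrArg TrivSqZeroExt.snd h
  simp only [TrivSqZeroExt.fst_sub, TrivSqZeroExt.snd_sub, TrivSqZeroExt.fst_mul,
      TrivSqZeroExt.snd_mul, smul_eq_mul, TrivSqZeroExt.fst_inl, TrivSqZeroExt.fst_add,
      TrivSqZeroExt.snd_add, TrivSqZeroExt.fst_natCast, TrivSqZeroExt.snd_natCast,
      TrivSqZeroExt.fst_inr, TrivSqZeroExt.snd_inl, TrivSqZeroExt.snd_inr,
      MulOpposite.smul_eq_mul_unop, MulOpposite.unop_op, h0.1, h0.2, h1.1, h1.2, h2.1, h2.2,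
      h3.1, h3.2] at hf hs
  push_cast at hf hs
  simp only [lenardValue, lenardLin, ← ha]
  constructor
  · have h2 : (2 : Polynomial ℂ) ≠ 0 := two_ne_zero
    apply mul_left_cancel₀ h2
    linear_combination -hf - 4 * (2 * (j : Polynomial ℂ) + 1) * (linHom a (lenard j)).fst * hCa
  · linear_combination hs -
      4 * (Polynomial.X - 2 * (j : Polynomial ℂ) - 1) * (linHom a (lenard j)).snd * hCa

/-! ### Contiguity in `k` and factorization of the linearized Lenard polynomials -/

/-- The common factor of the values of `𝓛_j` at `k(k+1)/2 z⁻²` and `(k+1)(k+2)/2 z⁻²`. -/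
def contiguousFactor (k : ℕ) : ℕ → ℂ
  | 0 => 1 / (k + 1)
  | j + 1 => -2 * (2 * j + 1) * (k + 1 + j) * (k + 1 - j) / (j + 1) * contiguousFactor k j

theorem contiguousFactor_succ (k j : ℕ) :
    ((j : Polynomial ℂ) + 1) * Polynomial.C (contiguousFactor k (j + 1)) =
      -2 * (2 * (j : Polynomial ℂ) + 1) * ((k : Polynomial ℂ) + 1 + j) *
        ((k : Polynomial ℂ) + 1 - j) * Polynomial.C (contiguousFactor k j) := by
  have hj : (j : ℂ) + 1 ≠ 0 := Nat.cast_add_one_ne_zero j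
  have : ((j : ℂ) + 1) * contiguousFactor k (j + 1) =
      -2 * (2 * (j : ℂ) + 1) * ((k : ℂ) + 1 + j) * ((k : ℂ) + 1 - j) * contiguousFactor k j := by
    rw [contiguousFactor]
    field_simp
  have := congrArg Polynomial.C this
  simpa [map_ofNat Polynomial.C] using this

theorem contiguousFactor_eq_zero {k j : ℕ} (h : k + 1 < j) : contiguousFactor k j = 0 := by
  induction j, h using Nat.le_induction with
  | base => rw [contiguousFactor]; push_cast; simp
  | succ j _ ih => rw [contiguousFactor, ih, mul_zero]

/-- The step factors of the values are proportional to `(j-k)(j+k+1)` for `k` and to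
`(j-k-1)(j+k+2)` for `k+1`. Their quotient telescopes to `(k+1-j)/(k+1+j)`. -/
theorem lenardValue_eq_contiguousFactor (k j : ℕ) :
    lenardValue k j = ((k : Polynomial ℂ) + 1 - j) * Polynomial.C (contiguousFactor k j) ∧
    lenardValue (k + 1) j = ((k : Polynomial ℂ) + 1 + j) * Polynomial.C (contiguousFactor k j) := by
  induction j with
  | zero =>
    have hk : (k : ℂ) + 1 ≠ 0 := Nat.cast_add_one_ne_zero k
    have : ((k : Polynomial ℂ) + 1) * Polynomial.C (contiguousFactor k 0) = 1 := by
      rw [contiguousFactor, ← map_natCast Polynomial.C, ← map_one Polynomial.C, ← map_add,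
        ← map_mul, mul_one_div_cancel hk]
    simp [lenardValue_zero, this]
  | succ j ih =>
    have hj : (j : Polynomial ℂ) + 1 ≠ 0 := Nat.cast_add_one_ne_zero j
    have hμ := contiguousFactor_succ k j
    constructor
    · apply mul_left_cancel₀ hj
      rw [(linHom_lenard_succ k j).1, ih.1]
      push_cast
      linear_combination -((k : Polynomial ℂ) + 1 - (j + 1)) * hμ
    · apply mul_left_cancel₀ hj
      rw [(linHom_lenard_succ (k + 1) j).1, ih.2]
      push_cast
      linear_combination -((k : Polynomial ℂ) + 1 + (j + 1)) * hμ

/-- At `j = k+1` the explicit prefactor is zero; beyond that the common factor is. The termination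
of the hierarchy on `k(k+1)/2 z⁻²` is the reason for these leading coefficients. -/
theorem lenardValue_eq_zero {k j : ℕ} (h : k < j) : lenardValue k j = 0 := by
  rw [(lenardValue_eq_contiguousFactor k j).1]
  rcases (Nat.succ_le_of_lt h).eq_or_lt with h | h
  · rw [← h]; push_cast; simp
  · rw [contiguousFactor_eq_zero h]; simp

/-- A contiguity relation between the linearizations at `k(k+1)/2 z⁻²` and
`(k+1)(k+2)/2 z⁻²`. -/
theorem lenardLin_contiguous (k j : ℕ) :
    (Polynomial.X + 2 * ((k : Polynomial ℂ) + 1) - 2 * (j : Polynomial ℂ)) *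
        (Polynomial.X - 1 - 2 * ((k : Polynomial ℂ) + 1)) * lenardLin (k + 1) j -
      (Polynomial.X - 2 * ((k : Polynomial ℂ) + 1) - 2 * (j : Polynomial ℂ)) *
        (Polynomial.X - 1 + 2 * ((k : Polynomial ℂ) + 1)) * lenardLin k j =
      8 * (j : Polynomial ℂ) * Polynomial.C (contiguousFactor k j) := by
  induction j with
  | zero => simp [lenardLin_zero]
  | succ j ih =>
    have hj : (Polynomial.X - 2 * (j : Polynomial ℂ) - 2) ≠ 0 := by
      have : Polynomial.X - 2 * (j : Polynomial ℂ) - 2 =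
          Polynomial.X - Polynomial.C (2 * (j : ℂ) + 2) := by
        simp [map_ofNat Polynomial.C]; ring
      rw [this]
      exact Polynomial.X_sub_C_ne_zero _
    have hμ := contiguousFactor_succ k j
    have h1 := (linHom_lenard_succ k j).2
    have h2 := (linHom_lenard_succ (k + 1) j).2
    rw [(lenardValue_eq_contiguousFactor k j).1] at h1
    rw [(lenardValue_eq_contiguousFactor k j).2] at h2
    apply mul_left_cancel₀ hj
    push_cast at h2 ⊢
    set x : Polynomial ℂ := Polynomial.X
    set y : Polynomial ℂ := (j : Polynomial ℂ)
    set q : Polynomial ℂ := (k : Polynomial ℂ)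
    -- Since `(x-2y)(x-2y-2) - 4q(q+1) = (x-2y-2-2q)(x-2y+2q)`, and likewise with `q+1` for `q`,
    -- both recursions reproduce the factors in `ih` up to one common multiplier.
    linear_combination (x + 2 * (q + 1) - 2 * (y + 1)) * (x - 1 - 2 * (q + 1)) * h2 -
      (x - 2 * (q + 1) - 2 * (y + 1)) * (x - 1 + 2 * (q + 1)) * h1 +
      (x + 2 * (q + 1) - 2 * (y + 1)) * (x - 2 * (q + 1) - 2 * (y + 1)) * (x - 2 * y - 1) * ih -
      8 * (x - 2 * y - 2) * hμ

/-- The product of the `X - ρ`, `ρ` running over the Kovalevskaya exponents. -/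
def exponentPoly (k m : ℕ) : Polynomial ℂ :=
  (∏ i ∈ Finset.Icc 1 (m - k), (Polynomial.X - 2 * (i : Polynomial ℂ))) *
  (∏ i ∈ Finset.Icc (k + 1) m, (Polynomial.X - (2 * (i : Polynomial ℂ) + 1))) *
  (∏ i ∈ Finset.Icc 1 k,
    (Polynomial.X - (2 * (m : Polynomial ℂ) + 2 * (i : Polynomial ℂ) + 2))) *
  (∏ i ∈ Finset.Icc 1 k, (Polynomial.X + (2 * (i : Polynomial ℂ) - 1)))

/-- For `k = 0` the recursion in `j` is homogeneous after its first step and contributes two linear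
factors each time. For the step from `k` to `k+1`, the contiguity relation at `j = m+1` has right
side zero, and it trades the roots `2(m-k)` and `2k+3` for `2m+2k+4` and `-(2k+1)`. -/
theorem lenardLin_eq_exponentPoly {k m : ℕ} (h : k ≤ m) :
    lenardLin k (m + 1) = -4 * exponentPoly k m := by
  have hX : ∀ a : ℂ, Polynomial.X - Polynomial.C a ≠ 0 := Polynomial.X_sub_C_ne_zero
  induction k with
  | zero =>
    clear h
    have hj : ∀ j : ℕ, (Polynomial.X - 2 * (j : Polynomial ℂ) - 2) ≠ 0 := fun j => by
      have := hX (2 * (j : ℂ) + 2)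
      simp only [map_add, map_mul, map_ofNat, map_natCast, ← sub_sub] at this
      exact this
    induction m with
    | zero =>
      have h1 := (linHom_lenard_succ 0 0).2
      rw [lenardLin_zero, lenardValue_zero] at h1
      apply mul_left_cancel₀ (hj 0)
      rw [h1]
      simp [exponentPoly]
      ring
    | succ m ih =>
      have h1 := (linHom_lenard_succ 0 (m + 1)).2
      rw [ih, lenardValue_eq_zero (Nat.succ_pos m)] at h1
      apply mul_left_cancel₀ (hj (m + 1))
      rw [h1]
      simp only [exponentPoly, Nat.sub_zero, zero_add, Finset.prod_Icc_succ_top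
        (show 1 ≤ m + 1 by omega)]
      push_cast
      simp
      ring
  | succ k ih =>
    have hc := lenardLin_contiguous k (m + 1)
    rw [ih (by omega), contiguousFactor_eq_zero (by omega), map_zero, mul_zero, sub_eq_zero] at hc
    obtain ⟨d, rfl⟩ : ∃ d, m = k + 1 + d := ⟨m - (k + 1), by omega⟩
    have h1 : (Polynomial.X + 2 * ((k : Polynomial ℂ) + 1) -
        2 * ((k + 1 + d + 1 : ℕ) : Polynomial ℂ)) ≠ 0 := by
      have := hX (2 * ((d : ℂ) + 1))
      convert this using 1
      simp [map_ofNat Polynomial.C]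
      ring
    have h2 : (Polynomial.X - 1 - 2 * ((k : Polynomial ℂ) + 1)) ≠ 0 := by
      have := hX (1 + 2 * ((k : ℂ) + 1))
      convert this using 1
      simp [map_ofNat Polynomial.C]
      ring
    apply mul_left_cancel₀ (mul_ne_zero h1 h2)
    rw [hc]
    have e1 : k + 1 + d - k = d + 1 := by omega
    have e2 : k + 1 + d - (k + 1) = d := by omega
    have e3 : Finset.Icc (k + 1) (k + 1 + d) = insert (k + 1) (Finset.Icc (k + 1 + 1) (k + 1 + d)) := by
      ext i; simp; omega
    rw [exponentPoly, exponentPoly, e1, e2, e3, Finset.prod_insert (by simp),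
      Finset.prod_Icc_succ_top (show 1 ≤ d + 1 by omega),
      Finset.prod_Icc_succ_top (show 1 ≤ k + 1 by omega),
      Finset.prod_Icc_succ_top (show 1 ≤ k + 1 by omega)]
    push_cast
    ring

local notation "∂ₜ" => LaurentSeries.derivative ℂ (V := ℂ)

/-! ### The differential polynomials at a Laurent series -/

/-- Evaluation of differential polynomials at a Laurent series. -/
def laurentEval (x : LaurentSeries ℂ) : MvPolynomial ℕ ℂ →ₐ[ℂ] LaurentSeries ℂ :=
  aeval fun n => ∂ₜ^[n] x

theorem laurentEval_X (x : LaurentSeries ℂ) (n : ℕ) : laurentEval x (X n) = ∂ₜ^[n] x :=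
  aeval_X _ _

theorem laurentEval_totalDeriv (x : LaurentSeries ℂ) (p : MvPolynomial ℕ ℂ) :
    laurentEval x (totalDeriv p) = ∂ₜ (laurentEval x p) := by
  induction p using MvPolynomial.induction_on with
  | C a =>
    rw [show totalDeriv (C a) = 0 from totalDeriv.map_algebraMap a, map_zero, laurentEval, aeval_C,
      algebraMap_laurentSeries, derivative_C]
  | add p q hp hq => simp only [map_add, hp, hq]
  | mul_X p n hp =>
    rw [Derivation.leibniz, totalDeriv_X, smul_eq_mul, smul_eq_mul, map_add, map_mul, map_mul,
      map_mul, derivative_mul, hp, laurentEval_X, laurentEval_X, Function.iterate_succ_apply']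

/-! ### Skew-adjointness of the Lenard operator and involution -/

/-- The differential operator of the Lenard recursion. -/
def lenardOp (x f : LaurentSeries ℂ) : LaurentSeries ℂ :=
  ∂ₜ (∂ₜ (∂ₜ f)) - 8 * x * ∂ₜ f - 4 * ∂ₜ x * f

theorem derivative_laurentEval_lenard_succ (x : LaurentSeries ℂ) (j : ℕ) :
    ∂ₜ (laurentEval x (lenard (j + 1))) = lenardOp x (laurentEval x (lenard j)) := by
  rw [← laurentEval_totalDeriv, lenard_spec.succ]
  simp only [map_sub, map_mul, laurentEval_totalDeriv, map_ofNat, laurentEval_X,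
    Function.iterate_zero_apply, Function.iterate_one, lenardOp]

/-- The operator of the Lenard recursion is skew-adjoint. -/
theorem residue_mul_lenardOp (x f g : LaurentSeries ℂ) :
    (f * lenardOp x g).coeff (-1) = -(g * lenardOp x f).coeff (-1) := by
  have h8 : ∀ h, ∂ₜ (8 * h) = 8 * ∂ₜ h := fun h => by
    rw [show (8 : LaurentSeries ℂ) = HahnSeries.C 8 from (map_ofNat HahnSeries.C 8).symm,
      derivative_mul, derivative_C, mul_zero, add_zero]
  -- The bilinear concomitant of the operator: the symmetrized product is an exact derivative.
  have h : f * lenardOp x g + g * lenardOp x f =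
      ∂ₜ (f * ∂ₜ (∂ₜ g) - ∂ₜ f * ∂ₜ g + ∂ₜ (∂ₜ f) * g - 8 * (x * (f * g))) := by
    simp only [map_sub, map_add, h8, derivative_mul, lenardOp]
    ring
  have h2 := residue_derivative (f * ∂ₜ (∂ₜ g) - ∂ₜ f * ∂ₜ g + ∂ₜ (∂ₜ f) * g - 8 * (x * (f * g)))
  rw [← h, HahnSeries.coeff_add] at h2
  exact eq_neg_of_add_eq_zero_left h2

/-- The Lenard polynomials are in involution. -/
theorem residue_lenard_mul_derivative (x : LaurentSeries ℂ) (i j : ℕ) :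
    (laurentEval x (lenard i) * ∂ₜ (laurentEval x (lenard j))).coeff (-1) = 0 := by
  induction j generalizing i with
  | zero =>
    rw [lenard_spec.zero, map_one, ← HahnSeries.C_one, derivative_C, mul_zero]
    rfl
  | succ j ih =>
    -- Lenard's shift of indices: skew-adjointness turns the residue of `𝓛_i ∂𝓛_{j+1}` into minus
    -- that of `𝓛_j ∂𝓛_{i+1}`, and integration by parts into that of `𝓛_{i+1} ∂𝓛_j`, which has
    -- smaller second index.
    rw [derivative_laurentEval_lenard_succ, residue_mul_lenardOp,
      ← derivative_laurentEval_lenard_succ]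
    have h := residue_derivative (laurentEval x (lenard j) * laurentEval x (lenard (i + 1)))
    rw [derivative_mul, HahnSeries.coeff_add, ih, add_zero] at h
    rw [h, neg_zero]

/-! ### Trivial monodromy and the compatibility conditions -/

/-- Laurent series `k(k+1)/2 t⁻² + ⋯` all of whose coefficients of odd order less than `2k+1`
vanish. These are the potentials with trivial monodromy. -/
structure IsMonodromyFree (k : ℕ) (x : LaurentSeries ℂ) : Prop where
  leading : x.coeff (-2) = (k : ℂ) * (k + 1) / 2
  order : ∀ l < (-2 : ℤ), x.coeff l = 0
  odd : ∀ l : ℤ, Odd l → l < 2 * k + 1 → x.coeff l = 0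

variable {k : ℕ} {x : LaurentSeries ℂ}

/-- The part of nonnegative order of a monodromy free series. -/
theorem IsMonodromyFree.exists_regular (hx : IsMonodromyFree k x) :
    ∃ y : LaurentSeries ℂ, x = HahnSeries.single (-2) ((k : ℂ) * (k + 1) / 2) + y ∧
      (∀ l < (0 : ℤ), y.coeff l = 0) ∧ ∀ l : ℤ, Odd l → l < 2 * k + 1 → y.coeff l = 0 := by
  refine ⟨x - HahnSeries.single (-2) ((k : ℂ) * (k + 1) / 2), by ring, fun l hl => ?_,
    fun l hl hlk => ?_⟩
  · rw [HahnSeries.coeff_sub]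
    rcases lt_trichotomy l (-2) with h | h | h
    · rw [hx.order l h, HahnSeries.coeff_single_of_ne h.ne, sub_zero]
    · rw [h, hx.leading, HahnSeries.coeff_single_same, sub_self]
    · obtain rfl : l = -1 := by omega
      rw [hx.odd (-1) (by decide) (by omega), HahnSeries.coeff_single_of_ne (by decide), sub_zero]
  · rw [HahnSeries.coeff_sub, hx.odd l hl hlk, HahnSeries.coeff_single_of_ne, sub_zero]
    rintro rfl
    exact absurd hl (by decide)

/-- The operator with potential `a t⁻²` maps powers to powers, and the rest `y` enters only through
two convolutions. The order is written `l - 1` because there the derivative of `𝓛_{j+1}` has `l`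
times its coefficient of order `l`. -/
theorem coeff_lenardOp (a : ℂ) (y f : LaurentSeries ℂ) (l : ℤ) :
    (lenardOp (HahnSeries.single (-2) a + y) f).coeff (l - 1) =
      ((l : ℂ) + 1) * (l * (l + 2) - 8 * a) * f.coeff (l + 2) - 8 * (y * ∂ₜ f).coeff (l - 1)
        - 4 * (∂ₜ y * f).coeff (l - 1) := by
  have h8 : (8 : LaurentSeries ℂ) = HahnSeries.C 8 := (map_ofNat HahnSeries.C 8).symm
  have h4 : (4 : LaurentSeries ℂ) = HahnSeries.C 4 := (map_ofNat HahnSeries.C 4).symm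
  have hs : ∀ (b : ℂ) (n : ℤ) (g : LaurentSeries ℂ) (r : ℤ),
      (HahnSeries.single n b * g).coeff r = b * g.coeff (r - n) := by
    intro b n g r
    have := HahnSeries.coeff_single_mul_add (r := b) (x := g) (a := r - n) (b := n)
    rwa [sub_add_cancel] at this
  have hd : ∂ₜ (HahnSeries.single (-2) a) = HahnSeries.single (-3) (-2 * a) := by
    rw [LaurentSeries.derivative_apply, LaurentSeries.hasseDeriv_single]
    simp
  have e : lenardOp (HahnSeries.single (-2) a + y) f = ∂ₜ (∂ₜ (∂ₜ f))
      - HahnSeries.C 8 * (HahnSeries.single (-2) a * ∂ₜ f)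
      - HahnSeries.C 8 * (y * ∂ₜ f) - HahnSeries.C 4 * (HahnSeries.single (-3) (-2 * a) * f)
      - HahnSeries.C 4 * (∂ₜ y * f) := by
    rw [lenardOp, map_add, hd, h8, h4]
    ring
  rw [e]
  simp only [HahnSeries.coeff_sub, HahnSeries.C_mul_eq_smul, HahnSeries.coeff_smul, hs,
    coeff_derivative, smul_eq_mul]
  rw [show l - 1 + 1 + 1 + 1 = l + 2 by ring, show l - 1 - -2 + 1 = l + 2 by ring,
    show l - 1 - -3 = l + 2 by ring]
  push_cast
  ring

theorem coeff_laurentEval_lenard_succ (a : ℂ) (y : LaurentSeries ℂ) (j : ℕ) (l : ℤ)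
    (h1 : (y * ∂ₜ (laurentEval (HahnSeries.single (-2) a + y) (lenard j))).coeff (l - 1) = 0)
    (h2 : (∂ₜ y * laurentEval (HahnSeries.single (-2) a + y) (lenard j)).coeff (l - 1) = 0) :
    l * (laurentEval (HahnSeries.single (-2) a + y) (lenard (j + 1))).coeff l =
      ((l : ℂ) + 1) * (l * (l + 2) - 8 * a) *
        (laurentEval (HahnSeries.single (-2) a + y) (lenard j)).coeff (l + 2) := by
  have h := congrArg (fun f => f.coeff (l - 1))
    (derivative_laurentEval_lenard_succ (HahnSeries.single (-2) a + y) j)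
  simp only [coeff_lenardOp, h1, h2, coeff_derivative] at h
  rw [sub_add_cancel] at h
  push_cast at h
  linear_combination h

theorem coeff_derivative_eq_zero {y : LaurentSeries ℂ} {b : ℤ} (h : b + 1 = 0 ∨ y.coeff (b + 1) = 0) :
    (∂ₜ y).coeff b = 0 := by
  rw [coeff_derivative]
  rcases h with h | h
  · have : (b : ℂ) + 1 = 0 := by exact_mod_cast h
    rw [this, zero_mul]
  · rw [h, mul_zero]

/-- `𝓛_j` has a pole of order at most `2j`. -/
theorem IsMonodromyFree.coeff_lenard_lt (hx : IsMonodromyFree k x) (j : ℕ) (l : ℤ)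
    (hl : l < -2 * j) : (laurentEval x (lenard j)).coeff l = 0 := by
  obtain ⟨y, rfl, hy0, -⟩ := hx.exists_regular
  induction j generalizing l with
  | zero =>
    rw [lenard_spec.zero, map_one, HahnSeries.coeff_one, if_neg]
    rintro rfl
    simp at hl
  | succ j ih =>
    push_cast at hl
    have h := coeff_laurentEval_lenard_succ ((k : ℂ) * (k + 1) / 2) y j l
      (coeff_mul_eq_zero fun a b hab => by
        by_cases ha : a < 0
        · exact Or.inl (hy0 a ha)
        · exact Or.inr (coeff_derivative_eq_zero (Or.inr (ih _ (by omega)))))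
      (coeff_mul_eq_zero fun a b hab => by
        by_cases ha : a < 0
        · refine Or.inl (coeff_derivative_eq_zero ?_)
          by_cases ha' : a + 1 = 0
          · exact Or.inl ha'
          · exact Or.inr (hy0 _ (by omega))
        · exact Or.inr (ih _ (by omega)))
    rw [ih (l + 2) (by omega), mul_zero] at h
    exact (mul_eq_zero.mp h).resolve_left (by exact_mod_cast (show l ≠ 0 by omega))

/-- The leading coefficient of `𝓛_j`, `j ≤ k`. -/
theorem IsMonodromyFree.coeff_lenard_ne_zero (hx : IsMonodromyFree k x) {j : ℕ} (hj : j ≤ k) :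
    (laurentEval x (lenard j)).coeff (-2 * j) ≠ 0 := by
  obtain ⟨y, hxy, hy0, -⟩ := hx.exists_regular
  induction j with
  | zero => rw [lenard_spec.zero, map_one]; simp
  | succ j ih =>
    have hlt := hx.coeff_lenard_lt j
    have ih := ih (by omega)
    rw [hxy] at ih hlt ⊢
    have h := coeff_laurentEval_lenard_succ ((k : ℂ) * (k + 1) / 2) y j (-2 * (j + 1 : ℕ))
      (coeff_mul_eq_zero fun a b hab => by
        push_cast at hab
        by_cases ha : a < 0
        · exact Or.inl (hy0 a ha)
        · exact Or.inr (coeff_derivative_eq_zero (Or.inr (hlt _ (by omega)))))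
      (coeff_mul_eq_zero fun a b hab => by
        push_cast at hab
        by_cases ha : a < 0
        · refine Or.inl (coeff_derivative_eq_zero ?_)
          by_cases ha' : a + 1 = 0
          · exact Or.inl ha'
          · exact Or.inr (hy0 _ (by omega))
        · exact Or.inr (hlt _ (by omega)))
    intro h0
    rw [h0, mul_zero, show (-2 * ((j + 1 : ℕ) : ℤ) + 2) = -2 * j by push_cast; ring] at h
    refine mul_ne_zero (mul_ne_zero ?_ ?_) ih h.symm
    · have : (-2 * ((j + 1 : ℕ) : ℤ) + 1) ≠ 0 := by push_cast; omega
      exact_mod_cast this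
    -- At `l = -2(j+1)` the factor `l(l+2) - 4k(k+1)` equals `4(j-k)(j+k+1)`, nonzero since `j < k`.
    · have h1 : ((j : ℤ) - k) * (j + k + 1) ≠ 0 :=
        mul_ne_zero (by omega) (by omega)
      have h2 : (((j : ℂ) - k) * (j + k + 1)) ≠ 0 := by exact_mod_cast h1
      intro h3
      apply h2
      push_cast at h3
      linear_combination h3 / 4

/-- `𝓛_j` has a pole of order at most `2k`, and only even powers in its principal part. -/
theorem IsMonodromyFree.coeff_lenard_eq_zero (hk : 1 ≤ k) (hx : IsMonodromyFree k x) (j : ℕ)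
    (l : ℤ) (hl : l < -2 * k ∨ (Odd l ∧ l < 0)) : (laurentEval x (lenard j)).coeff l = 0 := by
  obtain ⟨y, rfl, hy0, hy1⟩ := hx.exists_regular
  induction j generalizing l with
  | zero =>
    rw [lenard_spec.zero, map_one, HahnSeries.coeff_one, if_neg]
    rintro rfl
    simp at hl
    omega
  | succ j ih =>
    have h := coeff_laurentEval_lenard_succ ((k : ℂ) * (k + 1) / 2) y j l
      (coeff_mul_eq_zero fun a b hab => by
        -- The orders in `y` and in `𝓛_j` add up to `l`. An even nonnegative order in `y` leaves an
        -- order excluded by `ih`; an odd one is at least `2k+1` and leaves an order below `-2k`.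
        by_cases ha : a < 0 ∨ (Odd a ∧ a < 2 * k + 1)
        · rcases ha with ha | ha
          · exact Or.inl (hy0 a ha)
          · exact Or.inl (hy1 a ha.1 ha.2)
        · refine Or.inr (coeff_derivative_eq_zero (Or.inr (ih _ ?_)))
          simp only [Int.odd_iff] at ha hl ⊢
          omega)
      (coeff_mul_eq_zero fun a b hab => by
        by_cases ha : a + 1 < 0 ∨ a + 1 = 0 ∨ (Odd (a + 1) ∧ a + 1 < 2 * k + 1)
        · rcases ha with ha | ha | ha
          · exact Or.inl (coeff_derivative_eq_zero (Or.inr (hy0 _ ha)))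
          · exact Or.inl (coeff_derivative_eq_zero (Or.inl ha))
          · exact Or.inl (coeff_derivative_eq_zero (Or.inr (hy1 _ ha.1 ha.2)))
        · refine Or.inr (ih _ ?_)
          simp only [Int.odd_iff] at ha hl ⊢
          omega)
    have hl0 : (l : ℂ) ≠ 0 := by
      exact_mod_cast (show l ≠ 0 by simp only [Int.odd_iff] at hl; omega)
    have hz : ((l : ℂ) + 1) * (l * (l + 2) - 8 * ((k : ℂ) * (k + 1) / 2)) *
        (laurentEval (HahnSeries.single (-2) ((k : ℂ) * (k + 1) / 2) + y) (lenard j)).coeff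
          (l + 2) = 0 := by
      by_cases h1 : l + 2 < -2 * k ∨ (Odd (l + 2) ∧ l + 2 < 0)
      · rw [ih _ h1, mul_zero]
      -- Only these two orders are not covered by `ih`. The scalar factor vanishes at both: `l + 1 =
      -- 0` at the first, `l(l+2) = 4k(k+1)` at the second.
      · have : l = -1 ∨ l = -2 * k - 2 := by
          simp only [Int.odd_iff] at h1 hl
          omega
        rcases this with rfl | rfl
        · simp
        · push_cast
          ring
    rw [hz] at h
    exact (mul_eq_zero.mp h).resolve_left hl0

/-- The compatibility conditions at the resonances `2m + 4, …, 2m + 2k + 2`. -/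
theorem IsMonodromyFree.resonance (hk : 1 ≤ k) (hx : IsMonodromyFree k x) (j i : ℕ) (hi : 1 ≤ i)
    (hik : i ≤ k) (a b : ℂ)
    (h : ∀ l : ℤ, l < 2 * i → (laurentEval x (lenard j)).coeff l =
      (HahnSeries.C a + HahnSeries.single 1 b : LaurentSeries ℂ).coeff l) :
    (laurentEval x (lenard j)).coeff (2 * i) = 0 := by
  have hres := residue_lenard_mul_derivative x i j
  set f := laurentEval x (lenard i) with hf
  set F := laurentEval x (lenard j) with hF
  have hdb : ∂ₜ (HahnSeries.C a + HahnSeries.single 1 b : LaurentSeries ℂ) = HahnSeries.C b := by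
    rw [map_add, derivative_C, zero_add, LaurentSeries.derivative_apply,
      LaurentSeries.hasseDeriv_single]
    simp
  have hG : ∀ l : ℤ, (∂ₜ F - HahnSeries.C b).coeff l =
      ((l : ℂ) + 1) * (F.coeff (l + 1) -
        (HahnSeries.C a + HahnSeries.single 1 b : LaurentSeries ℂ).coeff (l + 1)) := by
    intro l
    rw [← hdb, ← map_sub, coeff_derivative, HahnSeries.coeff_sub]
  have hlow : ∀ l < (2 * i - 1 : ℤ), (∂ₜ F - HahnSeries.C b).coeff l = 0 := fun l hl => by
    rw [hG, h (l + 1) (by omega), sub_self, mul_zero]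
  -- The residue of `𝓛_i (∂𝓛_j - b)` is the product of the two lowest coefficients. It is also zero:
  -- `𝓛_i ∂𝓛_j` has no residue by involution, and `b 𝓛_i` has none because the principal part of
  -- `𝓛_i` is even.
  have h1 := coeff_mul_lowest (hx.coeff_lenard_lt i) hlow
  rw [show (-2 * (i : ℤ) + (2 * i - 1)) = -1 by ring, mul_sub, HahnSeries.coeff_sub, hres,
    mul_comm f, HahnSeries.C_mul_eq_smul, HahnSeries.coeff_smul,
    hx.coeff_lenard_eq_zero hk i (-1) (Or.inr ⟨by decide, by decide⟩), smul_zero, sub_zero, hG,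
    sub_add_cancel] at h1
  have h2 : (HahnSeries.C a + HahnSeries.single 1 b : LaurentSeries ℂ).coeff (2 * i) = 0 := by
    rw [HahnSeries.coeff_add, HahnSeries.C_apply, HahnSeries.coeff_single_of_ne (by omega),
      HahnSeries.coeff_single_of_ne (by omega), add_zero]
  rw [h2, sub_zero] at h1
  have h3 := (mul_eq_zero.mp h1.symm).resolve_left (hx.coeff_lenard_ne_zero hik)
  refine (mul_eq_zero.mp h3).resolve_left ?_
  push_cast
  have : (2 * i : ℂ) ≠ 0 := by exact_mod_cast (show 2 * i ≠ 0 by omega)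
  simpa using this

/-! ### The system and its Kovalevskaya exponents -/

/-- The polynomial `P_m` in the variables of the first order system. -/
def systemPoly (m : ℕ) : MvPolynomial (Fin (2 * m)) ℂ :=
  aeval (fun n : ℕ => if hn : n < 2 * m then X (⟨n, hn⟩ : Fin (2 * m)) else 0) (painlevePoly m)

/-- The variables sent to `0` do not occur in `P_m`, by `painlevePoly_mem_supported`, so nothing is
lost in passing to finitely many variables. -/
theorem aeval_systemPoly {A : Type*} [CommSemiring A] [Algebra ℂ A] (m : ℕ) (y : ℕ → A) :
    aeval (fun i : Fin (2 * m) => y i) (systemPoly m) = aeval y (painlevePoly m) := by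
  rw [systemPoly, ← AlgHom.comp_apply, comp_aeval]
  refine eval₂Hom_congr' rfl (fun i hi _ => ?_) rfl
  have h : i + 1 < 2 * m := mem_supported.mp (painlevePoly_mem_supported m) hi
  simp [show i < 2 * m by omega]

theorem aeval_field {A : Type*} [CommSemiring A] [Algebra ℂ A] (m : ℕ)
    (g : Option (Fin (2 * m)) → A) (i : Fin (2 * m)) :
    aeval g (field m i) = if h : (i : ℕ) + 1 < 2 * m then g (some ⟨i + 1, h⟩)
      else aeval (fun j => g (some j)) (systemPoly m) + g none := by
  rw [field]
  split_ifs with h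
  · rw [aeval_X]
  · rw [map_add, aeval_X, systemPoly, ← AlgHom.comp_apply, ← AlgHom.comp_apply, comp_aeval,
      comp_aeval]
    congr 3
    funext n
    split_ifs <;> simp

theorem autonomousPart_field (m : ℕ) (i : Fin (2 * m)) :
    autonomousPart (field m) i = if h : (i : ℕ) + 1 < 2 * m then X ⟨i + 1, h⟩
      else systemPoly m := by
  rw [autonomousPart, aeval_field]
  simp only [Option.elim_some, Option.elim_none, add_zero]
  split_ifs
  · rfl
  · rw [aeval_X_left_apply]

/-- First-order Taylor expansion over the dual numbers; it identifies the Jacobian of the system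
with the linearization computed by `linHom`. -/
theorem aeval_inl_add_inr {σ : Type*} [Fintype σ] (c : σ → ℂ) (b : σ → Polynomial ℂ)
    (p : MvPolynomial σ ℂ) :
    (aeval (fun i => (TrivSqZeroExt.inl (Polynomial.C (c i)) + TrivSqZeroExt.inr (b i) :
      DualNumber (Polynomial ℂ))) p).fst = Polynomial.C (eval c p) ∧
    (aeval (fun i => (TrivSqZeroExt.inl (Polynomial.C (c i)) + TrivSqZeroExt.inr (b i) :
      DualNumber (Polynomial ℂ))) p).snd =
        ∑ j, Polynomial.C (eval c (pderiv j p)) * b j := by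
  classical
  induction p using MvPolynomial.induction_on with
  | C a =>
    rw [aeval_C, show algebraMap ℂ (DualNumber (Polynomial ℂ)) a =
      TrivSqZeroExt.inl (Polynomial.C a) from rfl]
    simp
  | add p q hp hq =>
    simp only [map_add, TrivSqZeroExt.fst_add, TrivSqZeroExt.snd_add, hp.1, hp.2, hq.1, hq.2,
      add_mul, Finset.sum_add_distrib, and_self]
  | mul_X p n hp =>
    simp only [map_mul, aeval_X, TrivSqZeroExt.fst_mul, TrivSqZeroExt.snd_mul, hp.1, hp.2,
      TrivSqZeroExt.fst_add, TrivSqZeroExt.snd_add, TrivSqZeroExt.fst_inl, TrivSqZeroExt.fst_inr,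
      TrivSqZeroExt.snd_inl, TrivSqZeroExt.snd_inr, add_zero, zero_add, eval_X, true_and,
      MulOpposite.smul_eq_mul_unop, MulOpposite.unop_op, smul_eq_mul, Derivation.leibniz, map_add,
      add_mul, Finset.sum_add_distrib, pderiv_X, Pi.single_apply]
    congr 1
    · rw [Finset.sum_eq_single n]
      · simp
      · intro j _ hj
        simp [Ne.symm hj]
      · simp
    · rw [Finset.sum_mul]
      refine Finset.sum_congr rfl fun j _ => ?_
      ring

theorem leadingCoeff_eq (m k : ℕ) (i : Fin (2 * m)) : leadingCoeff m k i =
    (k : ℂ) * (k + 1) / 2 * ((-1) ^ (i : ℕ) * (Nat.factorial ((i : ℕ) + 1) : ℂ)) := by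
  rw [leadingCoeff, pow_add]
  ring

theorem linHom_painlevePoly (m k : ℕ) :
    Polynomial.C (eval (leadingCoeff m k) (systemPoly m)) =
      (linHom ((k : ℂ) * (k + 1) / 2) (painlevePoly m)).fst ∧
    ∑ j : Fin (2 * m), Polynomial.C (eval (leadingCoeff m k) (pderiv j (systemPoly m))) *
        descPoly j = (linHom ((k : ℂ) * (k + 1) / 2) (painlevePoly m)).snd := by
  have h := aeval_inl_add_inr (leadingCoeff m k) (fun j => descPoly j) (systemPoly m)
  rw [← h.1, ← h.2, linHom, ← aeval_systemPoly]
  simp only [leadingCoeff_eq, and_self]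

/-- Because `𝓛_{m+1}` vanishes at `k(k+1)/2 z⁻²` when `k ≤ m`, the value of `P_m` there is that of
`x^(2m)`. -/
theorem eval_leadingCoeff_systemPoly {m k : ℕ} (h : k ≤ m) :
    eval (leadingCoeff m k) (systemPoly m) =
      (k : ℂ) * (k + 1) / 2 * ((-1) ^ (2 * m) * (Nat.factorial (2 * m + 1) : ℂ)) := by
  apply Polynomial.C_injective
  rw [(linHom_painlevePoly m k).1, painlevePoly, map_add, map_mul, TrivSqZeroExt.fst_add,
    TrivSqZeroExt.fst_mul, show (linHom ((k : ℂ) * (k + 1) / 2) (lenard (m + 1))).fst = 0 from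
      lenardValue_eq_zero (Nat.lt_succ_of_le h), linHom_X]
  simp

/-- The characteristic polynomial of the Kovalevskaya matrix. -/
def indicialPoly (m k : ℕ) : Polynomial ℂ :=
  descPoly (2 * m) - ∑ j : Fin (2 * m),
    Polynomial.C (eval (leadingCoeff m k) (pderiv j (systemPoly m))) * descPoly j

/-- The linearization of `x^(2m)` cancels in `x^(2m) - P_m = -𝓛_{m+1}/4`, and the factor `-4` of
`lenardLin_eq_exponentPoly` compensates the `-1/4`. -/
theorem indicialPoly_eq_exponentPoly {m k : ℕ} (h : k ≤ m) :
    indicialPoly m k = exponentPoly k m := by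
  have hC : linHom ((k : ℂ) * (k + 1) / 2) (C (1 / 4)) =
      TrivSqZeroExt.inl (Polynomial.C (1 / 4)) := by rw [linHom, aeval_C]; rfl
  have h4 : (Polynomial.C (1 / 4 : ℂ)) * 4 = 1 := by
    rw [← map_ofNat Polynomial.C, ← map_mul]; norm_num
  rw [indicialPoly, (linHom_painlevePoly m k).2, painlevePoly, map_add, map_mul,
    TrivSqZeroExt.snd_add, TrivSqZeroExt.snd_mul, hC,
    show (linHom ((k : ℂ) * (k + 1) / 2) (lenard (m + 1))).snd = -4 * exponentPoly k m from
      lenardLin_eq_exponentPoly h, linHom_X]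
  simp only [TrivSqZeroExt.snd_add, TrivSqZeroExt.snd_inl, TrivSqZeroExt.snd_inr,
    TrivSqZeroExt.fst_inl, zero_add, smul_zero, add_zero, smul_eq_mul]
  linear_combination exponentPoly k m * h4

theorem isIndicialRoot_leadingCoeff {m k : ℕ} (h : k ≤ m) :
    IsIndicialRoot (field m) (weight m) (leadingCoeff m k) := by
  intro i
  rw [autonomousPart_field]
  have hi := i.2
  split_ifs with hlt
  · rw [eval_X, leadingCoeff_eq, leadingCoeff_eq, weight]
    simp only [Nat.factorial_succ ((i : ℕ) + 1)]
    push_cast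
    ring
  · rw [eval_leadingCoeff_systemPoly h, leadingCoeff_eq, weight]
    obtain ⟨j, hj⟩ := i
    simp only at hi hlt ⊢
    rw [show 2 * m = j + 1 by omega, Nat.factorial_succ (j + 1)]
    push_cast
    ring

/-! ### The spectrum of the Kovalevskaya matrix and its positive part -/

/-- The exponents listed in the theorem. -/
def exponentList (k m : ℕ) : Multiset ℂ :=
  (Finset.Icc 1 (m - k)).val.map (fun i : ℕ => 2 * (i : ℂ))
      + (Finset.Icc (k + 1) m).val.map (fun i : ℕ => 2 * (i : ℂ) + 1)
      + (Finset.Icc 1 k).val.map (fun i : ℕ => 2 * (m : ℂ) + 2 * (i : ℂ) + 2)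
      + (Finset.Icc 1 k).val.map (fun i : ℕ => -(2 * (i : ℂ) - 1))

theorem mem_exponentList {k m : ℕ} {ρ : ℂ} : ρ ∈ exponentList k m ↔
    (∃ i : ℕ, (1 ≤ i ∧ i ≤ m - k) ∧ 2 * (i : ℂ) = ρ) ∨
    (∃ i : ℕ, (k + 1 ≤ i ∧ i ≤ m) ∧ 2 * (i : ℂ) + 1 = ρ) ∨
    (∃ i : ℕ, (1 ≤ i ∧ i ≤ k) ∧ 2 * (m : ℂ) + 2 * (i : ℂ) + 2 = ρ) ∨
    (∃ i : ℕ, (1 ≤ i ∧ i ≤ k) ∧ -(2 * (i : ℂ) - 1) = ρ) := by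
  simp only [exponentList, Multiset.mem_add, Multiset.mem_map, Finset.mem_val, Finset.mem_Icc,
    or_assoc]

theorem prod_exponentList (k m : ℕ) :
    ((exponentList k m).map fun ρ => Polynomial.X - Polynomial.C ρ).prod = exponentPoly k m := by
  have h : ∀ (s : Finset ℕ) (f : ℕ → ℂ) (g : ℕ → Polynomial ℂ),
      (∀ i, Polynomial.X - Polynomial.C (f i) = g i) →
      ((s.val.map f).map fun ρ => Polynomial.X - Polynomial.C ρ).prod = ∏ i ∈ s, g i := by
    intro s f g hfg
    rw [Multiset.map_map, Finset.prod]
    exact congrArg Multiset.prod (Multiset.map_congr rfl fun i _ => hfg i)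
  rw [exponentList, Multiset.map_add, Multiset.map_add, Multiset.map_add, Multiset.prod_add,
    Multiset.prod_add, Multiset.prod_add, exponentPoly]
  have h1 := map_ofNat (Polynomial.C : ℂ →+* _) 2
  refine congrArg₂ _ (congrArg₂ _ (congrArg₂ _ (h _ _ _ ?_) (h _ _ _ ?_)) (h _ _ _ ?_))
    (h _ _ _ ?_)
  all_goals
    intro i
    simp only [map_mul, map_add, map_sub, map_neg, map_one, map_natCast, h1]
  all_goals ring

theorem card_exponentList {k m : ℕ} (h : k ≤ m) : (exponentList k m).card = 2 * m := by
  simp [exponentList]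
  omega

/-- Parity, sign and size separate the four families. Simplicity of the exponents makes one
eigenvector for each sufficient to determine multiplicities. -/
theorem nodup_exponentList {k m : ℕ} : (exponentList k m).Nodup := by
  have hinj : ∀ (f : ℕ → ℂ) (s : Finset ℕ), (∀ i j, f i = f j → i = j) → (s.val.map f).Nodup :=
    fun f s hf => Multiset.Nodup.map (fun i j hij => hf i j hij) s.nodup
  rw [exponentList]
  refine Multiset.nodup_add.mpr ⟨Multiset.nodup_add.mpr ⟨Multiset.nodup_add.mpr ⟨?_, ?_, ?_⟩,
    ?_, ?_⟩, ?_, ?_⟩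
  · exact hinj _ _ fun i j h => by simpa using h
  · exact hinj _ _ fun i j h => by simpa using h
  · rw [Multiset.disjoint_left]
    simp only [Multiset.mem_map, Finset.mem_val, Finset.mem_Icc, not_exists, not_and]
    rintro _ ⟨i, hi, rfl⟩ j hj h
    have : 2 * j + 1 = 2 * i := by exact_mod_cast h
    omega
  · exact hinj _ _ fun i j h => by simpa using h
  · rw [Multiset.disjoint_left]
    simp only [Multiset.mem_add, Multiset.mem_map, Finset.mem_val, Finset.mem_Icc, not_exists,
      not_and]
    rintro _ (⟨i, hi, rfl⟩ | ⟨i, hi, rfl⟩) j hj h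
    · have : 2 * m + 2 * j + 2 = 2 * i := by exact_mod_cast h
      omega
    · have : 2 * m + 2 * j + 2 = 2 * i + 1 := by exact_mod_cast h
      omega
  · exact hinj _ _ fun i j h => by simpa using h
  · rw [Multiset.disjoint_left]
    simp only [Multiset.mem_add, Multiset.mem_map, Finset.mem_val, Finset.mem_Icc, not_exists,
      not_and]
    rintro _ ((⟨i, hi, rfl⟩ | ⟨i, hi, rfl⟩) | ⟨i, hi, rfl⟩) j hj h
    · have : -(2 * (j : ℤ) - 1) = 2 * i := by exact_mod_cast h
      omega
    · have : -(2 * (j : ℤ) - 1) = 2 * i + 1 := by exact_mod_cast h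
      omega
    · have : -(2 * (j : ℤ) - 1) = 2 * m + 2 * i + 2 := by exact_mod_cast h
      omega

theorem roots_indicialPoly {m k : ℕ} (h : k ≤ m) : (indicialPoly m k).roots = exponentList k m := by
  rw [indicialPoly_eq_exponentPoly h, ← prod_exponentList, Polynomial.roots_multiset_prod_X_sub_C]

theorem indicialPoly_eval_eq_zero_iff {m k : ℕ} (h : k ≤ m) (ρ : ℂ) :
    (indicialPoly m k).eval ρ = 0 ↔ ρ ∈ exponentList k m := by
  rw [← roots_indicialPoly h, Polynomial.mem_roots, Polynomial.IsRoot.def]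
  rw [indicialPoly_eq_exponentPoly h, ← prod_exponentList]
  exact (Polynomial.monic_multisetProd_X_sub_C _).ne_zero

/-- The vector consists of the coefficients of the successive derivatives of `z^(ρ-2)`. All rows but
the last express that each entry is the derivative of the preceding one; the last row is the
indicial equation. -/
theorem kovalevskayaMatrix_mulVec (m k : ℕ) (ρ : ℂ)
    (hρ : (indicialPoly m k).eval ρ = 0) :
    (kovalevskayaMatrix (field m) (weight m) (leadingCoeff m k)).mulVec
        (fun i => (descPoly i).eval ρ) = ρ • fun i : Fin (2 * m) => (descPoly i).eval ρ := by
  classical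
  funext i
  have hi := i.2
  have hs : (descPoly (i + 1)).eval ρ = (descPoly i).eval ρ * (ρ - (i + 2)) := by
    rw [descPoly_succ]; simp
  have hmv : (kovalevskayaMatrix (field m) (weight m) (leadingCoeff m k)).mulVec
        (fun i => (descPoly i).eval ρ) i = (∑ j : Fin (2 * m), eval (leadingCoeff m k)
          (pderiv j (autonomousPart (field m) i)) * (descPoly j).eval ρ) +
            ((i : ℂ) + 2) * (descPoly i).eval ρ := by
    rw [Matrix.mulVec, dotProduct]
    simp only [kovalevskayaMatrix, Matrix.of_apply, add_mul, Finset.sum_add_distrib, ite_mul,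
      zero_mul, Finset.sum_ite_eq, Finset.mem_univ, if_true, weight]
    push_cast
    ring
  rw [hmv, Pi.smul_apply, smul_eq_mul, autonomousPart_field]
  split_ifs with hlt
  · rw [Finset.sum_eq_single (⟨i + 1, hlt⟩ : Fin (2 * m))]
    · rw [pderiv_X_self, map_one, one_mul]
      simp only
      rw [hs]
      ring
    · intro j _ hj
      rw [pderiv_X_of_ne (Ne.symm hj), map_zero, zero_mul]
    · simp
  · rw [indicialPoly, Polynomial.eval_sub, Polynomial.eval_finsetSum] at hρ
    simp only [Polynomial.eval_mul, Polynomial.eval_C] at hρ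
    rw [show descPoly (2 * m) = descPoly (i + 1) from congrArg descPoly (by omega), hs] at hρ
    linear_combination -hρ

/-- The list supplies `2m` distinct eigenvalues, and the characteristic polynomial has degree `2m`,
so there is no room for others. -/
theorem kovalevskayaExponents_eq {m k : ℕ} (hk : 1 ≤ k) (h : k ≤ m) :
    kovalevskayaExponents (field m) (weight m) (leadingCoeff m k) = exponentList k m := by
  have hm : 0 < m := by omega
  set K := kovalevskayaMatrix (field m) (weight m) (leadingCoeff m k) with hK
  have hle : exponentList k m ≤ K.charpoly.roots := by
    rw [Multiset.le_iff_subset nodup_exponentList]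
    intro ρ hρ
    have hev := kovalevskayaMatrix_mulVec m k ρ ((indicialPoly_eval_eq_zero_iff h ρ).mpr hρ)
    rw [Polynomial.mem_roots (Matrix.charpoly_monic K).ne_zero, Polynomial.IsRoot.def,
      Matrix.eval_charpoly, ← Matrix.exists_mulVec_eq_zero_iff]
    refine ⟨fun i => (descPoly i).eval ρ, fun h0 => ?_, ?_⟩
    · have := congrFun h0 (⟨0, by omega⟩ : Fin (2 * m))
      simp [descPoly_zero] at this
    · rw [Matrix.sub_mulVec, hev]
      simp
  refine (Multiset.eq_of_le_of_card_le hle ?_).symm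
  rw [card_exponentList h]
  refine (Polynomial.card_roots' _).trans ?_
  rw [Matrix.charpoly_natDegree_eq_dim]
  simp

theorem mem_freeOrders_iff {m k : ℕ} (hk : 1 ≤ k) (h : k ≤ m) (n : ℕ) :
    n ∈ freeOrders m k ↔ 0 < n ∧ (indicialPoly m k).eval (n : ℂ) = 0 := by
  rw [freeOrders, kovalevskayaExponents_eq hk h, indicialPoly_eval_eq_zero_iff h]
  rfl

theorem mem_freeOrders_iff_exists {m k : ℕ} (hk : 1 ≤ k) (h : k ≤ m) (n : ℕ) :
    n ∈ freeOrders m k ↔ (∃ i, (1 ≤ i ∧ i ≤ m - k) ∧ 2 * i = n) ∨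
      (∃ i, (k + 1 ≤ i ∧ i ≤ m) ∧ 2 * i + 1 = n) ∨
      (∃ i, (1 ≤ i ∧ i ≤ k) ∧ 2 * m + 2 * i + 2 = n) := by
  rw [freeOrders, kovalevskayaExponents_eq hk h]
  show 0 < n ∧ _ ↔ _
  rw [mem_exponentList]
  constructor
  · rintro ⟨h0, ⟨i, hi, e⟩ | ⟨i, hi, e⟩ | ⟨i, hi, e⟩ | ⟨i, hi, e⟩⟩
    · exact Or.inl ⟨i, hi, by exact_mod_cast e⟩
    · exact Or.inr (Or.inl ⟨i, hi, by exact_mod_cast e⟩)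
    · exact Or.inr (Or.inr ⟨i, hi, by exact_mod_cast e⟩)
    · have : -(2 * (i : ℤ) - 1) = n := by exact_mod_cast e
      omega
  · rintro (⟨i, hi, e⟩ | ⟨i, hi, e⟩ | ⟨i, hi, e⟩)
    · exact ⟨by omega, Or.inl ⟨i, hi, by exact_mod_cast e⟩⟩
    · exact ⟨by omega, Or.inr (Or.inl ⟨i, hi, by exact_mod_cast e⟩)⟩
    · exact ⟨by omega, Or.inr (Or.inr (Or.inl ⟨i, hi, by exact_mod_cast e⟩))⟩

/-- The positive exponents as a finite set. -/
def freeFinset (m k : ℕ) : Finset ℕ :=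
  ((Finset.Icc 1 (m - k)).image (fun i => 2 * i) ∪
    (Finset.Icc (k + 1) m).image (fun i => 2 * i + 1)) ∪
    (Finset.Icc 1 k).image (fun i => 2 * m + 2 * i + 2)

theorem coe_freeFinset {m k : ℕ} (hk : 1 ≤ k) (h : k ≤ m) :
    (freeFinset m k : Set ℕ) = freeOrders m k := by
  ext n
  rw [mem_freeOrders_iff_exists hk h]
  simp [freeFinset]

theorem card_freeFinset {m k : ℕ} (h : k ≤ m) : (freeFinset m k).card = 2 * m - k := by
  rw [freeFinset, Finset.card_union_of_disjoint, Finset.card_union_of_disjoint,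
    Finset.card_image_of_injective, Finset.card_image_of_injective, Finset.card_image_of_injective]
  · simp only [Nat.card_Icc]
    omega
  · intro i j hij
    simpa using hij
  · intro i j hij
    simpa using hij
  · intro i j hij
    simpa using hij
  · rw [Finset.disjoint_left]
    simp only [Finset.mem_image, Finset.mem_Icc]
    rintro _ ⟨i, hi, rfl⟩ ⟨j, hj, e⟩
    omega
  · rw [Finset.disjoint_left]
    simp only [Finset.mem_image, Finset.mem_Icc, Finset.mem_union]
    rintro _ (⟨i, hi, rfl⟩ | ⟨i, hi, rfl⟩) ⟨j, hj, e⟩ <;> omega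

theorem ncard_freeOrders {m k : ℕ} (hk : 1 ≤ k) (h : k ≤ m) :
    (freeOrders m k).ncard = 2 * m - k := by
  rw [← coe_freeFinset hk h, Set.ncard_coe_finset, card_freeFinset h]

/-! ### Truncated norms of power series -/

/-- The `ℓ¹` norm with weights `r ^ n` of the first `N` coefficients of a power series. -/
def truncNorm (N : ℕ) (r : ℝ) (f : PowerSeries ℂ) : ℝ :=
  ∑ n ∈ Finset.range N, ‖PowerSeries.coeff n f‖ * r ^ n

theorem truncNorm_zero (N : ℕ) (r : ℝ) : truncNorm N r 0 = 0 := by simp [truncNorm]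

theorem truncNorm_nonneg {r : ℝ} (hr : 0 ≤ r) (N : ℕ) (f : PowerSeries ℂ) : 0 ≤ truncNorm N r f :=
  Finset.sum_nonneg fun _ _ => by positivity

theorem truncNorm_add_le {r : ℝ} (hr : 0 ≤ r) (N : ℕ) (f g : PowerSeries ℂ) :
    truncNorm N r (f + g) ≤ truncNorm N r f + truncNorm N r g := by
  rw [truncNorm, truncNorm, truncNorm, ← Finset.sum_add_distrib]
  refine Finset.sum_le_sum fun n _ => ?_
  rw [map_add, ← add_mul]
  exact mul_le_mul_of_nonneg_right (norm_add_le _ _) (by positivity)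

theorem truncNorm_sum_le {ι : Type*} {r : ℝ} (hr : 0 ≤ r) (N : ℕ) (s : Finset ι)
    (f : ι → PowerSeries ℂ) :
    truncNorm N r (∑ i ∈ s, f i) ≤ ∑ i ∈ s, truncNorm N r (f i) := by
  classical
  induction s using Finset.induction_on with
  | empty => simp [truncNorm_zero]
  | insert i s hi ih =>
    rw [Finset.sum_insert hi, Finset.sum_insert hi]
    exact (truncNorm_add_le hr N _ _).trans (by gcongr)

theorem truncNorm_C_mul (N : ℕ) (r : ℝ) (a : ℂ) (f : PowerSeries ℂ) :
    truncNorm N r (PowerSeries.C a * f) = ‖a‖ * truncNorm N r f := by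
  simp only [truncNorm, PowerSeries.coeff_C_mul, norm_mul, Finset.mul_sum, mul_assoc]

theorem truncNorm_mono {r : ℝ} (hr : 0 ≤ r) {N N' : ℕ} (h : N ≤ N') (f : PowerSeries ℂ) :
    truncNorm N r f ≤ truncNorm N' r f :=
  Finset.sum_le_sum_of_subset_of_nonneg (Finset.range_mono h) fun _ _ _ => by positivity

/-- Products of series without constant term gain one order. -/
theorem truncNorm_succ_mul_le {r : ℝ} (hr : 0 ≤ r) (N : ℕ) {f g : PowerSeries ℂ}
    (hf : PowerSeries.coeff 0 f = 0) (hg : PowerSeries.coeff 0 g = 0) :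
    truncNorm (N + 1) r (f * g) ≤ truncNorm N r f * truncNorm N r g := by
  classical
  set F : ℕ × ℕ → ℝ := fun p =>
    (‖PowerSeries.coeff p.1 f‖ * r ^ p.1) * (‖PowerSeries.coeff p.2 g‖ * r ^ p.2) with hF
  have hF0 : ∀ p, 0 ≤ F p := fun p => by positivity
  have h1 : truncNorm (N + 1) r (f * g) ≤
      ∑ n ∈ Finset.range (N + 1), ∑ p ∈ Finset.HasAntidiagonal.antidiagonal n, F p := by
    refine Finset.sum_le_sum fun n _ => ?_
    rw [PowerSeries.coeff_mul]
    refine (mul_le_mul_of_nonneg_right (norm_sum_le _ _) (by positivity)).trans ?_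
    rw [Finset.sum_mul]
    refine Finset.sum_le_sum fun p hp => ?_
    rw [norm_mul, hF, ← Finset.HasAntidiagonal.mem_antidiagonal.mp hp, pow_add]
    apply le_of_eq
    ring
  refine h1.trans ?_
  rw [Finset.sum_sigma', truncNorm, truncNorm, Finset.sum_mul_sum, ← Finset.sum_product']
  have hinj : Set.InjOn (fun x : (_ : ℕ) × ℕ × ℕ => x.2)
      ((Finset.range (N + 1)).sigma fun n => Finset.HasAntidiagonal.antidiagonal n) := by
    rintro ⟨a, p⟩ ha ⟨b, q⟩ hb hpq
    simp only [Finset.coe_sigma, Set.mem_sigma_iff, Finset.mem_coe,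
      Finset.HasAntidiagonal.mem_antidiagonal] at ha hb
    simp only at hpq
    subst hpq
    obtain rfl : a = b := ha.2.symm.trans hb.2
    rfl
  rw [← Finset.sum_image (f := F) hinj, ← Finset.sum_filter_ne_zero]
  refine Finset.sum_le_sum_of_subset_of_nonneg ?_ fun p _ _ => hF0 p
  intro p hp
  simp only [Finset.mem_filter, Finset.mem_image, Finset.mem_sigma, Finset.mem_range,
    Finset.HasAntidiagonal.mem_antidiagonal, Sigma.exists, exists_eq_right] at hp
  obtain ⟨⟨n, hn, hpn⟩, hne⟩ := hp
  -- Terms with a zero index vanish, so both indices are at least `1`; with sum at most `N`, both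
  -- are less than `N`.
  have hp1 : p.1 ≠ 0 := by
    intro h
    simp [hF, h, hf] at hne
  have hp2 : p.2 ≠ 0 := by
    intro h
    simp [hF, h, hg] at hne
  simp only [Finset.mem_product, Finset.mem_range]
  omega

/-! ### The nonlinear part of a polynomial at a point -/

/-- The terms of order at least two of `P` at `c`, evaluated at power series. -/
def taylorRemainder {σ : Type*} [Fintype σ] (P : MvPolynomial σ ℂ) (c : σ → ℂ)
    (v : σ → PowerSeries ℂ) : PowerSeries ℂ :=
  aeval (fun i => PowerSeries.C (c i) + v i) P - PowerSeries.C (eval c P)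
    - ∑ i, PowerSeries.C (eval c (pderiv i P)) * v i

section taylorRemainder

variable {σ : Type*} [Fintype σ] (P : MvPolynomial σ ℂ) (c : σ → ℂ)

theorem taylorRemainder_C (a : ℂ) (v : σ → PowerSeries ℂ) :
    taylorRemainder (C a) c v = 0 := by
  simp [taylorRemainder]

theorem taylorRemainder_add (Q : MvPolynomial σ ℂ) (v : σ → PowerSeries ℂ) :
    taylorRemainder (P + Q) c v = taylorRemainder P c v + taylorRemainder Q c v := by
  simp only [taylorRemainder, map_add, add_mul, Finset.sum_add_distrib]
  ring

/-- This recursion carries all inductions on `P`: the new quadratic terms are products of a linear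
form in `v` with `v j`. -/
theorem taylorRemainder_mul_X (j : σ) (v : σ → PowerSeries ℂ) :
    taylorRemainder (P * X j) c v = taylorRemainder P c v * (PowerSeries.C (c j) + v j) +
      (∑ i, PowerSeries.C (eval c (pderiv i P)) * v i) * v j := by
  classical
  have h : ∑ i, PowerSeries.C (eval c (pderiv i (P * X j))) * v i =
      PowerSeries.C (eval c P) * v j +
        PowerSeries.C (c j) * ∑ i, PowerSeries.C (eval c (pderiv i P)) * v i := by
    simp only [Derivation.leibniz, smul_eq_mul, map_add, map_mul, eval_X, pderiv_X,
      Pi.single_apply, add_mul, Finset.sum_add_distrib]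
    congr 1
    · rw [Finset.sum_eq_single j]
      · simp
      · intro i _ hi
        simp [Ne.symm hi]
      · simp
    · rw [Finset.mul_sum]
      exact Finset.sum_congr rfl fun i _ => by ring
  rw [taylorRemainder, h, taylorRemainder, map_mul, map_mul, aeval_X, eval_X, map_mul]
  ring

theorem taylorRemainder_zero : taylorRemainder P c 0 = 0 := by
  induction P using MvPolynomial.induction_on with
  | C a => exact taylorRemainder_C c a 0
  | add p q hp hq => rw [taylorRemainder_add, hp, hq, add_zero]
  | mul_X p n hp => rw [taylorRemainder_mul_X, hp]; simp

theorem coeff_zero_taylorRemainder {v : σ → PowerSeries ℂ}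
    (hv : ∀ i, PowerSeries.coeff 0 (v i) = 0) :
    PowerSeries.coeff 0 (taylorRemainder P c v) = 0 := by
  induction P using MvPolynomial.induction_on with
  | C a => rw [taylorRemainder_C, map_zero]
  | add p q hp hq => rw [taylorRemainder_add, map_add, hp, hq, add_zero]
  | mul_X p n hp =>
    have h0 : ∀ f g : PowerSeries ℂ, PowerSeries.coeff 0 (f * g) =
        PowerSeries.coeff 0 f * PowerSeries.coeff 0 g := fun f g => by simp
    rw [taylorRemainder_mul_X, map_add, h0, h0, hp, hv, zero_mul, mul_zero, add_zero]

/-- The remainder is Lipschitz, with a small constant on small series. -/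
theorem exists_truncNorm_taylorRemainder_le (S : ℝ) (hS : 0 ≤ S) : ∃ B : ℝ, 0 ≤ B ∧
    ∀ (r : ℝ) (_ : 0 ≤ r) (N : ℕ) (s d : ℝ) (v v' : σ → PowerSeries ℂ), 0 ≤ s → s ≤ S → 0 ≤ d →
      (∀ i, PowerSeries.coeff 0 (v i) = 0) → (∀ i, PowerSeries.coeff 0 (v' i) = 0) →
      (∀ i, truncNorm N r (v i) ≤ s) → (∀ i, truncNorm N r (v' i) ≤ s) →
      (∀ i, truncNorm N r (v i - v' i) ≤ d) →
      truncNorm (N + 1) r (taylorRemainder P c v - taylorRemainder P c v') ≤ B * s * d := by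
  induction P using MvPolynomial.induction_on with
  | C a =>
    refine ⟨0, le_rfl, fun r hr N s d v v' _ _ _ _ _ _ _ _ => ?_⟩
    rw [taylorRemainder_C, taylorRemainder_C, sub_zero, truncNorm_zero]
    simp
  | add p q hp hq =>
    obtain ⟨B₁, h1, hB₁⟩ := hp
    obtain ⟨B₂, h2, hB₂⟩ := hq
    refine ⟨B₁ + B₂, by positivity, fun r hr N s d v v' hs hsS hd hv hv' hvs hvs' hvd => ?_⟩
    rw [taylorRemainder_add, taylorRemainder_add, add_sub_add_comm]
    refine (truncNorm_add_le hr _ _ _).trans ?_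
    have e1 := hB₁ r hr N s d v v' hs hsS hd hv hv' hvs hvs' hvd
    have e2 := hB₂ r hr N s d v v' hs hsS hd hv hv' hvs hvs' hvd
    linarith
  | mul_X p j hp =>
    obtain ⟨B, hB0, hB⟩ := hp
    set Λ : ℝ := ∑ i, ‖eval c (pderiv i p)‖ with hΛ
    have hΛ0 : 0 ≤ Λ := Finset.sum_nonneg fun _ _ => norm_nonneg _
    -- The summands come from `b1`, from `b2` and `b3` (cubic in the small quantities, with one
    -- factor `s` replaced by `S`), and from `b4` and `b5`.
    refine ⟨‖c j‖ * B + 2 * B * S + 2 * Λ, by positivity,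
      fun r hr N s d v v' hs hsS hd hv hv' hvs hvs' hvd => ?_⟩
    set R := taylorRemainder p c v with hR
    set R' := taylorRemainder p c v' with hR'
    have hRR := hB r hr N s d v v' hs hsS hd hv hv' hvs hvs' hvd
    have hRN : truncNorm N r (R - R') ≤ B * s * d :=
      (truncNorm_mono hr (Nat.le_succ N) _).trans hRR
    -- Comparison with the zero series, at distance `d = s`, gives the quadratic bound for a single
    -- remainder.
    have hR'N : truncNorm N r R' ≤ B * s * s := by
      have := hB r hr N s s v' 0 hs hsS hs hv' (fun i => by simp) hvs'
        (fun i => by simpa [truncNorm_zero] using hs) (fun i => by simpa using hvs' i)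
      rw [taylorRemainder_zero, sub_zero] at this
      exact (truncNorm_mono hr (Nat.le_succ N) _).trans this
    have hlin : ∀ (w : σ → PowerSeries ℂ) (a : ℝ), (∀ i, truncNorm N r (w i) ≤ a) →
        truncNorm N r (∑ i, PowerSeries.C (eval c (pderiv i p)) * w i) ≤ Λ * a := by
      intro w a hw
      refine (truncNorm_sum_le hr _ _ _).trans ?_
      rw [hΛ, Finset.sum_mul]
      refine Finset.sum_le_sum fun i _ => ?_
      rw [truncNorm_C_mul]
      exact mul_le_mul_of_nonneg_left (hw i) (norm_nonneg _)
    have hlin0 : ∀ (w : σ → PowerSeries ℂ), (∀ i, PowerSeries.coeff 0 (w i) = 0) →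
        PowerSeries.coeff 0 (∑ i, PowerSeries.C (eval c (pderiv i p)) * w i) = 0 := by
      intro w hw
      rw [map_sum]
      refine Finset.sum_eq_zero fun i _ => ?_
      rw [PowerSeries.coeff_C_mul, hw, mul_zero]
    have hc0 : PowerSeries.coeff 0 R = 0 := coeff_zero_taylorRemainder p c hv
    have hc0' : PowerSeries.coeff 0 R' = 0 := coeff_zero_taylorRemainder p c hv'
    have hd0 : ∀ i, PowerSeries.coeff 0 (v i - v' i) = 0 := fun i => by
      rw [map_sub, hv, hv', sub_zero]
    have key : taylorRemainder (p * X j) c v - taylorRemainder (p * X j) c v' =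
        PowerSeries.C (c j) * (R - R') + (R - R') * v j + R' * (v j - v' j) +
        (∑ i, PowerSeries.C (eval c (pderiv i p)) * (v i - v' i)) * v j +
        (∑ i, PowerSeries.C (eval c (pderiv i p)) * v' i) * (v j - v' j) := by
      rw [taylorRemainder_mul_X, taylorRemainder_mul_X]
      simp only [mul_sub, Finset.sum_sub_distrib]
      ring
    have b1 : truncNorm (N + 1) r (PowerSeries.C (c j) * (R - R')) ≤ ‖c j‖ * (B * s * d) := by
      rw [truncNorm_C_mul]
      exact mul_le_mul_of_nonneg_left hRR (norm_nonneg _)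
    have b2 : truncNorm (N + 1) r ((R - R') * v j) ≤ (B * s * d) * s :=
      (truncNorm_succ_mul_le hr N (by rw [map_sub, hc0, hc0', sub_zero]) (hv j)).trans
        (mul_le_mul hRN (hvs j) (truncNorm_nonneg hr _ _) (by positivity))
    have b3 : truncNorm (N + 1) r (R' * (v j - v' j)) ≤ (B * s * s) * d :=
      (truncNorm_succ_mul_le hr N hc0' (hd0 j)).trans
        (mul_le_mul hR'N (hvd j) (truncNorm_nonneg hr _ _) (by positivity))
    have b4 : truncNorm (N + 1) r
        ((∑ i, PowerSeries.C (eval c (pderiv i p)) * (v i - v' i)) * v j) ≤ (Λ * d) * s :=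
      (truncNorm_succ_mul_le hr N (hlin0 _ hd0) (hv j)).trans
        (mul_le_mul (hlin _ d hvd) (hvs j) (truncNorm_nonneg hr _ _) (by positivity))
    have b5 : truncNorm (N + 1) r
        ((∑ i, PowerSeries.C (eval c (pderiv i p)) * v' i) * (v j - v' j)) ≤ (Λ * s) * d :=
      (truncNorm_succ_mul_le hr N (hlin0 _ hv') (hd0 j)).trans
        (mul_le_mul (hlin _ s hvs') (hvd j) (truncNorm_nonneg hr _ _) (by positivity))
    rw [key]
    refine (truncNorm_add_le hr _ _ _).trans ?_
    refine (add_le_add ((truncNorm_add_le hr _ _ _).trans (add_le_add ((truncNorm_add_le hr _ _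
      _).trans (add_le_add ((truncNorm_add_le hr _ _ _).trans (add_le_add b1 b2)) b3)) b4))
      b5).trans ?_
    have h6 : B * s * d * s ≤ B * s * d * S := by gcongr
    nlinarith [h6]

/-- The `n`-th coefficient of the remainder depends on the coefficients of lower order only. -/
theorem coeff_taylorRemainder_congr {v v' : σ → PowerSeries ℂ} {n : ℕ}
    (hv : ∀ i, PowerSeries.coeff 0 (v i) = 0) (hv' : ∀ i, PowerSeries.coeff 0 (v' i) = 0)
    (h : ∀ i, ∀ l < n, PowerSeries.coeff l (v i) = PowerSeries.coeff l (v' i)) :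
    PowerSeries.coeff n (taylorRemainder P c v) = PowerSeries.coeff n (taylorRemainder P c v') := by
  set s : ℝ := ∑ i, (truncNorm n 1 (v i) + truncNorm n 1 (v' i)) with hs
  have hpos : ∀ f, 0 ≤ truncNorm n 1 f := fun f => truncNorm_nonneg zero_le_one n f
  have hs0 : 0 ≤ s := Finset.sum_nonneg fun i _ => add_nonneg (hpos _) (hpos _)
  have hle : ∀ i, truncNorm n 1 (v i) + truncNorm n 1 (v' i) ≤ s := fun i =>
    Finset.single_le_sum (f := fun i => truncNorm n 1 (v i) + truncNorm n 1 (v' i))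
      (fun i _ => add_nonneg (hpos _) (hpos _)) (Finset.mem_univ i)
  obtain ⟨B, -, hB⟩ := exists_truncNorm_taylorRemainder_le P c s hs0
  -- With `d = 0` the Lipschitz bound is an exact statement: agreement of the arguments in orders
  -- below `n` forces agreement of the remainders in orders up to `n`.
  have := hB 1 zero_le_one n s 0 v v' hs0 le_rfl le_rfl hv hv'
    (fun i => by linarith [hle i, hpos (v' i)]) (fun i => by linarith [hle i, hpos (v i)])
    (fun i => le_of_eq (Finset.sum_eq_zero fun l hl => by
      rw [map_sub, h i l (Finset.mem_range.mp hl)]; simp))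
  rw [mul_zero] at this
  have h2 : ‖PowerSeries.coeff n (taylorRemainder P c v - taylorRemainder P c v')‖ * 1 ^ n ≤ 0 :=
    (Finset.single_le_sum (f := fun n => ‖PowerSeries.coeff n (taylorRemainder P c v -
      taylorRemainder P c v')‖ * (1 : ℝ) ^ n) (fun _ _ => by positivity)
      (Finset.self_mem_range_succ n)).trans this
  rw [one_pow, mul_one, map_sub] at h2
  exact sub_eq_zero.mp (norm_le_zero_iff.mp h2)

end taylorRemainder

/-! ### Formal Laurent series solutions -/

/-- The Laurent series `t ^ (-p) f`. -/
def shiftSeries (p : ℕ) (f : PowerSeries ℂ) : LaurentSeries ℂ :=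
  HahnSeries.single (-(p : ℤ)) 1 * HahnSeries.ofPowerSeries ℤ ℂ f

theorem coeff_shiftSeries (p : ℕ) (f : PowerSeries ℂ) (n : ℕ) :
    (shiftSeries p f).coeff ((n : ℤ) - p) = PowerSeries.coeff n f := by
  rw [shiftSeries, sub_eq_add_neg, HahnSeries.coeff_single_mul_add, one_mul,
    HahnSeries.ofPowerSeries_apply_coeff]

theorem coeff_shiftSeries_of_lt (p : ℕ) (f : PowerSeries ℂ) {l : ℤ} (h : l < -(p : ℤ)) :
    (shiftSeries p f).coeff l = 0 := by
  have := HahnSeries.coeff_single_mul_add (r := (1 : ℂ)) (x := HahnSeries.ofPowerSeries ℤ ℂ f)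
    (a := l + p) (b := -(p : ℤ))
  rw [add_neg_cancel_right] at this
  rw [shiftSeries, this, PowerSeries.coeff_coe, if_pos (by omega), mul_zero]

theorem eq_shiftSeries {x : LaurentSeries ℂ} {p : ℕ} {f : PowerSeries ℂ}
    (h : ∀ n : ℕ, x.coeff ((n : ℤ) - p) = PowerSeries.coeff n f)
    (h0 : ∀ l < -(p : ℤ), x.coeff l = 0) : x = shiftSeries p f := by
  ext l
  rcases lt_or_ge l (-(p : ℤ)) with hl | hl
  · rw [h0 l hl, coeff_shiftSeries_of_lt p f hl]
  · obtain ⟨n, rfl⟩ : ∃ n : ℕ, l = n - p := ⟨(l + p).toNat, by omega⟩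
    rw [h, coeff_shiftSeries]

theorem derivative_shiftSeries (p : ℕ) (f : PowerSeries ℂ) : ∂ₜ (shiftSeries p f) =
    shiftSeries (p + 1) (PowerSeries.mk fun n => ((n : ℂ) - p) * PowerSeries.coeff n f) := by
  refine eq_shiftSeries (fun n => ?_) fun l hl => ?_
  · rw [coeff_derivative, PowerSeries.coeff_mk, ← coeff_shiftSeries p f]
    push_cast
    rw [show (n : ℤ) - (p + 1) + 1 = n - p by ring]
    ring
  · push_cast at hl
    rw [coeff_derivative, coeff_shiftSeries_of_lt _ _ (by omega), mul_zero]

theorem shiftSeries_eq_pow_mul (p : ℕ) (f : PowerSeries ℂ) : shiftSeries p f =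
    (HahnSeries.single (-1 : ℤ) (1 : ℂ)) ^ p * HahnSeries.ofPowerSeries ℤ ℂ f := by
  rw [shiftSeries, HahnSeries.single_pow]
  simp

/-- The terms of positive order of `t ^ (i + 2) x^(i)`, where `x = t⁻² ∑ b_n t ^ n`. -/
def fluct (b : ℕ → ℂ) (i : ℕ) : PowerSeries ℂ :=
  PowerSeries.mk fun n => if n = 0 then 0 else (descPoly i).eval (n : ℂ) * b n

theorem coeff_zero_fluct (b : ℕ → ℂ) (i : ℕ) : PowerSeries.coeff 0 (fluct b i) = 0 := by
  rw [fluct, PowerSeries.coeff_mk, if_pos rfl]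

theorem coeff_fluct (b : ℕ → ℂ) (i : ℕ) {n : ℕ} (hn : n ≠ 0) :
    PowerSeries.coeff n (fluct b i) = (descPoly i).eval (n : ℂ) * b n := by
  rw [fluct, PowerSeries.coeff_mk, if_neg hn]

/-- The series `t ^ (i + 2) x^(i)`, where `x = k(k+1)/2 t⁻² + t⁻² ∑ b_n t ^ n`. -/
def fullSeries (k : ℕ) (b : ℕ → ℂ) (i : ℕ) : PowerSeries ℂ :=
  PowerSeries.C ((k : ℂ) * (k + 1) / 2 * ((-1) ^ i * (Nat.factorial (i + 1) : ℂ))) + fluct b i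

theorem coeff_zero_fullSeries (k : ℕ) (b : ℕ → ℂ) (i : ℕ) :
    PowerSeries.coeff 0 (fullSeries k b i) =
      (k : ℂ) * (k + 1) / 2 * ((-1) ^ i * (Nat.factorial (i + 1) : ℂ)) := by
  rw [fullSeries, map_add, coeff_zero_fluct, PowerSeries.coeff_zero_C, add_zero]

theorem coeff_fullSeries (k : ℕ) (b : ℕ → ℂ) (i : ℕ) {n : ℕ} (hn : n ≠ 0) :
    PowerSeries.coeff n (fullSeries k b i) = (descPoly i).eval (n : ℂ) * b n := by
  rw [fullSeries, map_add, coeff_fluct b i hn, PowerSeries.coeff_C, if_neg hn, zero_add]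

/-- The Laurent series `k(k+1)/2 t⁻² + ∑_{n ≥ 1} b_n t ^ (n - 2)`. -/
def laurentOf (k : ℕ) (b : ℕ → ℂ) : LaurentSeries ℂ := shiftSeries 2 (fullSeries k b 0)

theorem derivative_iterate_laurentOf (k : ℕ) (b : ℕ → ℂ) (i : ℕ) :
    ∂ₜ^[i] (laurentOf k b) = shiftSeries (i + 2) (fullSeries k b i) := by
  induction i with
  | zero => rfl
  | succ i ih =>
    rw [Function.iterate_succ_apply', ih, derivative_shiftSeries]
    congr 1
    ext n
    rw [PowerSeries.coeff_mk]
    rcases eq_or_ne n 0 with rfl | hn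
    · rw [coeff_zero_fullSeries, coeff_zero_fullSeries, Nat.factorial_succ (i + 1)]
      push_cast
      ring
    · rw [coeff_fullSeries k b _ hn, coeff_fullSeries k b _ hn, descPoly_succ, Polynomial.eval_mul]
      simp
      ring

/-- The coefficient of order `n` of the nonlinear terms. -/
def nonlinear (m k : ℕ) (b : ℕ → ℂ) (n : ℕ) : ℂ :=
  PowerSeries.coeff n
    (taylorRemainder (systemPoly m) (leadingCoeff m k) fun i => fluct b i)

theorem nonlinear_congr (m k : ℕ) {b b' : ℕ → ℂ} {n : ℕ} (h : ∀ l, l ≠ 0 → l < n → b l = b' l) :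
    nonlinear m k b n = nonlinear m k b' n := by
  refine coeff_taylorRemainder_congr _ _ (fun i => coeff_zero_fluct b i)
    (fun i => coeff_zero_fluct b' i) fun i l hl => ?_
  rcases eq_or_ne l 0 with rfl | hl0
  · rw [coeff_zero_fluct, coeff_zero_fluct]
  · rw [coeff_fluct b i hl0, coeff_fluct b' i hl0, h l hl0 hl]

/-- The linear term of the Taylor expansion is `descPoly (2m) - indicialPoly` by the definition of
the latter, so `indicialPoly` will multiply `b n` once the equation is written out. -/
theorem coeff_aeval_systemPoly (m k : ℕ) (b : ℕ → ℂ) {n : ℕ} (hn : n ≠ 0) :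
    PowerSeries.coeff n (aeval (fun i : Fin (2 * m) => fullSeries k b i) (systemPoly m)) =
      nonlinear m k b n + ((descPoly (2 * m)).eval (n : ℂ) - (indicialPoly m k).eval (n : ℂ)) * b n := by
  have h : aeval (fun i : Fin (2 * m) => fullSeries k b i) (systemPoly m) =
      taylorRemainder (systemPoly m) (leadingCoeff m k) (fun i => fluct b i) +
        PowerSeries.C (eval (leadingCoeff m k) (systemPoly m)) +
        ∑ i : Fin (2 * m), PowerSeries.C (eval (leadingCoeff m k) (pderiv i (systemPoly m))) *
          fluct b i := by
    simp only [taylorRemainder, leadingCoeff_eq, fullSeries]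
    ring
  rw [h, map_add, map_add, PowerSeries.coeff_C, if_neg hn, add_zero, ← nonlinear, map_sum,
    indicialPoly, Polynomial.eval_sub, sub_sub_cancel, Polynomial.eval_finsetSum, Finset.sum_mul]
  congr 1
  refine Finset.sum_congr rfl fun i _ => ?_
  rw [PowerSeries.coeff_C_mul, coeff_fluct b i hn, Polynomial.eval_mul, Polynomial.eval_C, mul_assoc]

/-- `HahnSeries.ofPowerSeries` as a homomorphism of `ℂ`-algebras. -/
def powerToLaurent : PowerSeries ℂ →ₐ[ℂ] LaurentSeries ℂ :=
  { HahnSeries.ofPowerSeries ℤ ℂ with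
    commutes' := fun a => by
      rw [algebraMap_laurentSeries]
      exact HahnSeries.ofPowerSeries_C a }

/-- Weighted homogeneity pulls the common power `t^(-(2m+2))` out of `P_m` and leaves an identity
between power series. -/
theorem laurentEval_painlevePoly (m k : ℕ) (b : ℕ → ℂ) :
    laurentEval (laurentOf k b) (painlevePoly m) = shiftSeries (2 * m + 2)
      (aeval (fun i : Fin (2 * m) => fullSeries k b i) (systemPoly m)) := by
  have h : laurentEval (laurentOf k b) (painlevePoly m) =
      aeval (fun n => HahnSeries.single (-1 : ℤ) (1 : ℂ) ^ (n + 2) *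
        powerToLaurent (fullSeries k b n)) (painlevePoly m) := by
    rw [laurentEval]
    congr 2
    funext n
    rw [derivative_iterate_laurentOf, shiftSeries_eq_pow_mul]
    rfl
  rw [h, (painlevePoly_isWeightedHomogeneous m).aeval_pow_mul, shiftSeries_eq_pow_mul]
  congr 1
  rw [← comp_aeval_apply, aeval_systemPoly]
  rfl

/-- The residual of the equation in terms of the coefficients. -/
theorem coeff_laurentEval_lenard (m k : ℕ) (b : ℕ → ℂ) {n : ℕ} (hn : n ≠ 0) :
    (laurentEval (laurentOf k b) (lenard (m + 1))).coeff ((n : ℤ) - (2 * m + 2 : ℕ)) =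
      -4 * ((indicialPoly m k).eval (n : ℂ) * b n - nonlinear m k b n) := by
  have h1 : laurentEval (laurentOf k b) (painlevePoly m) = ∂ₜ^[2 * m] (laurentOf k b) +
      HahnSeries.C (1 / 4) * laurentEval (laurentOf k b) (lenard (m + 1)) := by
    rw [painlevePoly, map_add, map_mul, laurentEval_X, ← algebraMap_laurentSeries]
    congr 2
    exact aeval_C _ _
  have h2 := congrArg (fun f => f.coeff ((n : ℤ) - (2 * m + 2 : ℕ))) h1
  simp only [laurentEval_painlevePoly, derivative_iterate_laurentOf, HahnSeries.coeff_add,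
    HahnSeries.C_mul_eq_smul, HahnSeries.coeff_smul, coeff_shiftSeries, smul_eq_mul,
    coeff_fullSeries k b _ hn, coeff_aeval_systemPoly m k b hn] at h2
  linear_combination -4 * h2

/-- The equation in lowest order is the indicial equation for `c(k)`. For this reason the recursion
is imposed only for `n ≠ 0`. -/
theorem coeff_laurentEval_lenard_zero {m k : ℕ} (hk : k ≤ m) (b : ℕ → ℂ) :
    (laurentEval (laurentOf k b) (painlevePoly m)).coeff (-(2 * m + 2 : ℕ)) =
      (∂ₜ^[2 * m] (laurentOf k b)).coeff (-(2 * m + 2 : ℕ)) := by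
  have e : (-((2 * m + 2 : ℕ) : ℤ)) = ((0 : ℕ) : ℤ) - (2 * m + 2 : ℕ) := by simp
  rw [e, laurentEval_painlevePoly, derivative_iterate_laurentOf, coeff_shiftSeries,
    coeff_shiftSeries, coeff_zero_fullSeries, PowerSeries.coeff_zero_eq_constantCoeff_apply,
    ← eval_leadingCoeff_systemPoly hk]
  let φ : PowerSeries ℂ →ₐ[ℂ] ℂ := { PowerSeries.constantCoeff (R := ℂ) with
    commutes' := fun a => by simp }
  show φ _ = _
  rw [comp_aeval_apply, ← aeval_eq_eval]
  congr 2
  funext i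
  rw [leadingCoeff_eq, ← coeff_zero_fullSeries k b i]
  exact (PowerSeries.coeff_zero_eq_constantCoeff_apply _).symm

/-- The inhomogeneous terms: `e₁ + e₂ t` multiplied by `t ^ (2m + 2)`. -/
def forcing (m : ℕ) (e₁ e₂ : ℂ) (n : ℕ) : ℂ :=
  (if n = 2 * m + 2 then e₁ else 0) + if n = 2 * m + 3 then e₂ else 0

/-- The recursion for the coefficients of a Laurent series solution. -/
def IsFormalSolution (m k : ℕ) (e₁ e₂ : ℂ) (b : ℕ → ℂ) : Prop :=
  ∀ n : ℕ, n ≠ 0 → (indicialPoly m k).eval (n : ℂ) * b n = nonlinear m k b n + forcing m e₁ e₂ n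

theorem coeff_C_add_single (e₁ e₂ : ℂ) (m n : ℕ) :
    (HahnSeries.C e₁ + HahnSeries.single 1 e₂ : LaurentSeries ℂ).coeff
      ((n : ℤ) - (2 * m + 2 : ℕ)) = forcing m e₁ e₂ n := by
  rw [HahnSeries.coeff_add, HahnSeries.C_apply, HahnSeries.coeff_single, HahnSeries.coeff_single,
    forcing]
  push_cast
  congr 1 <;> split_ifs <;> first | rfl | omega

theorem coeff_C_add_single_of_neg (e₁ e₂ : ℂ) {l : ℤ} (hl : l < 0) :
    (HahnSeries.C e₁ + HahnSeries.single 1 e₂ : LaurentSeries ℂ).coeff l = 0 := by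
  rw [HahnSeries.coeff_add, HahnSeries.C_apply, HahnSeries.coeff_single_of_ne (by omega),
    HahnSeries.coeff_single_of_ne (by omega), add_zero]

/-- The formal solutions in terms of their coefficients. -/
theorem isLaurentSolution_iff {m k : ℕ} (hk : 1 ≤ k) (hkm : k ≤ m) (z₀ : ℂ)
    (x : Fin (2 * m) → LaurentSeries ℂ) :
    IsLaurentSolution (field m) (weight m) (leadingCoeff m k) z₀ x ↔
      ∃ b, IsFormalSolution m k z₀ 1 b ∧ ∀ i : Fin (2 * m), x i = ∂ₜ^[i] (laurentOf k b) := by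
  have hm : 0 < 2 * m := by omega
  have hlast : ∀ b : ℕ → ℂ, aeval (fun j : Fin (2 * m) => ∂ₜ^[j] (laurentOf k b)) (systemPoly m) =
      laurentEval (laurentOf k b) (painlevePoly m) := fun b =>
    aeval_systemPoly m fun j => ∂ₜ^[j] (laurentOf k b)
  have hformal : ∀ b, IsFormalSolution m k z₀ 1 b ↔ ∂ₜ^[2 * m] (laurentOf k b) =
      laurentEval (laurentOf k b) (painlevePoly m) +
        (HahnSeries.single 1 1 + HahnSeries.C z₀) := by
    intro b
    have hco : ∀ n : ℕ, n ≠ 0 → ((∂ₜ^[2 * m] (laurentOf k b)).coeff ((n : ℤ) - (2 * m + 2 : ℕ)) =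
        (laurentEval (laurentOf k b) (painlevePoly m) +
        (HahnSeries.single 1 1 + HahnSeries.C z₀) : LaurentSeries ℂ).coeff
          ((n : ℤ) - (2 * m + 2 : ℕ)) ↔
        (indicialPoly m k).eval (n : ℂ) * b n = nonlinear m k b n + forcing m z₀ 1 n) := by
      intro n hn
      rw [HahnSeries.coeff_add, add_comm (HahnSeries.single 1 1) _, coeff_C_add_single,
        derivative_iterate_laurentOf, laurentEval_painlevePoly, coeff_shiftSeries,
        coeff_shiftSeries, coeff_fullSeries k b _ hn, coeff_aeval_systemPoly m k b hn]
      constructor <;> intro h <;> linear_combination h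
    constructor
    · intro h
      ext l
      rcases lt_trichotomy l (-(2 * m + 2 : ℕ)) with hl | hl | hl
      · rw [HahnSeries.coeff_add, add_comm (HahnSeries.single 1 1) _,
          coeff_C_add_single_of_neg _ _ (by omega), derivative_iterate_laurentOf,
          laurentEval_painlevePoly, coeff_shiftSeries_of_lt _ _ hl, coeff_shiftSeries_of_lt _ _ hl,
          add_zero]
      · rw [hl, HahnSeries.coeff_add, add_comm (HahnSeries.single 1 1) _,
          coeff_C_add_single_of_neg _ _ (by omega), coeff_laurentEval_lenard_zero hkm, add_zero]
      · obtain ⟨n, rfl⟩ : ∃ n : ℕ, l = n - (2 * m + 2 : ℕ) := ⟨(l + (2 * m + 2 : ℕ)).toNat, by omega⟩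
        have hn : n ≠ 0 := by omega
        exact (hco n hn).mpr (h n hn)
    · intro h n hn
      exact (hco n hn).mp (by rw [h])
  constructor
  · intro hx
    have h0 := hx.leading ⟨0, hm⟩
    have hlow := hx.order ⟨0, hm⟩
    rw [leadingCoeff_eq] at h0
    simp only [weight, zero_add] at h0 hlow
    -- The first component determines the others by differentiation. The value `b 0` plays no role,
    -- since the constant term of `fullSeries` is prescribed.
    set b : ℕ → ℂ := fun n => (x ⟨0, hm⟩).coeff ((n : ℤ) - (2 : ℕ)) with hb
    have hx0 : x ⟨0, hm⟩ = laurentOf k b := by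
      refine eq_shiftSeries (fun n => ?_) hlow
      rcases eq_or_ne n 0 with rfl | hn
      · rw [coeff_zero_fullSeries]
        simpa using h0
      · rw [coeff_fullSeries k b 0 hn, descPoly_zero, Polynomial.eval_one, one_mul]
    have hxi : ∀ i (hi : i < 2 * m), x ⟨i, hi⟩ = ∂ₜ^[i] (laurentOf k b) := by
      intro i
      induction i with
      | zero => exact fun _ => hx0
      | succ i ih =>
        intro hi
        have := hx.equation ⟨i, by omega⟩
        rw [aeval_field, dif_pos hi, ih (by omega)] at this
        rw [Function.iterate_succ_apply', this]
        rfl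
    refine ⟨b, (hformal b).mpr ?_, fun i => hxi i i.2⟩
    have := hx.equation ⟨2 * m - 1, by omega⟩
    rw [aeval_field, dif_neg (by simp only; omega), hxi, ← Function.iterate_succ_apply' (f := ∂ₜ),
      show (2 * m - 1).succ = 2 * m by omega] at this
    rw [this, ← hlast]
    congr 2
    congr 1
    funext j
    exact hxi j j.2
  · rintro ⟨b, hb, hx⟩
    have hshift : ∀ i : Fin (2 * m), x i = shiftSeries (weight m i) (fullSeries k b i) := fun i => by
      rw [hx, derivative_iterate_laurentOf]
      rfl
    refine ⟨fun i => ?_, fun i l hl => ?_, fun i => ?_⟩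
    · have := coeff_shiftSeries (weight m i) (fullSeries k b i) 0
      rw [coeff_zero_fullSeries, ← leadingCoeff_eq, Nat.cast_zero, zero_sub] at this
      rw [hshift, this]
    · rw [hshift, coeff_shiftSeries_of_lt _ _ hl]
    · rw [aeval_field, hx i, ← Function.iterate_succ_apply' (f := ∂ₜ)]
      split_ifs with hi
      · exact (hx ⟨i + 1, hi⟩).symm
      · rw [show (i : ℕ).succ = 2 * m by have := i.2; omega, (hformal b).mp hb, ← hlast]
        congr 2
        congr 1
        funext j
        exact (hx j).symm

/-! ### Existence and uniqueness of the formal solutions -/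

/-- Course-of-values recursion. The value `default` at indices `≥ n` is harmless, because `Φ n`
ignores them. -/
theorem exists_eq_of_forall_lt_congr {α : Type*} [Inhabited α] (Φ : ℕ → (ℕ → α) → α)
    (h : ∀ n b b', (∀ i < n, b i = b' i) → Φ n b = Φ n b') : ∃ b, ∀ n, b n = Φ n b := by
  classical
  let step : ∀ n : ℕ, (∀ i, i < n → α) → α := fun n rec =>
    Φ n fun i => if hi : i < n then rec i hi else default
  refine ⟨WellFounded.fix Nat.lt_wfRel.wf step, fun n => ?_⟩
  rw [WellFounded.fix_eq]
  exact h _ _ _ fun i hi => dif_pos hi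

theorem isMonodromyFree_laurentOf {k : ℕ} {b : ℕ → ℂ}
    (hb : ∀ n, Odd n → n ≤ 2 * k + 1 → b n = 0) : IsMonodromyFree k (laurentOf k b) := by
  refine ⟨?_, fun l hl => coeff_shiftSeries_of_lt _ _ hl, fun l hl hlk => ?_⟩
  · have := coeff_shiftSeries 2 (fullSeries k b 0) 0
    rw [coeff_zero_fullSeries] at this
    simpa [laurentOf] using this
  · rcases lt_or_ge l (-2) with h | h
    · exact coeff_shiftSeries_of_lt _ _ h
    · obtain ⟨n, rfl⟩ : ∃ n : ℕ, l = n - (2 : ℕ) := ⟨(l + 2).toNat, by omega⟩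
      rw [Int.odd_iff] at hl
      rw [laurentOf, coeff_shiftSeries, coeff_fullSeries k b 0 (by omega),
        hb n (by rw [Nat.odd_iff]; omega) (by omega), mul_zero]

theorem exists_isFormalSolution {m k : ℕ} (hk : 1 ≤ k) (hkm : k ≤ m) (e₁ e₂ : ℂ) (α : ℕ → ℂ) :
    ∃ b, IsFormalSolution m k e₁ e₂ b ∧ ∀ n ∈ freeOrders m k, b n = α n := by
  classical
  -- The odd coefficients up to `2k+1` are set to zero by decree, to secure trivial monodromy. None
  -- of these orders is free, and the recursion there is verified afterwards instead of being used
  -- as a definition.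
  obtain ⟨b, hb⟩ := exists_eq_of_forall_lt_congr (fun n b =>
    if Odd n ∧ n ≤ 2 * k + 1 then 0 else if n ∈ freeOrders m k then α n else
      (nonlinear m k b n + forcing m e₁ e₂ n) / (indicialPoly m k).eval (n : ℂ)) (by
    intro n b b' h
    simp only [nonlinear_congr m k fun l _ hl => h l hl])
  have hodd : ∀ n, Odd n → n ≤ 2 * k + 1 → b n = 0 := fun n h1 h2 => by
    rw [hb, if_pos ⟨h1, h2⟩]
  have hx := isMonodromyFree_laurentOf hodd
  have hcoeff := fun (n : ℕ) (hn : n ≠ 0) => coeff_laurentEval_lenard m k b hn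
  refine ⟨b, fun n => ?_, fun n hn => ?_⟩
  · induction n using Nat.strong_induction_on with
    | _ n ih =>
    intro hn
    have hzero : ∀ l : ℤ, l = n - (2 * m + 2 : ℕ) → forcing m e₁ e₂ n = 0 →
        (laurentEval (laurentOf k b) (lenard (m + 1))).coeff l = 0 →
        (indicialPoly m k).eval (n : ℂ) * b n = nonlinear m k b n + forcing m e₁ e₂ n := by
      rintro l rfl h1 h2
      rw [hcoeff n hn] at h2
      rw [h1]
      linear_combination -h2 / 4
    have hforce : n ≠ 2 * m + 2 → n ≠ 2 * m + 3 → forcing m e₁ e₂ n = 0 := fun h1 h2 => by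
      rw [forcing, if_neg h1, if_neg h2, add_zero]
    -- Odd orders of the principal part of `𝓛_{m+1}` vanish. This covers both the coefficients set
    -- to zero and the odd free orders.
    by_cases h1 : Odd n ∧ n ≤ 2 * m + 1
    · refine hzero _ rfl (hforce (by omega) (by omega)) (hx.coeff_lenard_eq_zero hk _ _ (Or.inr ?_))
      rw [Int.odd_iff]
      have := Nat.odd_iff.mp h1.1
      omega
    by_cases h2 : n ∈ freeOrders m k
    · rcases (mem_freeOrders_iff_exists hk hkm n).mp h2 with
        ⟨i, hi, rfl⟩ | ⟨i, hi, rfl⟩ | ⟨i, hi, rfl⟩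
      -- Even free orders `2i ≤ 2m-2k` correspond to powers of `t` below `-2k`, beyond the pole of
      -- `𝓛_{m+1}`.
      · exact hzero _ rfl (hforce (by omega) (by omega))
          (hx.coeff_lenard_eq_zero hk _ _ (Or.inl (by push_cast; omega)))
      · exact absurd ⟨odd_two_mul_add_one i, by omega⟩ h1
      -- At the upper resonances the induction hypothesis says that `𝓛_{m+1}` agrees with `-4 (e₁ +
      -- e₂ t)` in all orders below `2i`, which is what `IsMonodromyFree.resonance` requires.
      · refine hzero (2 * i) (by push_cast; ring) (hforce (by omega) (by omega))
          (hx.resonance hk (m + 1) i hi.1 hi.2 (-4 * e₁) (-4 * e₂) fun l hl => ?_)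
        rcases lt_or_ge (-(2 * m + 2 : ℤ)) l with hl' | hl'
        · obtain ⟨n', rfl⟩ : ∃ n' : ℕ, l = n' - (2 * m + 2 : ℕ) :=
            ⟨(l + (2 * m + 2 : ℕ)).toNat, by push_cast; omega⟩
          push_cast at hl hl'
          have hf : forcing m (-4 * e₁) (-4 * e₂) n' = -4 * forcing m e₁ e₂ n' := by
            rw [forcing, forcing]
            split_ifs <;> ring
          rw [hcoeff n' (by omega), coeff_C_add_single, hf]
          linear_combination -4 * ih n' (by omega) (by omega)
        · rw [coeff_C_add_single_of_neg _ _ (by omega)]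
          exact hx.coeff_lenard_eq_zero hk _ _ (Or.inl (by omega))
    · have hne : (indicialPoly m k).eval (n : ℂ) ≠ 0 := fun h =>
        h2 ((mem_freeOrders_iff hk hkm n).mpr ⟨Nat.pos_of_ne_zero hn, h⟩)
      have h3 : ¬(Odd n ∧ n ≤ 2 * k + 1) := fun h => h1 ⟨h.1, by omega⟩
      have := hb n
      rw [if_neg h3, if_neg h2] at this
      rw [this, mul_div_cancel₀ _ hne]
  · have h3 : ¬(Odd n ∧ n ≤ 2 * k + 1) := by
      rintro ⟨ho, hle⟩
      rw [Nat.odd_iff] at ho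
      rcases (mem_freeOrders_iff_exists hk hkm n).mp hn with
        ⟨i, hi, rfl⟩ | ⟨i, hi, rfl⟩ | ⟨i, hi, rfl⟩ <;> omega
    rw [hb, if_neg h3, if_pos hn]

theorem IsFormalSolution.congr {m k : ℕ} (hk : 1 ≤ k) (hkm : k ≤ m) {e₁ e₂ : ℂ} {b b' : ℕ → ℂ}
    (hb : IsFormalSolution m k e₁ e₂ b) (hb' : IsFormalSolution m k e₁ e₂ b')
    (h : ∀ n ∈ freeOrders m k, b n = b' n) (n : ℕ) (hn : n ≠ 0) : b n = b' n := by
  induction n using Nat.strong_induction_on with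
  | _ n ih =>
  by_cases hf : n ∈ freeOrders m k
  · exact h n hf
  · have hne : (indicialPoly m k).eval (n : ℂ) ≠ 0 := fun h =>
      hf ((mem_freeOrders_iff hk hkm n).mpr ⟨Nat.pos_of_ne_zero hn, h⟩)
    apply mul_left_cancel₀ hne
    rw [hb n hn, hb' n hn, nonlinear_congr m k fun l hl0 hl => ih l hl hl0]

theorem fullSeries_congr {k : ℕ} {b b' : ℕ → ℂ} (h : ∀ n, n ≠ 0 → b n = b' n) (i : ℕ) :
    fullSeries k b i = fullSeries k b' i := by
  ext n
  rcases eq_or_ne n 0 with rfl | hn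
  · rw [coeff_zero_fullSeries, coeff_zero_fullSeries]
  · rw [coeff_fullSeries k b i hn, coeff_fullSeries k b' i hn, h n hn]

theorem coeff_laurentOf (k : ℕ) (b : ℕ → ℂ) {n : ℕ} (hn : n ≠ 0) :
    (laurentOf k b).coeff (-2 + (n : ℤ)) = b n := by
  have := coeff_shiftSeries 2 (fullSeries k b 0) n
  rw [coeff_fullSeries k b 0 hn, descPoly_zero, Polynomial.eval_one, one_mul] at this
  rw [← this, laurentOf, add_comm]
  rfl

theorem existsUnique_isLaurentSolution {m k : ℕ} (hk : 1 ≤ k) (hkm : k ≤ m) (h0 : 0 < 2 * m)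
    (z₀ : ℂ) (α : freeOrders m k → ℂ) : ∃! x : Fin (2 * m) → LaurentSeries ℂ,
      IsLaurentSolution (field m) (weight m) (leadingCoeff m k) z₀ x ∧
      ∀ n : freeOrders m k, (x ⟨0, h0⟩).coeff (-2 + ((n : ℕ) : ℤ)) = α n := by
  classical
  have hpos : ∀ n ∈ freeOrders m k, n ≠ 0 := fun n hn => hn.1.ne'
  obtain ⟨b, hb, hα⟩ := exists_isFormalSolution hk hkm z₀ 1
    (fun n => if h : n ∈ freeOrders m k then α ⟨n, h⟩ else 0)
  refine ⟨fun i => ∂ₜ^[i] (laurentOf k b),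
    ⟨(isLaurentSolution_iff hk hkm z₀ _).mpr ⟨b, hb, fun _ => rfl⟩, fun n => ?_⟩, ?_⟩
  · show (laurentOf k b).coeff _ = _
    rw [coeff_laurentOf k b (hpos n n.2), hα n n.2, dif_pos n.2]
  · rintro x ⟨hx, hxα⟩
    obtain ⟨b', hb', hx'⟩ := (isLaurentSolution_iff hk hkm z₀ _).mp hx
    have hfree : ∀ n ∈ freeOrders m k, b' n = b n := fun n hn => by
      have := hxα ⟨n, hn⟩
      rw [hx'] at this
      rw [hα n hn, dif_pos hn, ← this]
      exact (coeff_laurentOf k b' (hpos n hn)).symm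
    funext i
    rw [hx', laurentOf, laurentOf,
      fullSeries_congr (fun n hn => hb'.congr hk hkm hb hfree n hn) 0]

/-! ### Estimates for the coefficients -/

open Asymptotics Filter in
theorem isBigO_natCast_sub_const (ρ : ℂ) :
    (fun n : ℕ => (n : ℂ) - ρ) =O[atTop] (fun n : ℕ => (n : ℂ)) ∧
    (fun n : ℕ => (n : ℂ)) =O[atTop] (fun n : ℕ => (n : ℂ) - ρ) := by
  have h : (fun _ : ℕ => ρ) =o[atTop] (fun n : ℕ => (n : ℂ)) := by
    rw [isLittleO_const_left]
    right
    have : (norm ∘ fun n : ℕ => (n : ℂ)) = fun n : ℕ => (n : ℝ) := by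
      funext n
      simp
    rw [this]
    exact tendsto_natCast_atTop_atTop
  exact ⟨(isBigO_refl _ _).sub h.isBigO, h.right_isBigO_sub⟩

open Asymptotics Filter in
theorem isBigO_multiset_prod (S : Multiset ℂ) :
    (fun n : ℕ => (n : ℂ) ^ S.card) =O[atTop]
      fun n : ℕ => (S.map fun ρ => (n : ℂ) - ρ).prod := by
  induction S using Multiset.induction_on with
  | empty => simpa using isBigO_refl (fun _ : ℕ => (1 : ℂ)) atTop
  | cons ρ S ih =>
    simp only [Multiset.card_cons, Multiset.map_cons, Multiset.prod_cons, pow_succ']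
    exact (isBigO_natCast_sub_const ρ).2.mul ih

open Asymptotics Filter in
theorem isBigO_descPoly (i : ℕ) :
    (fun n : ℕ => (descPoly i).eval (n : ℂ)) =O[atTop] fun n : ℕ => (n : ℂ) ^ i := by
  induction i with
  | zero => simpa [descPoly_zero] using isBigO_refl (fun _ : ℕ => (1 : ℂ)) atTop
  | succ i ih =>
    have h : ∀ n : ℕ, (descPoly (i + 1)).eval (n : ℂ) =
        (descPoly i).eval (n : ℂ) * ((n : ℂ) - ((i : ℂ) + 2)) := fun n => by
      rw [descPoly_succ]; simp
    simp only [h, pow_succ]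
    exact ih.mul (isBigO_natCast_sub_const _).1

open Asymptotics Filter in
-- The numerator has degree `i`, smaller than the degree `2m` of `indicialPoly`, so the quotient is
-- bounded for large `n`; the remaining finitely many `n` only change the constant.
theorem exists_descPoly_le {m k : ℕ} (hk : k ≤ m) (i : ℕ) (hi : i < 2 * m) :
    ∃ C : ℝ, 0 < C ∧ ∀ n : ℕ, (indicialPoly m k).eval (n : ℂ) ≠ 0 →
      ‖(descPoly i).eval (n : ℂ)‖ ≤ C * ‖(indicialPoly m k).eval (n : ℂ)‖ := by
  have h : ∀ n : ℕ, (indicialPoly m k).eval (n : ℂ) =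
      ((exponentList k m).map fun ρ => (n : ℂ) - ρ).prod := fun n => by
    rw [indicialPoly_eq_exponentPoly hk, ← prod_exponentList, Polynomial.eval_multiset_prod,
      Multiset.map_map]
    simp
  have h1 : (fun n : ℕ => (descPoly i).eval (n : ℂ)) =O[atTop]
      fun n : ℕ => (indicialPoly m k).eval (n : ℂ) := by
    simp only [h]
    have h2 := isBigO_multiset_prod (exponentList k m)
    rw [card_exponentList hk] at h2
    refine ((isBigO_descPoly i).trans ?_).trans h2
    refine IsBigO.of_bound 1 (eventually_atTop.mpr ⟨1, fun n hn => ?_⟩)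
    rw [norm_pow, norm_pow, one_mul, Complex.norm_natCast]
    exact pow_le_pow_right₀ (by exact_mod_cast hn) hi.le
  obtain ⟨C, hC, hb⟩ := bound_of_isBigO_nat_atTop h1
  exact ⟨C, hC, fun n hn => hb hn⟩

/-- A common bound for the eigenvectors at the free orders, and for the resolvents elsewhere. -/
theorem exists_uniform_descPoly_le {m k : ℕ} (hk : 1 ≤ k) (hkm : k ≤ m) :
    ∃ C : ℝ, 1 ≤ C ∧ ∀ i < 2 * m,
      (∀ n ∈ freeFinset m k, ‖(descPoly i).eval (n : ℂ)‖ ≤ C) ∧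
      ∀ n : ℕ, n ≠ 0 → n ∉ freeFinset m k →
        ‖(descPoly i).eval (n : ℂ)‖ ≤ C * ‖(indicialPoly m k).eval (n : ℂ)‖ := by
  have h1 : ∀ i : Fin (2 * m), ∃ C : ℝ, 0 < C ∧ ∀ n : ℕ, (indicialPoly m k).eval (n : ℂ) ≠ 0 →
      ‖(descPoly i).eval (n : ℂ)‖ ≤ C * ‖(indicialPoly m k).eval (n : ℂ)‖ := fun i =>
    exists_descPoly_le hkm i i.2
  choose C hC0 hC using h1
  set D : Fin (2 * m) → ℝ := fun i => ∑ n ∈ freeFinset m k, ‖(descPoly i).eval (n : ℂ)‖ with hD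
  have hD0 : ∀ i, 0 ≤ D i := fun i => Finset.sum_nonneg fun _ _ => norm_nonneg _
  set A : ℝ := 1 + ∑ i, (C i + D i) with hA
  have hle : ∀ i, C i + D i ≤ ∑ i, (C i + D i) := fun i =>
    Finset.single_le_sum (f := fun i => C i + D i)
      (fun j _ => add_nonneg (hC0 j).le (hD0 j)) (Finset.mem_univ i)
  have hsum : 0 ≤ ∑ i, (C i + D i) :=
    Finset.sum_nonneg fun j _ => add_nonneg (hC0 j).le (hD0 j)
  refine ⟨A, by linarith, fun i hi => ⟨fun n hn => ?_, fun n hn hnf => ?_⟩⟩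
  · have : ‖(descPoly i).eval (n : ℂ)‖ ≤ D ⟨i, hi⟩ :=
      Finset.single_le_sum (f := fun n : ℕ => ‖(descPoly i).eval (n : ℂ)‖)
        (fun _ _ => norm_nonneg _) hn
    linarith [hle ⟨i, hi⟩, hC0 ⟨i, hi⟩]
  · have hne : (indicialPoly m k).eval (n : ℂ) ≠ 0 := fun h => hnf (by
      rw [← Finset.mem_coe, coe_freeFinset hk hkm]
      exact (mem_freeOrders_iff hk hkm n).mpr ⟨Nat.pos_of_ne_zero hn, h⟩)
    refine (hC ⟨i, hi⟩ n hne).trans (mul_le_mul_of_nonneg_right ?_ (norm_nonneg _))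
    linarith [hle ⟨i, hi⟩, hD0 ⟨i, hi⟩]

/-! ### A priori bounds and Lipschitz dependence on the parameters -/

/-- The size of the inhomogeneous terms. -/
def forcingSize (m : ℕ) (r : ℝ) (e₁ e₂ : ℂ) : ℝ :=
  ‖e₁‖ * r ^ (2 * m + 2) + ‖e₂‖ * r ^ (2 * m + 3)

/-- The size of the parameters of a formal solution. -/
def dataSize (m k : ℕ) (r : ℝ) (e₁ e₂ : ℂ) (b : ℕ → ℂ) : ℝ :=
  ∑ n ∈ freeFinset m k, ‖b n‖ * r ^ n + forcingSize m r e₁ e₂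

theorem forcingSize_nonneg (m : ℕ) {r : ℝ} (hr : 0 ≤ r) (e₁ e₂ : ℂ) :
    0 ≤ forcingSize m r e₁ e₂ := by
  rw [forcingSize]; positivity

theorem dataSize_nonneg (m k : ℕ) {r : ℝ} (hr : 0 ≤ r) (e₁ e₂ : ℂ) (b : ℕ → ℂ) :
    0 ≤ dataSize m k r e₁ e₂ b :=
  add_nonneg (Finset.sum_nonneg fun _ _ => by positivity) (forcingSize_nonneg m hr _ _)

theorem sum_norm_forcing_le (m : ℕ) {r : ℝ} (hr : 0 ≤ r) (e₁ e₂ : ℂ) (s : Finset ℕ) :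
    ∑ n ∈ s, ‖forcing m e₁ e₂ n‖ * r ^ n ≤ forcingSize m r e₁ e₂ := by
  have h : ∀ n, ‖forcing m e₁ e₂ n‖ * r ^ n ≤ (if n = 2 * m + 2 then ‖e₁‖ * r ^ (2 * m + 2) else 0)
      + if n = 2 * m + 3 then ‖e₂‖ * r ^ (2 * m + 3) else 0 := by
    intro n
    rw [forcing]
    split_ifs with h1 h2 h2
    · omega
    · simp [h1]
    · simp [h2]
    · simp
  refine (Finset.sum_le_sum fun n _ => h n).trans ?_
  rw [Finset.sum_add_distrib, Finset.sum_ite_eq', Finset.sum_ite_eq', forcingSize]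
  have h1 : 0 ≤ ‖e₁‖ * r ^ (2 * m + 2) := by positivity
  have h2 : 0 ≤ ‖e₂‖ * r ^ (2 * m + 3) := by positivity
  split_ifs <;> linarith

/-- Comparison with this solution turns the estimate for differences into a bound for a single
solution. -/
theorem isFormalSolution_zero (m k : ℕ) : IsFormalSolution m k 0 0 0 := by
  intro n _
  have h : (fun i : Fin (2 * m) => fluct 0 i) = 0 := by
    funext i
    ext n
    simp [fluct]
  rw [nonlinear, h, taylorRemainder_zero, forcing]
  simp

/-- The basic estimate: outside of the free orders, the coefficients are controlled by those of
lower order. -/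
theorem exists_sum_nonfree_le {m k : ℕ} (hk : 1 ≤ k) (hkm : k ≤ m) :
    ∃ C B : ℝ, 1 ≤ C ∧ 0 ≤ B ∧ (∀ i < 2 * m, ∀ n ∈ freeFinset m k,
        ‖(descPoly i).eval (n : ℂ)‖ ≤ C) ∧
      ∀ (r : ℝ) (_ : 0 ≤ r) (e₁ e₂ e₁' e₂' : ℂ) (b b' : ℕ → ℂ), IsFormalSolution m k e₁ e₂ b →
      IsFormalSolution m k e₁' e₂' b' → ∀ (N : ℕ) (s d : ℝ), 0 ≤ s → s ≤ 1 → 0 ≤ d →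
      (∀ i < 2 * m, truncNorm N r (fluct b i) ≤ s) →
      (∀ i < 2 * m, truncNorm N r (fluct b' i) ≤ s) →
      (∀ i < 2 * m, truncNorm N r (fluct b i - fluct b' i) ≤ d) → ∀ i < 2 * m,
      ∑ n ∈ Finset.range (N + 1) with n ∉ freeFinset m k,
        ‖PowerSeries.coeff n (fluct b i - fluct b' i)‖ * r ^ n ≤
          C * (forcingSize m r (e₁ - e₁') (e₂ - e₂') + B * s * d) := by
  obtain ⟨C, hC1, hC⟩ := exists_uniform_descPoly_le hk hkm
  obtain ⟨B, hB0, hB⟩ := exists_truncNorm_taylorRemainder_le (systemPoly m) (leadingCoeff m k) 1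
    zero_le_one
  refine ⟨C, B, hC1, hB0, fun i hi => (hC i hi).1, ?_⟩
  intro r hr e₁ e₂ e₁' e₂' b b' hb hb' N s d hs hs1 hd hbs hbs' hbd i hi
  have hR := hB r hr N s d (fun i => fluct b i) (fun i => fluct b' i) hs hs1 hd
    (fun i => coeff_zero_fluct b i) (fun i => coeff_zero_fluct b' i) (fun i => hbs i i.2)
    (fun i => hbs' i i.2) (fun i => hbd i i.2)
  set R := taylorRemainder (systemPoly m) (leadingCoeff m k) (fun i => fluct b i) -
    taylorRemainder (systemPoly m) (leadingCoeff m k) (fun i => fluct b' i) with hRdef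
  have hterm : ∀ n, n ∉ freeFinset m k → ‖PowerSeries.coeff n (fluct b i - fluct b' i)‖ * r ^ n ≤
      C * (‖forcing m (e₁ - e₁') (e₂ - e₂') n‖ * r ^ n + ‖PowerSeries.coeff n R‖ * r ^ n) := by
    intro n hn
    rw [← add_mul, ← mul_assoc]
    refine mul_le_mul_of_nonneg_right ?_ (by positivity)
    rcases eq_or_ne n 0 with rfl | hn0
    · rw [map_sub, coeff_zero_fluct, coeff_zero_fluct, sub_zero, norm_zero]
      positivity
    · rw [map_sub, coeff_fluct b i hn0, coeff_fluct b' i hn0, ← mul_sub, norm_mul]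
      refine (mul_le_mul_of_nonneg_right ((hC i hi).2 n hn0 hn) (norm_nonneg _)).trans ?_
      rw [mul_assoc, ← norm_mul]
      refine mul_le_mul_of_nonneg_left ?_ (by linarith)
      have hf : forcing m (e₁ - e₁') (e₂ - e₂') n = forcing m e₁ e₂ n - forcing m e₁' e₂' n := by
        simp only [forcing]
        split_ifs <;> ring
      have : (indicialPoly m k).eval (n : ℂ) * (b n - b' n) =
          forcing m (e₁ - e₁') (e₂ - e₂') n + PowerSeries.coeff n R := by
        rw [hf, mul_sub, hb n hn0, hb' n hn0, hRdef, map_sub, nonlinear, nonlinear]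
        ring
      rw [this]
      exact norm_add_le _ _
  refine (Finset.sum_le_sum fun n hn => hterm n (Finset.mem_filter.mp hn).2).trans ?_
  rw [← Finset.mul_sum, Finset.sum_add_distrib]
  refine mul_le_mul_of_nonneg_left (add_le_add (sum_norm_forcing_le m hr _ _ _) ?_) (by linarith)
  exact (Finset.sum_le_sum_of_subset_of_nonneg (Finset.filter_subset _ _)
    fun _ _ _ => by positivity).trans hR

theorem truncNorm_fluct_sub_le {m k : ℕ} {C : ℝ} {i : ℕ} (hC0 : 0 ≤ C)
    (hC : ∀ n ∈ freeFinset m k, ‖(descPoly i).eval (n : ℂ)‖ ≤ C) {r : ℝ} (hr : 0 ≤ r)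
    (b b' : ℕ → ℂ) (N : ℕ) : truncNorm N r (fluct b i - fluct b' i) ≤
      C * ∑ n ∈ freeFinset m k, ‖b n - b' n‖ * r ^ n +
      ∑ n ∈ Finset.range N with n ∉ freeFinset m k,
        ‖PowerSeries.coeff n (fluct b i - fluct b' i)‖ * r ^ n := by
  rw [truncNorm, ← Finset.sum_filter_add_sum_filter_not (Finset.range N)
    (fun n => n ∈ freeFinset m k)]
  refine add_le_add ?_ le_rfl
  have h : ∀ n ∈ freeFinset m k, ‖PowerSeries.coeff n (fluct b i - fluct b' i)‖ * r ^ n ≤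
      C * (‖b n - b' n‖ * r ^ n) := by
    intro n hn
    rw [← mul_assoc]
    refine mul_le_mul_of_nonneg_right ?_ (by positivity)
    rcases eq_or_ne n 0 with rfl | hn0
    · rw [map_sub, coeff_zero_fluct, coeff_zero_fluct, sub_zero, norm_zero]
      positivity
    · rw [map_sub, coeff_fluct b i hn0, coeff_fluct b' i hn0, ← mul_sub, norm_mul]
      exact mul_le_mul_of_nonneg_right (hC n hn) (norm_nonneg _)
  rw [Finset.mul_sum]
  refine (Finset.sum_le_sum fun n hn => h n (Finset.mem_filter.mp hn).2).trans ?_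
  exact Finset.sum_le_sum_of_subset_of_nonneg
    (fun n hn => (Finset.mem_filter.mp hn).2) fun _ _ _ => by positivity

/-- Formal solutions with small parameters are small, depend on the parameters in a Lipschitz way,
and are to first order given by the parameters. -/
theorem exists_estimates {m k : ℕ} (hk : 1 ≤ k) (hkm : k ≤ m) :
    ∃ C η : ℝ, 1 ≤ C ∧ 0 < η ∧
      ∀ (r : ℝ) (_ : 0 ≤ r) (e₁ e₂ e₁' e₂' : ℂ) (b b' : ℕ → ℂ), IsFormalSolution m k e₁ e₂ b →
      IsFormalSolution m k e₁' e₂' b' → ∀ (s : ℝ), 0 ≤ s → s ≤ η →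
      dataSize m k r e₁ e₂ b ≤ s → dataSize m k r e₁' e₂' b' ≤ s → ∀ N, ∀ i < 2 * m,
      truncNorm N r (fluct b i) ≤ C * s ∧
      truncNorm N r (fluct b i - fluct b' i) ≤
        C * dataSize m k r (e₁ - e₁') (e₂ - e₂') (b - b') ∧
      ∑ n ∈ Finset.range N with n ∉ freeFinset m k,
        ‖PowerSeries.coeff n (fluct b i - fluct b' i)‖ * r ^ n ≤
          C * (forcingSize m r (e₁ - e₁') (e₂ - e₂') +
            s * dataSize m k r (e₁ - e₁') (e₂ - e₂') (b - b')) := by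
  obtain ⟨C, B, hC1, hB0, hCf, hstep⟩ := exists_sum_nonfree_le hk hkm
  have hC0 : 0 ≤ C := by linarith
  -- Chosen so that, for `s ≤ η`, the bound `2Cs` stays below `1` and the quadratic contribution `B
  -- (2Cs)(2Cd)` is at most `d`; the bootstrap then reproduces its own constant `2C`.
  set η : ℝ := 1 / (4 * C ^ 2 * (B + 1)) with hη
  have hηpos : 0 < η := by positivity
  have hη4 : 4 * C ^ 2 * (B + 1) * η = 1 := by rw [hη]; field_simp
  have hη1 : 2 * C * η ≤ 1 := by
    have h1 := mul_nonneg (mul_nonneg (sq_nonneg C) hB0) hηpos.le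
    have h2 := mul_nonneg (mul_nonneg hC0 (sub_nonneg.mpr hC1)) hηpos.le
    have h3 := mul_nonneg hC0 hηpos.le
    linarith
  have hη2 : 4 * C ^ 2 * B * η ≤ 1 := by
    have h1 := mul_nonneg (sq_nonneg C) hηpos.le
    linarith
  have hsplit : ∀ (r : ℝ) (e₁ e₂ e₁' e₂' : ℂ) (b b' : ℕ → ℂ),
      dataSize m k r (e₁ - e₁') (e₂ - e₂') (b - b') =
        ∑ n ∈ freeFinset m k, ‖b n - b' n‖ * r ^ n + forcingSize m r (e₁ - e₁') (e₂ - e₂') :=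
    fun _ _ _ _ _ _ _ => rfl
  have hsmall : ∀ (r : ℝ) (_ : 0 ≤ r) (e₁ e₂ : ℂ) (b : ℕ → ℂ), IsFormalSolution m k e₁ e₂ b →
      ∀ s, 0 ≤ s → s ≤ η → dataSize m k r e₁ e₂ b ≤ s → ∀ N, ∀ i < 2 * m,
      truncNorm N r (fluct b i) ≤ 2 * C * s := by
    intro r hr e₁ e₂ b hb s hs hsη hbs N
    have h0 : ∀ i, fluct b i - fluct 0 i = fluct b i := fun i => by
      ext n; simp [fluct]
    have h00 : ∀ i, fluct 0 i = 0 := fun i => by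
      ext n; simp [fluct]
    have hs1 : 2 * C * s ≤ 1 := le_trans (by gcongr) hη1
    -- The bootstrap: the nonlinear terms in the first `N+1` orders are controlled by the first `N`
    -- orders, so the bound passes from `N` to `N+1` unchanged.
    induction N with
    | zero => intro i _; rw [truncNorm, Finset.sum_range_zero]; positivity
    | succ N ih =>
      intro i hi
      have h1 := hstep r hr e₁ e₂ 0 0 b 0 hb (isFormalSolution_zero m k) N (2 * C * s) (2 * C * s)
        (by positivity) hs1 (by positivity) ih
        (fun i _ => by rw [h00, truncNorm_zero]; positivity) (fun i hi => by rw [h0]; exact ih i hi)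
        i hi
      have h2 := truncNorm_fluct_sub_le hC0 (hCf i hi) hr b 0 (N + 1)
      have h3 := hsplit r e₁ e₂ 0 0 b 0
      rw [h0] at h1 h2
      simp only [sub_zero] at h1 h3
      have h4 : B * (2 * C * s) * (2 * C * s) ≤ s := by
        calc B * (2 * C * s) * (2 * C * s) = 4 * C ^ 2 * B * s * s := by ring
          _ ≤ 4 * C ^ 2 * B * η * s := by gcongr
          _ ≤ 1 * s := by gcongr
          _ = s := one_mul s
      have h5 : C * (dataSize m k r e₁ e₂ b + B * (2 * C * s) * (2 * C * s)) ≤ C * (s + s) := by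
        gcongr
      rw [h3] at h5
      nlinarith
  have hlip : ∀ (r : ℝ) (_ : 0 ≤ r) (e₁ e₂ e₁' e₂' : ℂ) (b b' : ℕ → ℂ),
      IsFormalSolution m k e₁ e₂ b → IsFormalSolution m k e₁' e₂' b' → ∀ s, 0 ≤ s → s ≤ η →
      dataSize m k r e₁ e₂ b ≤ s → dataSize m k r e₁' e₂' b' ≤ s → ∀ N, ∀ i < 2 * m,
      truncNorm N r (fluct b i - fluct b' i) ≤
        2 * C * dataSize m k r (e₁ - e₁') (e₂ - e₂') (b - b') := by
    intro r hr e₁ e₂ e₁' e₂' b b' hb hb' s hs hsη hbs hbs' N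
    have hs1 : 2 * C * s ≤ 1 := le_trans (by gcongr) hη1
    have hd0 := dataSize_nonneg m k hr (e₁ - e₁') (e₂ - e₂') (b - b')
    have h3 := hsplit r e₁ e₂ e₁' e₂' b b'
    set d := dataSize m k r (e₁ - e₁') (e₂ - e₂') (b - b') with hd
    induction N with
    | zero => intro i _; rw [truncNorm, Finset.sum_range_zero]; positivity
    | succ N ih =>
      intro i hi
      have h1 := hstep r hr e₁ e₂ e₁' e₂' b b' hb hb' N (2 * C * s) (2 * C * d)
        (by positivity) hs1 (by positivity) (hsmall r hr e₁ e₂ b hb s hs hsη hbs N)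
        (hsmall r hr e₁' e₂' b' hb' s hs hsη hbs' N) ih i hi
      have h2 := truncNorm_fluct_sub_le hC0 (hCf i hi) hr b b' (N + 1)
      have h4 : B * (2 * C * s) * (2 * C * d) ≤ d := by
        calc B * (2 * C * s) * (2 * C * d) = 4 * C ^ 2 * B * s * d := by ring
          _ ≤ 4 * C ^ 2 * B * η * d := by gcongr
          _ ≤ 1 * d := by gcongr
          _ = d := one_mul d
      have h5 : C * (d + B * (2 * C * s) * (2 * C * d)) ≤ C * (d + d) := by gcongr
      nlinarith
  -- `2C` serves the first two estimates; `4C³B` absorbs `C · B (2Cs)(2Cd)` in the third.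
  refine ⟨2 * C + 4 * C ^ 3 * B, η, ?_, hηpos, ?_⟩
  · have : 0 ≤ 4 * C ^ 3 * B := by positivity
    linarith
  intro r hr e₁ e₂ e₁' e₂' b b' hb hb' s hs hsη hbs hbs' N i hi
  have hd0 := dataSize_nonneg m k hr (e₁ - e₁') (e₂ - e₂') (b - b')
  have hf0 := forcingSize_nonneg m hr (e₁ - e₁') (e₂ - e₂')
  have hCB : 0 ≤ 4 * C ^ 3 * B := by positivity
  have hs1 : 2 * C * s ≤ 1 := le_trans (by gcongr) hη1
  refine ⟨?_, ?_, ?_⟩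
  · refine (hsmall r hr e₁ e₂ b hb s hs hsη hbs N i hi).trans ?_
    gcongr
    linarith
  · refine (hlip r hr e₁ e₂ e₁' e₂' b b' hb hb' s hs hsη hbs hbs' N i hi).trans ?_
    gcongr
    linarith
  · have h1 := hstep r hr e₁ e₂ e₁' e₂' b b' hb hb' N (2 * C * s)
      (2 * C * dataSize m k r (e₁ - e₁') (e₂ - e₂') (b - b'))
      (by positivity) hs1 (by positivity) (hsmall r hr e₁ e₂ b hb s hs hsη hbs N)
      (hsmall r hr e₁' e₂' b' hb' s hs hsη hbs' N)
      (hlip r hr e₁ e₂ e₁' e₂' b b' hb hb' s hs hsη hbs hbs' N) i hi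
    refine (Finset.sum_le_sum_of_subset_of_nonneg (Finset.filter_subset_filter _
      (Finset.range_mono (Nat.le_succ N))) fun _ _ _ => by positivity).trans (h1.trans ?_)
    have h6 : 0 ≤ s * dataSize m k r (e₁ - e₁') (e₂ - e₂') (b - b') := mul_nonneg hs hd0
    have h7 := mul_nonneg hCB hf0
    have h8 := mul_nonneg hC0 h6
    have h9 := mul_nonneg hC0 hf0
    nlinarith

/-! ### Convergence -/

theorem _root_.HasSum.of_eq {ι : Type*} {f g : ι → ℂ} {a b : ℂ} (h : HasSum f a)
    (hf : ∀ i, g i = f i) (ha : b = a) : HasSum g b := by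
  rw [ha, funext hf]
  exact h

theorem coeff_fullSeries_succ (k : ℕ) (b : ℕ → ℂ) (i n : ℕ) :
    PowerSeries.coeff n (fullSeries k b (i + 1)) =
      ((n : ℂ) - ((i + 2 : ℕ) : ℂ)) * PowerSeries.coeff n (fullSeries k b i) := by
  rcases eq_or_ne n 0 with rfl | hn
  · rw [coeff_zero_fullSeries, coeff_zero_fullSeries, Nat.factorial_succ (i + 1)]
    push_cast
    ring
  · rw [coeff_fullSeries k b _ hn, coeff_fullSeries k b _ hn, descPoly_succ, Polynomial.eval_mul]
    simp
    ring

/-- Evaluation of absolutely convergent power series commutes with polynomials. -/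
theorem hasSum_coeff_aeval {σ : Type*} (P : MvPolynomial σ ℂ) (u : σ → PowerSeries ℂ) (t : ℂ)
    (h : ∀ i, Summable fun n => ‖PowerSeries.coeff n (u i) * t ^ n‖) :
    (Summable fun n => ‖PowerSeries.coeff n (aeval u P) * t ^ n‖) ∧
    HasSum (fun n => PowerSeries.coeff n (aeval u P) * t ^ n)
      (eval (fun i => ∑' n, PowerSeries.coeff n (u i) * t ^ n) P) := by
  suffices H : (Summable fun n => ‖PowerSeries.coeff n (aeval u P) * t ^ n‖) ∧
      ∑' n, PowerSeries.coeff n (aeval u P) * t ^ n =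
      eval (fun i => ∑' n, PowerSeries.coeff n (u i) * t ^ n) P from
    ⟨H.1, H.2 ▸ H.1.of_norm.hasSum⟩
  induction P using MvPolynomial.induction_on with
  | C a =>
    have h0 : ∀ n, n ≠ 0 → PowerSeries.coeff n (aeval u (C a : MvPolynomial σ ℂ)) * t ^ n = 0 := by
      intro n hn
      rw [aeval_C, PowerSeries.algebraMap_apply, PowerSeries.coeff_C, if_neg hn, zero_mul]
    refine ⟨summable_of_ne_finset_zero (s := {0}) fun n hn => ?_, ?_⟩
    · rw [h0 n (by simpa using hn), norm_zero]
    · rw [tsum_eq_single 0 h0, eval_C, aeval_C, PowerSeries.algebraMap_apply]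
      simp
  | add p q hp hq =>
    simp only [map_add, add_mul]
    refine ⟨(hp.1.add hq.1).of_nonneg_of_le (fun _ => norm_nonneg _) fun _ => norm_add_le _ _, ?_⟩
    rw [hp.1.of_norm.tsum_add hq.1.of_norm, hp.2, hq.2]
  | mul_X p j hp =>
    have hc : ∀ n, PowerSeries.coeff n (aeval u (p * X j)) * t ^ n =
        ∑ l ∈ Finset.HasAntidiagonal.antidiagonal n, (PowerSeries.coeff l.1 (aeval u p) * t ^ l.1) *
          (PowerSeries.coeff l.2 (u j) * t ^ l.2) := by
      intro n
      rw [map_mul, aeval_X, PowerSeries.coeff_mul, Finset.sum_mul]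
      refine Finset.sum_congr rfl fun l hl => ?_
      rw [← Finset.HasAntidiagonal.mem_antidiagonal.mp hl, pow_add]
      ring
    have h1 := summable_norm_sum_mul_antidiagonal_of_summable_norm hp.1 (h j)
    have h2 := tsum_mul_tsum_eq_tsum_sum_antidiagonal_of_summable_norm hp.1 (h j)
    refine ⟨h1.congr fun n => by rw [hc], ?_⟩
    rw [tsum_congr hc, ← h2, hp.2, map_mul, eval_X]

/-- The sum of a power series with absolutely summable coefficients is differentiable. -/
theorem hasDerivAt_tsum_coeff {u : PowerSeries ℂ} {r : ℝ}
    (h : Summable fun n => ‖PowerSeries.coeff n u‖ * r ^ n) {t : ℂ} (ht : ‖t‖ < r) :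
    ∃ d, HasDerivAt (fun w => ∑' n, PowerSeries.coeff n u * w ^ n) d t ∧
      HasSum (fun n : ℕ => (n : ℂ) * PowerSeries.coeff n u * t ^ n) (t * d) := by
  have hF : ∀ n : ℕ, DifferentiableOn ℂ (fun w : ℂ => PowerSeries.coeff n u * w ^ n)
      (Metric.ball 0 r) := fun n => by fun_prop
  have hle : ∀ (n : ℕ) (w : ℂ), w ∈ Metric.ball (0 : ℂ) r →
      ‖PowerSeries.coeff n u * w ^ n‖ ≤ ‖PowerSeries.coeff n u‖ * r ^ n := by
    intro n w hw
    rw [norm_mul, norm_pow]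
    have : ‖w‖ ≤ r := by simpa using (mem_ball_zero_iff.mp hw).le
    gcongr
  have htm : t ∈ Metric.ball (0 : ℂ) r := mem_ball_zero_iff.mpr ht
  have hd := (Complex.differentiableOn_tsum_of_summable_norm h hF Metric.isOpen_ball hle
    |>.differentiableAt (Metric.isOpen_ball.mem_nhds htm)).hasDerivAt
  refine ⟨_, hd, ?_⟩
  have hs := (Complex.hasSum_deriv_of_summable_norm h hF Metric.isOpen_ball hle htm).mul_left t
  refine hs.of_eq (fun n => ?_) rfl
  rw [deriv_const_mul_field, deriv_pow_field]
  rcases n with _ | n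
  · simp
  · simp [pow_succ]
    ring

theorem aeval_pow_mul_systemPoly (m : ℕ) (s : ℂ) (y : ℕ → ℂ) :
    eval (fun i : Fin (2 * m) => s ^ ((i : ℕ) + 2) * y i) (systemPoly m) =
      s ^ (2 * m + 2) * eval (fun i : Fin (2 * m) => y i) (systemPoly m) := by
  have h1 := aeval_systemPoly m (fun i => s ^ (i + 2) * y i)
  have h2 := aeval_systemPoly m y
  rw [(painlevePoly_isWeightedHomogeneous m).aeval_pow_mul, ← h2] at h1
  exact h1

theorem hasSum_shiftSeries {p : ℕ} {f : PowerSeries ℂ} {t a : ℂ} (ht : t ≠ 0)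
    (h : HasSum (fun n => PowerSeries.coeff n f * t ^ n) a) :
    HasSum (fun l : ℤ => (shiftSeries p f).coeff l * t ^ l) ((t⁻¹) ^ p * a) := by
  have hinj : Function.Injective fun n : ℕ => (n : ℤ) - p := fun a b hab => by
    simpa using hab
  rw [← hinj.hasSum_iff]
  · refine (h.mul_left ((t⁻¹) ^ p)).of_eq (fun n => ?_) rfl
    simp only [Function.comp_apply]
    rw [coeff_shiftSeries, zpow_sub₀ ht, zpow_natCast, zpow_natCast, inv_pow]
    ring
  · intro l hl
    rw [coeff_shiftSeries_of_lt, zero_mul]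
    by_contra! hle
    exact hl ⟨(l + p).toNat, by simp only; omega⟩

/-- Formal solutions with absolutely summable coefficients are solutions. -/
theorem convergesToSolution {m k : ℕ} {z₀ : ℂ} {b : ℕ → ℂ}
    (hb : IsFormalSolution m k z₀ 1 b) (hkm : k ≤ m) {r : ℝ}
    (h : ∀ i < 2 * m, Summable fun n => ‖PowerSeries.coeff n (fullSeries k b i)‖ * r ^ n) :
    ConvergesToSolution (field m) z₀ (fun i => ∂ₜ^[i] (laurentOf k b)) r fun i z =>
      (z - z₀)⁻¹ ^ ((i : ℕ) + 2) * ∑' n, PowerSeries.coeff n (fullSeries k b i) * (z - z₀) ^ n := by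
  intro z hz0 hzr i
  have ht : z - z₀ ≠ 0 := norm_pos_iff.mp hz0
  have hsum : ∀ i < 2 * m, Summable fun n =>
      ‖PowerSeries.coeff n (fullSeries k b i) * (z - z₀) ^ n‖ := fun i hi => by
    refine (h i hi).of_nonneg_of_le (fun _ => norm_nonneg _) fun n => ?_
    rw [norm_mul, norm_pow]
    gcongr
  constructor
  · simp only [derivative_iterate_laurentOf]
    exact hasSum_shiftSeries ht (hsum i i.2).of_norm.hasSum
  · obtain ⟨d, hd, hds⟩ := hasDerivAt_tsum_coeff (h i i.2) hzr
    have hz : HasDerivAt (fun z : ℂ => z - z₀) 1 z := (hasDerivAt_id z).sub_const z₀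
    have hd' : HasDerivAt (fun z => ∑' n, PowerSeries.coeff n (fullSeries k b i) * (z - z₀) ^ n)
        d z := by
      have := HasDerivAt.comp z hd hz
      rwa [mul_one] at this
    have hp : HasDerivAt (fun z : ℂ => (z - z₀)⁻¹ ^ ((i : ℕ) + 2))
        (-(((i : ℕ) + 2 : ℕ) : ℂ) * (z - z₀)⁻¹ ^ ((i : ℕ) + 3)) z := by
      have := (hz.fun_inv ht).fun_pow ((i : ℕ) + 2)
      refine this.congr_deriv ?_
      rw [show (i : ℕ) + 2 - 1 = (i : ℕ) + 1 by omega, neg_div, one_div, ← inv_pow]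
      ring
    have hprod := hp.fun_mul hd'
    refine hprod.congr_deriv ?_
    symm
    set t := z - z₀ with htdef
    have hU := (hsum i i.2).of_norm.hasSum
    -- The operator `t d/dt - (i+2)` takes the `i`-th series to the next one. This is
    -- differentiation after removal of the powers of `t`.
    have hnext : HasSum (fun n => PowerSeries.coeff n (fullSeries k b (i + 1)) * t ^ n)
        (t * d - (((i : ℕ) + 2 : ℕ) : ℂ) *
          ∑' n, PowerSeries.coeff n (fullSeries k b i) * t ^ n) := by
      refine (hds.sub (hU.mul_left (((i : ℕ) + 2 : ℕ) : ℂ))).of_eq (fun n => ?_) rfl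
      rw [coeff_fullSeries_succ]
      ring
    have hrhs : -(((i : ℕ) + 2 : ℕ) : ℂ) * t⁻¹ ^ ((i : ℕ) + 3) *
        ∑' n, PowerSeries.coeff n (fullSeries k b i) * t ^ n + t⁻¹ ^ ((i : ℕ) + 2) * d =
        t⁻¹ ^ ((i : ℕ) + 3) * (t * d - (((i : ℕ) + 2 : ℕ) : ℂ) *
          ∑' n, PowerSeries.coeff n (fullSeries k b i) * t ^ n) := by
      rw [pow_succ t⁻¹ ((i : ℕ) + 2)]
      field_simp
      ring
    rw [hrhs, ← aeval_eq_eval]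
    show aeval _ (field m i) = _
    rw [aeval_field]
    split_ifs with hi
    · simp only [Option.elim_some]
      rw [hnext.tsum_eq]
    · have hi2 : (i : ℕ) + 1 = 2 * m := by have := i.2; omega
      have hP := (hasSum_coeff_aeval (systemPoly m)
        (fun i : Fin (2 * m) => fullSeries k b i) t fun i => hsum i i.2).2
      have hforce : HasSum (fun n => forcing m z₀ 1 n * t ^ n)
          (z₀ * t ^ (2 * m + 2) + 1 * t ^ (2 * m + 3)) := by
        refine ((hasSum_ite_eq (2 * m + 2) (z₀ * t ^ (2 * m + 2))).add
          (hasSum_ite_eq (2 * m + 3) (1 * t ^ (2 * m + 3)))).of_eq (fun n => ?_) rfl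
        simp only [forcing, add_mul, ite_mul, zero_mul]
        congr 1
        · split_ifs with h
          · rw [h]
          · rfl
        · split_ifs with h
          · rw [h]
          · rfl
      -- For the last component the next series is summed a second time through the recursion: order
      -- `0` is the indicial equation, the other orders are `hb`.
      have hsame : HasSum (fun n => PowerSeries.coeff n (fullSeries k b (i + 1)) * t ^ n)
          (eval (fun i : Fin (2 * m) => ∑' n, PowerSeries.coeff n (fullSeries k b i) * t ^ n)
            (systemPoly m) + (z₀ * t ^ (2 * m + 2) + 1 * t ^ (2 * m + 3))) := by
        refine (hP.add hforce).of_eq (fun n => ?_) rfl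
        rw [← add_mul, hi2]
        congr 1
        rcases eq_or_ne n 0 with rfl | hn
        · have h0 := coeff_laurentEval_lenard_zero hkm b
          have e : (-((2 * m + 2 : ℕ) : ℤ)) = ((0 : ℕ) : ℤ) - (2 * m + 2 : ℕ) := by simp
          rw [e, laurentEval_painlevePoly, derivative_iterate_laurentOf, coeff_shiftSeries,
            coeff_shiftSeries] at h0
          rw [h0, forcing, if_neg (by omega), if_neg (by omega), add_zero, add_zero]
        · rw [coeff_aeval_systemPoly m k b hn, coeff_fullSeries k b _ hn]
          linear_combination hb n hn
      rw [hnext.unique hsame]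
      have hhom := aeval_pow_mul_systemPoly m t⁻¹
        (fun i => ∑' n, PowerSeries.coeff n (fullSeries k b i) * t ^ n)
      simp only [Option.elim_some, Option.elim_none]
      rw [aeval_eq_eval]
      show eval _ (systemPoly m) + z = _
      rw [hhom, show (i : ℕ) + 3 = 2 * m + 2 by omega, mul_add]
      congr 1
      rw [show z = z₀ + t by rw [htdef]; ring, inv_pow]
      field_simp
      ring

theorem summable_fullSeries {k : ℕ} {b : ℕ → ℂ} {i : ℕ} {r A : ℝ} (hr : 0 ≤ r)
    (h : ∀ N, truncNorm N r (fluct b i) ≤ A) :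
    Summable fun n => ‖PowerSeries.coeff n (fullSeries k b i)‖ * r ^ n := by
  have h1 : Summable fun n => ‖PowerSeries.coeff n (fluct b i)‖ * r ^ n :=
    summable_of_sum_range_le (fun n => by positivity) h
  refine (summable_nat_add_iff 1).mp (((summable_nat_add_iff 1).mpr h1).congr fun n => ?_)
  rw [coeff_fluct b i (Nat.succ_ne_zero n), coeff_fullSeries k b i (Nat.succ_ne_zero n)]

/-- Every parameter enters `dataSize` with a positive power of `r`, so the data of any formal
solution become small as `r → 0`. The bounds of `exists_estimates`, uniform in `N`, then give
absolute summability. -/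
theorem exists_convergesToSolution {m k : ℕ} (hk : 1 ≤ k) (hkm : k ≤ m) (z₀ : ℂ)
    (x : Fin (2 * m) → LaurentSeries ℂ)
    (hx : IsLaurentSolution (field m) (weight m) (leadingCoeff m k) z₀ x) :
    ∃ r : ℝ, 0 < r ∧ ∃ ξ, ConvergesToSolution (field m) z₀ x r ξ := by
  obtain ⟨b, hb, hxb⟩ := (isLaurentSolution_iff hk hkm z₀ x).mp hx
  obtain ⟨C, η, hC1, hη, hest⟩ := exists_estimates hk hkm
  have hcont : Continuous fun r : ℝ => dataSize m k r z₀ 1 b := by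
    unfold dataSize forcingSize
    fun_prop
  have h0 : dataSize m k 0 z₀ 1 b = 0 := by
    rw [dataSize, forcingSize, Finset.sum_eq_zero, zero_pow (by omega), zero_pow (by omega)]
    · simp
    · intro n hn
      rw [← Finset.mem_coe, coe_freeFinset hk hkm] at hn
      rw [zero_pow hn.1.ne', mul_zero]
  have hev : ∀ᶠ r in nhds (0 : ℝ), dataSize m k r z₀ 1 b < η :=
    hcont.continuousAt.eventually_lt continuousAt_const (by rw [h0]; exact hη)
  obtain ⟨ε, hε, hball⟩ := Metric.eventually_nhds_iff.mp hev
  have hr : (0 : ℝ) ≤ ε / 2 := by positivity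
  have hd : dataSize m k (ε / 2) z₀ 1 b ≤ η :=
    (hball (by rw [Real.dist_eq, sub_zero, abs_of_nonneg hr]; linarith)).le
  rw [show x = fun i : Fin (2 * m) => ∂ₜ^[i] (laurentOf k b) from funext hxb]
  exact ⟨ε / 2, by positivity, _, convergesToSolution hb hkm fun i hi =>
    summable_fullSeries hr fun N =>
      (hest (ε / 2) hr z₀ 1 z₀ 1 b b hb hb η hη.le le_rfl hd hd N i hi).1⟩

/-! ### Rescaling of formal solutions -/

theorem rescale_fluct (s : ℂ) (b : ℕ → ℂ) (i : ℕ) :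
    PowerSeries.rescale s (fluct b i) = fluct (fun n => s ^ n * b n) i := by
  rw [fluct, PowerSeries.rescale_mk, fluct]
  congr 1
  funext n
  split_ifs <;> ring

theorem rescale_C (s a : ℂ) : PowerSeries.rescale s (PowerSeries.C a) = PowerSeries.C a := by
  ext n
  rw [PowerSeries.coeff_rescale, PowerSeries.coeff_C]
  split_ifs with h
  · rw [h, pow_zero, one_mul]
  · rw [mul_zero]

theorem rescale_taylorRemainder {σ : Type*} [Fintype σ] (P : MvPolynomial σ ℂ) (c : σ → ℂ)
    (v : σ → PowerSeries ℂ) (s : ℂ) :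
    PowerSeries.rescale s (taylorRemainder P c v) =
      taylorRemainder P c fun i => PowerSeries.rescale s (v i) := by
  have h : PowerSeries.rescale s (aeval (fun i => PowerSeries.C (c i) + v i) P) =
      aeval (fun i => PowerSeries.C (c i) + PowerSeries.rescale s (v i)) P := by
    rw [aeval_def, ← coe_eval₂Hom, ← RingHom.comp_apply, aeval_def, ← coe_eval₂Hom]
    congr 1
    refine MvPolynomial.ringHom_ext (fun a => ?_) fun i => ?_
    · simp only [RingHom.comp_apply, coe_eval₂Hom, eval₂_C]
      exact rescale_C s a
    · simp only [RingHom.comp_apply, coe_eval₂Hom, eval₂_X, map_add, rescale_C]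
  simp only [taylorRemainder, map_sub, map_sum, map_mul, rescale_C, h]

theorem nonlinear_pow_mul (m k : ℕ) (s : ℂ) (b : ℕ → ℂ) (n : ℕ) :
    nonlinear m k (fun n => s ^ n * b n) n = s ^ n * nonlinear m k b n := by
  rw [nonlinear, nonlinear, ← PowerSeries.coeff_rescale, rescale_taylorRemainder]
  simp only [rescale_fluct]

/-- The substitution of `s t` for `t`. It is the reason for admitting arbitrary `e₁`, `e₂` in place
of `z₀`, `1`: evaluation at `t` is reduced to evaluation at `1`, with `t` moved into the forcing. -/
theorem IsFormalSolution.pow_mul {m k : ℕ} {e₁ e₂ : ℂ} {b : ℕ → ℂ}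
    (h : IsFormalSolution m k e₁ e₂ b) (s : ℂ) :
    IsFormalSolution m k (s ^ (2 * m + 2) * e₁) (s ^ (2 * m + 3) * e₂) fun n => s ^ n * b n := by
  intro n hn
  have hf : forcing m (s ^ (2 * m + 2) * e₁) (s ^ (2 * m + 3) * e₂) n =
      s ^ n * forcing m e₁ e₂ n := by
    simp only [forcing, mul_add, mul_ite, mul_zero]
    congr 1
    · split_ifs with h
      · rw [h]
      · rfl
    · split_ifs with h
      · rw [h]
      · rfl
  rw [nonlinear_pow_mul, hf]
  linear_combination s ^ n * h n hn

theorem coeff_fullSeries_pow_mul (k : ℕ) (s : ℂ) (b : ℕ → ℂ) (i n : ℕ) :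
    PowerSeries.coeff n (fullSeries k (fun n => s ^ n * b n) i) =
      s ^ n * PowerSeries.coeff n (fullSeries k b i) := by
  rw [fullSeries, fullSeries, ← rescale_fluct, ← PowerSeries.coeff_rescale,
    map_add (PowerSeries.rescale s), rescale_C]

/-! ### The map from the free parameters to the values of the solutions -/

/-- Substituting a map with values near zero into a strictly differentiable one. -/
theorem approximatesLinearOn_comp {E F G : Type*} [NormedAddCommGroup E] [NormedSpace ℂ E]
    [NormedAddCommGroup F] [NormedSpace ℂ F] [NormedAddCommGroup G] [NormedSpace ℂ G]
    {g : F → G} {g' : F →L[ℂ] G} (hg : HasStrictFDerivAt g g' 0) (L : E →L[ℂ] F) {κ : NNReal}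
    (hκ : 0 < κ) : ∃ ε : NNReal, 0 < ε ∧ ∀ (f : E → F) (s : Set E), ApproximatesLinearOn f L s ε →
      (∀ x ∈ s, ‖f x‖ ≤ ε) → ApproximatesLinearOn (g ∘ f) (g' ∘L L) s κ := by
  set A : NNReal := ‖L‖₊ + 1 with hA
  have hApos : 0 < A := by positivity
  obtain ⟨V, hV, hgV⟩ := hg.approximates_deriv_on_nhds (c := κ / (2 * A)) (Or.inr (by positivity))
  obtain ⟨ρ, hρ, hball⟩ := Metric.mem_nhds_iff.mp hV
  -- The bound `1` makes `f` Lipschitz with constant `‖L‖ + 1`; `ρ/2` keeps its values where `g` is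
  -- nearly linear; the last bound lets `g'` spend at most `κ/2` on the error of `f`. The other
  -- `κ/2` is for the error of `g`.
  have hpos : 0 < min (min 1 (ρ.toNNReal / 2)) (κ / (2 * (‖g'‖₊ + 1))) := by
    have : 0 < ρ.toNNReal := Real.toNNReal_pos.mpr hρ
    positivity
  refine ⟨_, hpos, fun f s hf hfs => ?_⟩
  set ε := min (min 1 (ρ.toNNReal / 2)) (κ / (2 * (‖g'‖₊ + 1))) with hε
  have hε1 : (ε : ℝ) ≤ 1 := by
    exact_mod_cast (min_le_left _ _).trans (min_le_left _ _)
  have hερ : (ε : ℝ) < ρ := by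
    have h1 : ε ≤ ρ.toNNReal / 2 := (min_le_left _ _).trans (min_le_right _ _)
    have h2 : (ε : ℝ) ≤ (ρ.toNNReal : ℝ) / 2 := by exact_mod_cast h1
    rw [Real.coe_toNNReal ρ hρ.le] at h2
    linarith
  have hεκ : (ε : ℝ) * (‖g'‖ + 1) ≤ κ / 2 := by
    have h1 : ε ≤ κ / (2 * (‖g'‖₊ + 1)) := min_le_right _ _
    have h2 : (ε : ℝ) ≤ κ / (2 * (‖g'‖ + 1)) := by exact_mod_cast h1
    rw [le_div_iff₀ (by positivity)] at h2
    linarith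
  intro x hx y hy
  have hmem : ∀ z ∈ s, f z ∈ V := fun z hz =>
    hball (mem_ball_zero_iff.mpr ((hfs z hz).trans_lt hερ))
  have h1 := hgV (f x) (hmem x hx) (f y) (hmem y hy)
  have h2 := hf x hx y hy
  have h3 : ‖f x - f y‖ ≤ A * ‖x - y‖ := by
    have : f x - f y = (f x - f y - L (x - y)) + L (x - y) := by abel
    rw [this]
    refine (norm_add_le _ _).trans ?_
    have h4 := L.le_opNorm (x - y)
    have h5 : (ε : ℝ) * ‖x - y‖ ≤ 1 * ‖x - y‖ := by gcongr
    rw [hA]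
    push_cast
    linarith
  have h6 : ‖g' (f x - f y - L (x - y))‖ ≤ ‖g'‖ * (ε * ‖x - y‖) :=
    (g'.le_opNorm _).trans (by gcongr)
  have h7 : (g ∘ f) x - (g ∘ f) y - (g' ∘L L) (x - y) =
      (g (f x) - g (f y) - g' (f x - f y)) + g' (f x - f y - L (x - y)) := by
    simp only [Function.comp_apply, ContinuousLinearMap.comp_apply, map_sub]
    abel
  rw [h7]
  refine (norm_add_le _ _).trans ?_
  have h8 : ((κ / (2 * A) : NNReal) : ℝ) * ‖f x - f y‖ ≤ κ / 2 * ‖x - y‖ := by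
    calc ((κ / (2 * A) : NNReal) : ℝ) * ‖f x - f y‖
        ≤ ((κ / (2 * A) : NNReal) : ℝ) * (A * ‖x - y‖) := by gcongr
      _ = κ / 2 * ‖x - y‖ := by
        have : (A : ℝ) ≠ 0 := by exact_mod_cast hApos.ne'
        push_cast
        field_simp
  have h9 : ‖g'‖ * (ε * ‖x - y‖) ≤ κ / 2 * ‖x - y‖ := by
    have : (ε : ℝ) * ‖g'‖ ≤ κ / 2 := by
      have := ε.coe_nonneg
      linarith
    calc ‖g'‖ * (ε * ‖x - y‖) = ε * ‖g'‖ * ‖x - y‖ := by ring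
      _ ≤ _ := by gcongr
  linarith

/-- The parameters of Laurent series solutions: the displacement of the pole and the coefficients
at the free orders. -/
abbrev Params (m k : ℕ) : Type := Option (freeFinset m k) → ℂ

/-- The coefficients at the free orders. -/
def freeCoeff {m k : ℕ} (a : Params m k) (n : ℕ) : ℂ :=
  if h : n ∈ freeFinset m k then a (some ⟨n, h⟩) else 0

theorem norm_freeCoeff_le {m k : ℕ} (a : Params m k) (n : ℕ) : ‖freeCoeff a n‖ ≤ ‖a‖ := by
  rw [freeCoeff]
  split_ifs
  · exact norm_le_pi_norm a _
  · simp

/-- The linear part of the dependence of the solution on the coefficients at the free orders. -/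
def freeLin (m k : ℕ) : Params m k →L[ℂ] (Fin (2 * m) → ℂ) :=
  ∑ n : freeFinset m k, (ContinuousLinearMap.proj (some n)).smulRight
    fun i : Fin (2 * m) => (descPoly i).eval ((n : ℕ) : ℂ)

theorem freeLin_apply {m k : ℕ} (a : Params m k) (i : Fin (2 * m)) :
    freeLin m k a i = ∑ n ∈ freeFinset m k, (descPoly i).eval (n : ℂ) * freeCoeff a n := by
  rw [freeLin, sum_apply, Finset.sum_apply,
    ← Finset.sum_coe_sort _ fun n : ℕ => (descPoly i).eval (n : ℂ) * freeCoeff a n]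
  refine Finset.sum_congr rfl fun n _ => ?_
  simp [freeCoeff, mul_comm]

/-- The linear part of the dependence of the solution on all parameters. -/
def paramLin (m k : ℕ) : Params m k →L[ℂ] (Fin (2 * m) → ℂ) :=
  freeLin m k + (ContinuousLinearMap.proj none).smulRight
    fun i : Fin (2 * m) => -((i : ℂ) + 2) * leadingCoeff m k i

/-- The exponent `-1` belongs to translations in `z`: its eigenvector is the derivative of the
leading term, up to a scalar. -/
theorem eval_descPoly_neg_one (i : ℕ) :
    (descPoly i).eval (-1) * 2 = (-1) ^ i * (Nat.factorial (i + 2) : ℂ) := by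
  induction i with
  | zero => simp [descPoly_zero]
  | succ i ih =>
    rw [descPoly_succ, Polynomial.eval_mul, mul_right_comm, ih, Nat.factorial_succ (i + 2)]
    simp
    ring

/-- Each free order contributes its eigenvector, and moving the pole contributes a multiple of the
one for `-1`. For `k = 1` these are `2m` eigenvectors with distinct eigenvalues, hence a basis. -/
theorem surjective_paramLin {m : ℕ} (hm : 1 ≤ m) : Function.Surjective (paramLin m 1) := by
  classical
  set K := kovalevskayaMatrix (field m) (weight m) (leadingCoeff m 1) with hK
  let μ : Option (freeFinset m 1) → ℂ := fun o => o.elim (-1) fun n => ((n : ℕ) : ℂ)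
  have hroot : ∀ o, (indicialPoly m 1).eval (μ o) = 0 := by
    rintro (_ | n)
    · rw [indicialPoly_eval_eq_zero_iff hm, mem_exponentList]
      exact Or.inr (Or.inr (Or.inr ⟨1, ⟨le_rfl, le_rfl⟩, by simp [μ]; norm_num⟩))
    · have hn : (n : ℕ) ∈ freeOrders m 1 := by
        rw [← coe_freeFinset le_rfl hm]
        exact n.2
      exact ((mem_freeOrders_iff le_rfl hm _).mp hn).2
  have hμ : Function.Injective μ := by
    have hne : ∀ n : freeFinset m 1, (-1 : ℂ) ≠ ((n : ℕ) : ℂ) := fun n h => by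
      have h2 : (-1 : ℤ) = ((n : ℕ) : ℤ) := by exact_mod_cast h
      omega
    rintro (_ | n) (_ | n') h
    · rfl
    · exact absurd h (hne n')
    · exact absurd h.symm (hne n)
    · simp only [μ, Option.elim_some, Nat.cast_inj] at h
      rw [Subtype.ext h]
  have hli : LinearIndependent ℂ fun (o : Option (freeFinset m 1)) (i : Fin (2 * m)) =>
      (descPoly i).eval (μ o) := by
    refine Module.End.eigenvectors_linearIndependent' (Matrix.toLin' K) μ hμ _ fun o => ⟨?_, ?_⟩
    · rw [Module.End.mem_eigenspace_iff, Matrix.toLin'_apply]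
      exact kovalevskayaMatrix_mulVec m 1 (μ o) (hroot o)
    · intro h0
      have := congrFun h0 (⟨0, by omega⟩ : Fin (2 * m))
      simp [descPoly_zero] at this
  have hspan := hli.span_eq_top_of_card_eq_finrank' (by
    rw [Fintype.card_option, Fintype.card_coe, card_freeFinset hm, Module.finrank_fin_fun]
    omega)
  have hle : Submodule.span ℂ (Set.range fun (o : Option (freeFinset m 1)) (i : Fin (2 * m)) =>
      (descPoly i).eval (μ o)) ≤ LinearMap.range (paramLin m 1 : Params m 1 →ₗ[ℂ] _) := by
    rw [Submodule.span_le]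
    rintro _ ⟨o, rfl⟩
    rcases o with _ | n
    -- For `k = 1`, `-(i+2) c_i = -(-1)^i (i+2)!`, which is `-2` times the eigenvector entry.
    · refine ⟨Pi.single none (-(1 / 2)), ?_⟩
      funext i
      have hd := eval_descPoly_neg_one i
      have hz : freeLin m 1 (Pi.single none (-(1 / 2))) i = 0 := by
        rw [freeLin_apply]
        refine Finset.sum_eq_zero fun n hn => ?_
        rw [freeCoeff, dif_pos hn, Pi.single_eq_of_ne (by simp), mul_zero]
      show freeLin m 1 _ i + _ = _
      rw [hz]
      rw [Nat.factorial_succ] at hd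
      simp [leadingCoeff, μ] at hd ⊢
      linear_combination (-1 / 2) * hd
    · refine ⟨Pi.single (some n) 1, ?_⟩
      funext i
      show freeLin m 1 _ i + _ = _
      rw [freeLin_apply, Finset.sum_eq_single (n : ℕ)]
      · simp [freeCoeff, μ]
      · intro l hl hln
        rw [freeCoeff, dif_pos hl, Pi.single_eq_of_ne, mul_zero]
        simpa [Subtype.ext_iff] using hln
      · intro h
        exact absurd n.2 h
  rw [hspan, top_le_iff, LinearMap.range_eq_top] at hle
  exact hle

/-! ### The general solution -/

theorem summable_and_norm_tsum_le {u : ℕ → ℂ} {B : ℝ}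
    (h : ∀ N, ∑ n ∈ Finset.range N, ‖u n‖ ≤ B) : Summable u ∧ ‖∑' n, u n‖ ≤ B := by
  have hs : Summable fun n => ‖u n‖ := summable_of_sum_range_le (fun n => norm_nonneg _) h
  exact ⟨hs.of_norm, (norm_tsum_le_tsum_norm hs).trans
    (Real.tsum_le_of_sum_range_le (fun n => norm_nonneg _) h)⟩

/-- A `C¹` function is strictly differentiable. Applied to the rescaled forcing terms, this shows
that they do not contribute to the linear part. -/
theorem exists_norm_sub_le_of_hasDerivAt_zero {E : ℂ → ℂ} (hE : ContDiff ℂ 1 E)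
    (h' : HasDerivAt E 0 0) {ε : ℝ} (hε : 0 < ε) : ∃ ρ : ℝ, 0 < ρ ∧
      ∀ t t' : ℂ, ‖t‖ < ρ → ‖t'‖ < ρ → ‖E t - E t'‖ ≤ ε * ‖t - t'‖ := by
  have hs : HasStrictDerivAt E 0 0 := hE.contDiffAt.hasStrictDerivAt' h' one_ne_zero
  obtain ⟨V, hV, hEV⟩ := hs.hasStrictFDerivAt.approximates_deriv_on_nhds
    (c := ε.toNNReal) (Or.inr (Real.toNNReal_pos.mpr hε))
  obtain ⟨ρ, hρ, hball⟩ := Metric.mem_nhds_iff.mp hV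
  refine ⟨ρ, hρ, fun t t' ht ht' => ?_⟩
  have := hEV t (hball (mem_ball_zero_iff.mpr ht)) t' (hball (mem_ball_zero_iff.mpr ht'))
  rw [Real.coe_toNNReal ε hε.le] at this
  simpa using this

set_option maxHeartbeats 1000000 in
/-- The sums at `1` of the power series of the formal solutions with small forcing terms depend
on the parameters almost linearly. -/
theorem exists_approximatesLinearOn {m k : ℕ} (hk : 1 ≤ k) (hkm : k ≤ m) (z₁ : ℂ) {ε : NNReal}
    (hε : 0 < ε) : ∃ (r δ : ℝ) (b : Params m k → ℕ → ℂ), 0 < r ∧ 0 < δ ∧ δ ≤ ε ∧ δ < 1 ∧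
      (∀ a, IsFormalSolution m k ((r * (1 + a none)) ^ (2 * m + 2) * (z₁ - r * (1 + a none)))
        ((r * (1 + a none)) ^ (2 * m + 3)) (b a)) ∧
      (∀ a ∈ Metric.ball (0 : Params m k) δ, ∃ A, ∀ N, ∀ i < 2 * m,
        truncNorm N 2 (fluct (b a) i) ≤ A) ∧
      (∀ a ∈ Metric.ball (0 : Params m k) δ, ∀ i : Fin (2 * m),
        ‖∑' n, PowerSeries.coeff n (fluct (b a) i)‖ ≤ ε) ∧
      ApproximatesLinearOn (fun a (i : Fin (2 * m)) => ∑' n, PowerSeries.coeff n (fluct (b a) i))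
        (freeLin m k) (Metric.ball 0 δ) ε := by
  obtain ⟨C, η, hC1, hη, hest⟩ := exists_estimates hk hkm
  -- `M` bounds `dataSize` at radius `2` in terms of the largest parameter. Radius `2` rather than
  -- `1` leaves room for the evaluation point `1` in the interior of the disc.
  set M : ℝ := ∑ n ∈ freeFinset m k, (2 : ℝ) ^ n + 2 ^ (2 * m + 2) + 2 ^ (2 * m + 3) with hM
  have hS0 : (0 : ℝ) ≤ ∑ n ∈ freeFinset m k, (2 : ℝ) ^ n :=
    Finset.sum_nonneg fun _ _ => by positivity
  have hM1 : 1 ≤ M := by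
    have h1 : (1 : ℝ) ≤ 2 ^ (2 * m + 2) := one_le_pow₀ (by norm_num)
    have h2 : (0 : ℝ) ≤ 2 ^ (2 * m + 3) := by positivity
    linarith
  have hM0 : 0 < M := by linarith
  have hC0 : 0 < C := by linarith
  have hε' : (0 : ℝ) < ε := by exact_mod_cast hε
  set κ : ℝ := min (min 1 ε) (min (η / M) (ε / (2 * C * M ^ 2))) with hκ
  have hκ0 : 0 < κ := by positivity
  have hκ1 : κ ≤ 1 := (min_le_left _ _).trans (min_le_left _ _)
  have hκε : κ ≤ ε := (min_le_left _ _).trans (min_le_right _ _)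
  have hκη : M * κ ≤ η := by
    have : κ ≤ η / M := (min_le_right _ _).trans (min_le_left _ _)
    rwa [le_div_iff₀ hM0, mul_comm] at this
  have hκC : 2 * (C * M ^ 2 * κ) ≤ ε := by
    have : κ ≤ ε / (2 * C * M ^ 2) := (min_le_right _ _).trans (min_le_right _ _)
    rw [le_div_iff₀ (by positivity)] at this
    linarith
  have hMM : C * M * κ ≤ C * M ^ 2 * κ := by
    have : M ≤ M ^ 2 := by nlinarith
    gcongr
  obtain ⟨ρ₁, hρ₁, hE₁⟩ := exists_norm_sub_le_of_hasDerivAt_zero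
    (E := fun t : ℂ => t ^ (2 * m + 2) * (z₁ - t)) (by fun_prop)
    (by
      have h := (hasDerivAt_pow (2 * m + 2) (0 : ℂ)).fun_mul ((hasDerivAt_id (0 : ℂ)).const_sub z₁)
      refine h.congr_deriv ?_
      rw [zero_pow (by omega), zero_pow (by omega)]
      simp) hκ0
  obtain ⟨ρ₂, hρ₂, hE₂⟩ := exists_norm_sub_le_of_hasDerivAt_zero
    (E := fun t : ℂ => t ^ (2 * m + 3)) (by fun_prop)
    (by
      refine (hasDerivAt_pow (2 * m + 3) (0 : ℂ)).congr_deriv ?_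
      rw [zero_pow (by omega)]
      simp) hκ0
  set ρ : ℝ := min 1 (min ρ₁ ρ₂) with hρ
  have hρ0 : 0 < ρ := by positivity
  have hρ1 : ρ ≤ 1 := min_le_left _ _
  have hρle₁ : ρ ≤ ρ₁ := (min_le_right _ _).trans (min_le_left _ _)
  have hρle₂ : ρ ≤ ρ₂ := (min_le_right _ _).trans (min_le_right _ _)
  -- Together with `‖a none‖ < 1/2` this keeps `r (1 + a none)` in the ball of radius `ρ`, where the
  -- forcing terms are nearly constant.
  set r : ℝ := ρ / 2 with hr
  have hr0 : 0 < r := by positivity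
  have hb := fun a : Params m k => exists_isFormalSolution hk hkm
    ((r * (1 + a none)) ^ (2 * m + 2) * (z₁ - r * (1 + a none))) ((r * (1 + a none)) ^ (2 * m + 3))
    (freeCoeff a)
  choose b hb hfree using hb
  set δ : ℝ := min κ (1 / 2) with hδ
  have hδ0 : 0 < δ := by positivity
  have hδκ : δ ≤ κ := min_le_left _ _
  have hδ2 : δ ≤ 1 / 2 := min_le_right _ _
  have hbF : ∀ (a : Params m k), ∀ n ∈ freeFinset m k, b a n = freeCoeff a n := fun a n hn =>
    hfree a n (by rwa [← coe_freeFinset hk hkm])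
  have hthr : ∀ a ∈ Metric.ball (0 : Params m k) δ, ‖(r : ℂ) * (1 + a none)‖ < ρ := by
    intro a ha
    have h1 := (norm_le_pi_norm a none).trans_lt (mem_ball_zero_iff.mp ha)
    have h2 : ‖(1 : ℂ) + a none‖ ≤ 1 + ‖a none‖ := (norm_add_le _ _).trans (by simp)
    rw [norm_mul, Complex.norm_real, Real.norm_of_nonneg hr0.le]
    calc r * ‖1 + a none‖ ≤ r * (3 / 2) := by gcongr; linarith
      _ < ρ := by rw [hr]; linarith
  have hdiff : ∀ a a' : Params m k,
      ‖(r : ℂ) * (1 + a none) - r * (1 + a' none)‖ ≤ ‖a - a'‖ := by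
    intro a a'
    rw [← mul_sub, add_sub_add_left_eq_sub, norm_mul, Complex.norm_real, Real.norm_of_nonneg hr0.le]
    have h1 : ‖a none - a' none‖ ≤ ‖a - a'‖ := norm_le_pi_norm (a - a') none
    calc r * ‖a none - a' none‖ ≤ 1 * ‖a - a'‖ := by gcongr; linarith
      _ = _ := one_mul _
  have hforce : ∀ (e₁ e₂ : ℂ) (B : ℝ), ‖e₁‖ ≤ B → ‖e₂‖ ≤ B →
      forcingSize m 2 e₁ e₂ ≤ B * 2 ^ (2 * m + 2) + B * 2 ^ (2 * m + 3) := by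
    intro e₁ e₂ B h1 h2
    rw [forcingSize]
    gcongr
  have hdata : ∀ (e₁ e₂ : ℂ) (β : ℕ → ℂ) (B : ℝ), ‖e₁‖ ≤ B → ‖e₂‖ ≤ B →
      (∀ n ∈ freeFinset m k, ‖β n‖ ≤ B) → dataSize m k 2 e₁ e₂ β ≤ M * B := by
    intro e₁ e₂ β B h1 h2 h3
    have h4 : ∑ n ∈ freeFinset m k, ‖β n‖ * 2 ^ n ≤ ∑ n ∈ freeFinset m k, B * 2 ^ n :=
      Finset.sum_le_sum fun n hn => by
        have := h3 n hn
        gcongr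
    rw [← Finset.mul_sum] at h4
    have := hforce e₁ e₂ B h1 h2
    rw [dataSize, hM]
    linarith
  have hsize : ∀ a ∈ Metric.ball (0 : Params m k) δ,
      dataSize m k 2 ((r * (1 + a none)) ^ (2 * m + 2) * (z₁ - r * (1 + a none)))
        ((r * (1 + a none)) ^ (2 * m + 3)) (b a) ≤ M * κ := by
    intro a ha
    have ht := hthr a ha
    refine hdata _ _ _ κ ?_ ?_ fun n hn => ?_
    · have := hE₁ _ 0 (ht.trans_le hρle₁) (by simpa using hρ₁)
      simp only [zero_pow (show 2 * m + 2 ≠ 0 by omega), zero_mul, sub_zero] at this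
      exact this.trans (mul_le_of_le_one_right hκ0.le (ht.le.trans hρ1))
    · have := hE₂ _ 0 (ht.trans_le hρle₂) (by simpa using hρ₂)
      simp only [zero_pow (show 2 * m + 3 ≠ 0 by omega), sub_zero] at this
      exact this.trans (mul_le_of_le_one_right hκ0.le (ht.le.trans hρ1))
    · rw [hbF a n hn]
      exact (norm_freeCoeff_le a n).trans ((mem_ball_zero_iff.mp ha).le.trans hδκ)
  have hle2 : ∀ x : ℂ, ∀ n : ℕ, ‖x‖ ≤ ‖x‖ * 2 ^ n := fun x n =>
    le_mul_of_one_le_right (norm_nonneg _) (one_le_pow₀ (by norm_num))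
  have hself : ∀ a ∈ Metric.ball (0 : Params m k) δ, ∀ N, ∀ i < 2 * m,
      truncNorm N 2 (fluct (b a) i) ≤ C * (M * κ) := fun a ha N i hi =>
    (hest 2 (by norm_num) _ _ _ _ _ _ (hb a) (hb a) (M * κ) (by positivity) hκη
      (hsize a ha) (hsize a ha) N i hi).1
  have hsum : ∀ a ∈ Metric.ball (0 : Params m k) δ, ∀ i : Fin (2 * m),
      (Summable fun n => PowerSeries.coeff n (fluct (b a) i)) ∧
      ‖∑' n, PowerSeries.coeff n (fluct (b a) i)‖ ≤ C * (M * κ) := fun a ha i =>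
    summable_and_norm_tsum_le fun N =>
      (Finset.sum_le_sum fun n _ => hle2 _ n).trans (hself a ha N i i.2)
  refine ⟨r, δ, b, hr0, hδ0, hδκ.trans hκε, by linarith, hb, fun a ha => ⟨_, hself a ha⟩,
    fun a ha i => (hsum a ha i).2.trans ?_, fun a ha a' ha' => ?_⟩
  · have : 0 ≤ C * M ^ 2 * κ := by positivity
    linarith
  · rw [pi_norm_le_iff_of_nonneg (mul_nonneg hε'.le (norm_nonneg _))]
    intro i
    have hD0 := norm_nonneg (a - a')
    have hd₁ := hE₁ _ _ ((hthr a ha).trans_le hρle₁) ((hthr a' ha').trans_le hρle₁)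
    have hd₂ := hE₂ _ _ ((hthr a ha).trans_le hρle₂) ((hthr a' ha').trans_le hρle₂)
    have hκd : κ * ‖(r : ℂ) * (1 + a none) - r * (1 + a' none)‖ ≤ κ * ‖a - a'‖ :=
      mul_le_mul_of_nonneg_left (hdiff a a') hκ0.le
    have hκD : κ * ‖a - a'‖ ≤ ‖a - a'‖ := mul_le_of_le_one_left hD0 hκ1
    have hF := hforce _ _ _ (hd₁.trans hκd) (hd₂.trans hκd)
    have hFM : κ * ‖a - a'‖ * 2 ^ (2 * m + 2) + κ * ‖a - a'‖ * 2 ^ (2 * m + 3) ≤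
        M * (κ * ‖a - a'‖) := by
      have : 0 ≤ κ * ‖a - a'‖ * ∑ n ∈ freeFinset m k, (2 : ℝ) ^ n := by positivity
      rw [hM]
      linarith
    have hfc : ∀ n, freeCoeff a n - freeCoeff a' n = freeCoeff (a - a') n := fun n => by
      simp only [freeCoeff]
      split_ifs
      · rfl
      · simp
    have hdat := hdata _ _ (b a - b a') ‖a - a'‖ ((hd₁.trans hκd).trans hκD)
      ((hd₂.trans hκd).trans hκD) fun n hn => by
        rw [Pi.sub_apply, hbF a n hn, hbF a' n hn, hfc]
        exact norm_freeCoeff_le _ n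
    set u : ℕ → ℂ := fun n => PowerSeries.coeff n (fluct (b a) i - fluct (b a') i) with hu
    -- The free orders of the difference are exactly linear in the parameters and sum to `freeLin`;
    -- all other orders form the error, bounded by the third part of `exists_estimates`.
    set v : ℕ → ℂ := fun n => if n ∈ freeFinset m k then u n else 0 with hv
    have hbound : ∀ N, ∑ n ∈ Finset.range N, ‖u n - v n‖ ≤ ε * ‖a - a'‖ := by
      intro N
      have h3 := (hest 2 (by norm_num) _ _ _ _ _ _ (hb a) (hb a') (M * κ) (by positivity) hκη
        (hsize a ha) (hsize a' ha') N i i.2).2.2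
      have h4 : ∑ n ∈ Finset.range N, ‖u n - v n‖ ≤
          ∑ n ∈ Finset.range N with n ∉ freeFinset m k, ‖u n‖ * 2 ^ n := by
        rw [Finset.sum_filter]
        refine Finset.sum_le_sum fun n _ => ?_
        by_cases h : n ∈ freeFinset m k
        · simp [hv, h]
        · rw [if_pos h, hv]
          simp only [if_neg h, sub_zero]
          exact hle2 _ n
      refine (h4.trans h3).trans ?_
      calc C * (forcingSize m 2 _ _ + M * κ * dataSize m k 2 _ _ (b a - b a'))
          ≤ C * (M * (κ * ‖a - a'‖) + M * κ * (M * ‖a - a'‖)) := by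
            have := hF.trans hFM
            gcongr
        _ = (C * M * κ + C * M ^ 2 * κ) * ‖a - a'‖ := by ring
        _ ≤ ε * ‖a - a'‖ := by
            gcongr
            linarith
    have hfin := (summable_and_norm_tsum_le hbound).2
    have hv' : HasSum v (freeLin m k (a - a') i) := by
      have h5 : HasSum v (∑ n ∈ freeFinset m k, v n) :=
        hasSum_sum_of_ne_finset_zero fun n hn => if_neg hn
      rw [freeLin_apply]
      refine h5.of_eq (fun _ => rfl) (Finset.sum_congr rfl fun n hn => ?_)
      have hn0 : n ≠ 0 := by
        have h6 : n ∈ freeOrders m k := by rwa [← coe_freeFinset hk hkm]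
        exact h6.1.ne'
      simp only [hv, if_pos hn, hu, map_sub]
      rw [coeff_fluct _ _ hn0, coeff_fluct _ _ hn0, hbF a n hn, hbF a' n hn, ← hfc, mul_sub]
    have hu' : HasSum u (∑' n, PowerSeries.coeff n (fluct (b a) i) -
        ∑' n, PowerSeries.coeff n (fluct (b a') i)) :=
      ((hsum a ha i).1.hasSum.sub (hsum a' ha' i).1.hasSum).of_eq (fun n => map_sub _ _ _) rfl
    have hw := (hu'.sub hv').tsum_eq
    rwa [hw] at hfin

/-- The derivative at zero of the map `(θ, w) ↦ (1 + θ) ^ (-(i + 2)) (c_i + w_i)`. -/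
theorem hasStrictFDerivAt_scaling {n : ℕ} (c : Fin n → ℂ) :
    HasStrictFDerivAt (fun (p : ℂ × (Fin n → ℂ)) (i : Fin n) => (1 + p.1)⁻¹ ^ ((i : ℕ) + 2) * (c i + p.2 i))
      (ContinuousLinearMap.snd ℂ ℂ (Fin n → ℂ) +
        (ContinuousLinearMap.fst ℂ ℂ (Fin n → ℂ)).smulRight
          fun i : Fin n => -((i : ℂ) + 2) * c i) 0 := by
  rw [hasStrictFDerivAt_pi']
  intro i
  have h1 : HasStrictDerivAt (fun θ : ℂ => (1 + θ)⁻¹ ^ ((i : ℕ) + 2)) (-((i : ℂ) + 2))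
      (0 : ℂ × (Fin n → ℂ)).1 := by
    have h2 : HasDerivAt (fun θ : ℂ => 1 + θ) 1 0 := (hasDerivAt_id 0).const_add 1
    have h3 : ContDiffAt ℂ 1 (fun θ : ℂ => (1 + θ)⁻¹ ^ ((i : ℕ) + 2)) 0 :=
      ((contDiffAt_const.add contDiffAt_id).inv (by simp)).pow _
    refine h3.hasStrictDerivAt' (((h2.fun_inv (by simp)).fun_pow ((i : ℕ) + 2)).congr_deriv ?_)
      one_ne_zero
    simp
  have h3 := h1.comp_hasStrictFDerivAt (0 : ℂ × (Fin n → ℂ))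
    (ContinuousLinearMap.fst ℂ ℂ (Fin n → ℂ)).hasStrictFDerivAt
  have h4 : HasStrictFDerivAt (fun p : ℂ × (Fin n → ℂ) => c i + p.2 i)
      ((ContinuousLinearMap.proj i).comp (ContinuousLinearMap.snd ℂ ℂ (Fin n → ℂ))) 0 :=
    (((ContinuousLinearMap.proj (R := ℂ) (φ := fun _ : Fin n => ℂ) i).comp
      (ContinuousLinearMap.snd ℂ ℂ (Fin n → ℂ))).hasStrictFDerivAt).const_add (c i)
  refine (h3.mul h4).congr_fderiv ?_
  ext p <;> simp
  ring

/-- With `z₁ - z₀ = r (1 + θ)`, the parameters are `θ` and the rescaled free coefficients. After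
removal of the powers of `r`, the values at `z₁` are `(1+θ)^(-(i+2)) (c_i + w_i)`, with `w` almost
linear in the parameters. The composite is approximated by the surjective `paramLin`, so its image
of a ball is open. -/
theorem representsGeneralSolution {m : ℕ} (hm : 1 ≤ m) :
    RepresentsGeneralSolution (field m) (weight m) (leadingCoeff m 1) := by
  intro z₁
  obtain ⟨R, hR⟩ := (paramLin m 1).exists_nonlinearRightInverse_of_surjective
    (LinearMap.range_eq_top.mpr (surjective_paramLin hm))
  obtain ⟨ε, hε, hcomp⟩ := approximatesLinearOn_comp
    (hasStrictFDerivAt_scaling (leadingCoeff m 1))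
    ((ContinuousLinearMap.proj none).prod (freeLin m 1)) (κ := R.nnnorm⁻¹ / 2) (by positivity)
  obtain ⟨r, δ, b, hr, hδ, hδε, hδ1, hb, hA, hw, happ⟩ :=
    exists_approximatesLinearOn le_rfl hm z₁ hε
  set f : Params m 1 → ℂ × (Fin (2 * m) → ℂ) := fun a =>
    (a none, fun i => ∑' n, PowerSeries.coeff n (fluct (b a) i)) with hf
  have hf1 : ApproximatesLinearOn f ((ContinuousLinearMap.proj none).prod (freeLin m 1))
      (Metric.ball 0 δ) ε := by
    intro a ha a' ha'
    rw [Prod.norm_def, max_le_iff]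
    refine ⟨?_, happ a ha a' ha'⟩
    simp [hf]
    positivity
  have hf2 : ∀ a ∈ Metric.ball (0 : Params m 1) δ, ‖f a‖ ≤ ε := by
    intro a ha
    rw [Prod.norm_def, max_le_iff]
    exact ⟨(norm_le_pi_norm a none).trans ((mem_ball_zero_iff.mp ha).le.trans hδε),
      (pi_norm_le_iff_of_nonneg ε.coe_nonneg).mpr (hw a ha)⟩
  have hΨ := hcomp f _ hf1 hf2
  have hlin : (ContinuousLinearMap.snd ℂ ℂ (Fin (2 * m) → ℂ) +
      (ContinuousLinearMap.fst ℂ ℂ (Fin (2 * m) → ℂ)).smulRight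
        fun i : Fin (2 * m) => -((i : ℂ) + 2) * leadingCoeff m 1 i) ∘L
      ((ContinuousLinearMap.proj none).prod (freeLin m 1)) = paramLin m 1 := rfl
  rw [hlin] at hΨ
  -- The approximation constant was fixed as half the inverse norm of a right inverse of `paramLin`,
  -- which is the smallness required for openness.
  have hopen := hΨ.open_image R Metric.isOpen_ball
    (Or.inr (NNReal.half_lt_self (inv_pos.mpr hR).ne'))
  have hrC : (r : ℂ) ≠ 0 := by exact_mod_cast hr.ne'
  refine ⟨(fun (y : Fin (2 * m) → ℂ) (i : Fin (2 * m)) => (r : ℂ) ^ ((i : ℕ) + 2) * y i) ⁻¹' _,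
    hopen.preimage (by fun_prop), ?_, ?_⟩
  · refine ⟨fun i => ((r : ℂ) ^ ((i : ℕ) + 2))⁻¹ *
      ((1 + (f 0).1)⁻¹ ^ ((i : ℕ) + 2) * (leadingCoeff m 1 i + (f 0).2 i)), 0,
      Metric.mem_ball_self hδ, ?_⟩
    funext i
    exact (mul_inv_cancel_left₀ (pow_ne_zero _ hrC) _).symm
  · rintro y ⟨a, ha, hy⟩
    have hθ : ‖a none‖ < 1 :=
      ((norm_le_pi_norm a none).trans_lt (mem_ball_zero_iff.mp ha)).trans hδ1
    have h1θ : 1 + a none ≠ 0 := fun h => by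
      rw [add_comm, add_eq_zero_iff_eq_neg] at h
      rw [h, norm_neg, norm_one] at hθ
      exact lt_irrefl _ hθ
    set t : ℂ := r * (1 + a none) with ht
    have ht0 : t ≠ 0 := mul_ne_zero hrC h1θ
    have htn : 0 < ‖t‖ := norm_pos_iff.mpr ht0
    -- Undoing the rescaling turns the forcing back into `z₀ = z₁ - t` and `1`, so a genuine
    -- solution with pole at `z₁ - t` results.
    have hsol : IsFormalSolution m 1 (z₁ - t) 1 fun n => t⁻¹ ^ n * b a n := by
      have := (hb a).pow_mul t⁻¹
      rwa [← ht, ← mul_assoc, ← mul_pow, ← mul_pow, inv_mul_cancel₀ ht0, one_pow, one_pow,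
        one_mul] at this
    obtain ⟨A, hAa⟩ := hA a ha
    have hsummable : ∀ i < 2 * m, Summable fun n =>
        ‖PowerSeries.coeff n (fullSeries 1 (b a) i)‖ * 2 ^ n := fun i hi =>
      summable_fullSeries (by norm_num) fun N => hAa N i hi
    -- Summability at radius `2` before the rescaling becomes convergence in the disc of radius
    -- `2‖t‖`, which contains `z₁` at distance `‖t‖` from the pole.
    have hconv := convergesToSolution (r := 2 * ‖t‖) hsol hm fun i hi => by
      refine (hsummable i hi).congr fun n => ?_
      rw [coeff_fullSeries_pow_mul, norm_mul, norm_pow, norm_inv, mul_pow, inv_pow]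
      have := pow_ne_zero n htn.ne'
      field_simp
    refine ⟨z₁ - t, _, _, _, (isLaurentSolution_iff le_rfl hm _ _).mpr ⟨_, hsol, fun i => rfl⟩,
      hconv, ?_, ?_, fun i => ?_⟩
    · rwa [sub_sub_cancel]
    · rw [sub_sub_cancel]
      linarith
    · have hsum1 : Summable fun n => PowerSeries.coeff n (fullSeries 1 (b a) i) :=
        ((hsummable i i.2).of_nonneg_of_le (fun _ => norm_nonneg _) fun n =>
          le_mul_of_one_le_right (norm_nonneg _) (one_le_pow₀ (by norm_num))).of_norm
      have hval : ∑' n, PowerSeries.coeff n (fullSeries 1 (b a) i) =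
          leadingCoeff m 1 i + ∑' n, PowerSeries.coeff n (fluct (b a) i) := by
        have hs2 : Summable fun n => PowerSeries.coeff n (fluct (b a) i) :=
          (summable_and_norm_tsum_le fun N => (Finset.sum_le_sum fun n _ =>
            le_mul_of_one_le_right (norm_nonneg _) (one_le_pow₀ (by norm_num))).trans
            (hAa N i i.2)).1
        have hs3 := hasSum_ite_eq (0 : ℕ) (leadingCoeff m 1 i)
        refine ((hs3.add hs2.hasSum).of_eq (fun n => ?_) rfl).tsum_eq
        rw [fullSeries, map_add, PowerSeries.coeff_C]
        congr 1
        split_ifs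
        · rw [leadingCoeff]
          push_cast
          ring
        · rfl
      have hyi := congrFun hy i
      simp only [Function.comp_apply, hf] at hyi
      rw [← hval] at hyi
      simp only [sub_sub_cancel, coeff_fullSeries_pow_mul]
      have hone : ∀ n, t⁻¹ ^ n * PowerSeries.coeff n (fullSeries 1 (b a) i) * t ^ n =
          PowerSeries.coeff n (fullSeries 1 (b a) i) := fun n => by
        rw [inv_pow]
        have := pow_ne_zero n ht0
        field_simp
      rw [tsum_congr hone, ht, mul_inv, mul_pow, mul_assoc, hyi, inv_pow,
        inv_mul_cancel_left₀ (pow_ne_zero _ hrC)]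

end PainleveI

end

/-- Kovalevskaya exponents and free parameters of the Laurent series solutions of the first
Painlevé hierarchy. The free parameters are the pole `z₀` and the coefficients of
`(z - z₀)^(-2 + n)` in `x_1`, for the positive exponents `n`; `2 * m - k + 1` in total. -/
theorem theorem4p1 (m k : ℕ) (hk : 1 ≤ k) (hkm : k ≤ m) :
    PainleveI.IsIndicialRoot (PainleveI.field m) (PainleveI.weight m)
      (PainleveI.leadingCoeff m k) ∧
    PainleveI.kovalevskayaExponents (PainleveI.field m) (PainleveI.weight m)
        (PainleveI.leadingCoeff m k) =
      (Finset.Icc 1 (m - k)).val.map (fun i : ℕ => 2 * (i : ℂ))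
      + (Finset.Icc (k + 1) m).val.map (fun i : ℕ => 2 * (i : ℂ) + 1)
      + (Finset.Icc 1 k).val.map (fun i : ℕ => 2 * (m : ℂ) + 2 * (i : ℂ) + 2)
      + (Finset.Icc 1 k).val.map (fun i : ℕ => -(2 * (i : ℂ) - 1)) ∧
    (PainleveI.freeOrders m k).ncard + 1 = 2 * m - k + 1 ∧
    (∀ (z₀ : ℂ) (α : PainleveI.freeOrders m k → ℂ),
      ∃! x : Fin (2 * m) → LaurentSeries ℂ,
        PainleveI.IsLaurentSolution (PainleveI.field m) (PainleveI.weight m)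
          (PainleveI.leadingCoeff m k) z₀ x ∧
        ∀ n : PainleveI.freeOrders m k,
          (x ⟨0, by omega⟩).coeff (-2 + ((n : ℕ) : ℤ)) = α n) ∧
    (∀ (z₀ : ℂ) (x : Fin (2 * m) → LaurentSeries ℂ),
      PainleveI.IsLaurentSolution (PainleveI.field m) (PainleveI.weight m)
        (PainleveI.leadingCoeff m k) z₀ x →
      ∃ r : ℝ, 0 < r ∧ ∃ ξ : Fin (2 * m) → ℂ → ℂ,
        PainleveI.ConvergesToSolution (PainleveI.field m) z₀ x r ξ) ∧
    (k = 1 → PainleveI.RepresentsGeneralSolution (PainleveI.field m) (PainleveI.weight m)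
      (PainleveI.leadingCoeff m k)) :=
  ⟨PainleveI.isIndicialRoot_leadingCoeff hkm, PainleveI.kovalevskayaExponents_eq hk hkm,
    by rw [PainleveI.ncard_freeOrders hk hkm],
    fun z₀ α => PainleveI.existsUnique_isLaurentSolution hk hkm _ z₀ α,
    PainleveI.exists_convergesToSolution hk hkm,
    fun h => h ▸ PainleveI.representsGeneralSolution (h ▸ hkm)⟩
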